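/- **Conventions.** A Boolean function $F$ over $n\in\mathbb N$ variables $X_1,\dots,X_n$ (not all of which need occur) is given by a formula built from the variables and the constants $0,1$ with $\wedge,\vee,\neg$. For $T\subseteq[n]$ let $F[T]\in\{0,1\}$ be its value when exactly the variables $X_i$ with $i\in T$ are set to $1$. Put $$\#F=\sum_{T\subseteq[n]}F[T],\qquad \#_kF=\sum_{T\subseteq[n],\,|T|=k}F[T],\qquad \mathrm{Shap}(F,X_i)=\frac1{n!}\sum_{\Pi\in S_n}\bigl(F[\Pi^{<i}\cup\{i\}]-F[\Pi^{<i}]\bigr),$$ where $\Pi^{<i}$ is the set of indices that come before $i$ in the permutation $\Pi$. An OR-substitution replaces every variable $X_i$ of $F$ by a disjunction $Z_i^1\vee\dots\vee Z_i^{m_i}$ of $m_i\ge 0$ fresh variables (by $0$ if $m_i=0$); the result is a function over the $\sum_i m_i$ variables $Z_i^j$, which may be numbered in any order. For a class $\mathcal C$ of Boolean functions let $\widetilde{\mathcal C}$ be the class of all functions obtained from functions in $\mathcal C$ by OR-substitutions. Consider the following problems, where the input is $F\in\mathcal C$ over $n$ variables, and the size of the input counts $n$ as well as the size of the formula: * $\#\mathcal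 C$: compute $\#F$; * $\#_*\mathcal C$: compute $(\#_0F,\#_1F,\dots,\#_nF)$; * $\mathrm{Shap}(\mathcal C)$: compute $(\mathrm{Shap}(F,X_1),\dots,\mathrm{Shap}(F,X_n))$. Integers are output in binary, and rational numbers as reduced fractions of integers in binary. A polynomial-time (Cook) reduction $A\le^P B$ is a polynomial-time algorithm for $A$ with access to an oracle for $B$. **Theorem.** 1. For every class $\mathcal C$ of Boolean functions given by formulas, $$\mathrm{Shap}(\mathcal C)\le^P\#_*\widetilde{\mathcal C},\qquad \#_*\mathcal C\le^P\#\widetilde{\mathcal C},\qquad \#\mathcal C\le^P\mathrm{Shap}(\widetilde{\mathcal C}).$$ 2. The same holds for other representations (such as circuits) in which OR-substitutions can be computed in polynomial time. Precisely, let $\mathcal C$ and $\mathcal C'$ be classes of Boolean functions, each with a representation of its members by finite data, and suppose that, given $F\in\mathcal C$ over $n$ variables and $m_1,\dots,m_n\in\mathbb N$, one can compute, in time polynomial in the size of $F$ (including $n$) and $\sum_i m_i$, a representation in $\mathcal C'$ of the function $F[X_i:=Z_i^1\vee\dots\vee Z_i^{m_i},\ i\in[n]]$ over the variables $Z_1^1,\dots,Z_1^{m_1},Z_2^1,\dots,Z_n^{m_n}$.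 Then $$\mathrm{Shap}(\mathcal C)\le^P\#_*\mathcal C'\qquad\text{and}\qquad \#_*\mathcal C\le^P\#\mathcal C';$$ and if, moreover, $F\mapsto F[\emptyset]$ (the value of $F$ when all variables are $0$) can be computed in polynomial time on $\mathcal C$, then $\#\mathcal C\le^P\mathrm{Shap}(\mathcal C')$. -/

import Mathlib

/-! ## Boolean functions, model counts, Shapley values -/

/-- A Boolean function on `n` variables (as a mapping). -/
abbrev BoolFn (n : ℕ) : Type := (Fin n → Bool) → Bool

namespace BoolFn

/-- `F[T]`: the value of `F`, as `0` or `1`, on the valuation that sets exactly the variables of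
`T` to true. -/
def valueOn {n : ℕ} (F : BoolFn n) (T : Finset (Fin n)) : ℕ :=
  if F (fun i => decide (i ∈ T)) = true then 1 else 0

/-- The model count `#F`. -/
def modelCount {n : ℕ} (F : BoolFn n) : ℕ := ∑ T : Finset (Fin n), F.valueOn T

/-- The number `#ₖF` of models of size `k`. -/
def modelCountOfSize {n : ℕ} (F : BoolFn n) (k : ℕ) : ℕ :=
  ∑ T ∈ Finset.powersetCard k (Finset.univ : Finset (Fin n)), F.valueOn T

/-- `Π^{<i}`: the indices that come before `i` in the sequence `Π 0, Π 1, …, Π (n-1)`. -/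
def before {n : ℕ} (p : Equiv.Perm (Fin n)) (i : Fin n) : Finset (Fin n) :=
  Finset.univ.filter fun j => p.symm j < p.symm i

/-- The Shapley value of the variable `i` of `F`. -/
def shapley {n : ℕ} (F : BoolFn n) (i : Fin n) : ℚ :=
  (1 / (n.factorial : ℚ)) *
    ∑ p : Equiv.Perm (Fin n), ((F.valueOn (before p i ∪ {i}) : ℚ) - (F.valueOn (before p i) : ℚ))

/-- `G = F[θ]` for `θ = {Xᵢ := Zᵢ¹ ∨ ⋯ ∨ Zᵢ^{mᵢ}}`, where `Zᵢʲ` is the variable number `e ⟨i, j⟩`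
of `G`. -/
def IsORSubst {n N : ℕ} (F : BoolFn n) (m : Fin n → ℕ) (e : (Σ i : Fin n, Fin (m i)) ≃ Fin N)
    (G : BoolFn N) : Prop :=
  ∀ v : Fin N → Bool, G v = F (fun i => decide (∃ j : Fin (m i), v (e ⟨i, j⟩) = true))

end BoolFn

/-! ## Formulas -/

/-- Formulas over the variables `X_0, …, X_{n-1}`. -/
inductive BoolFormula (n : ℕ) : Type
  | const (b : Bool)
  | var (i : Fin n)
  | neg (f : BoolFormula n)
  | and (f g : BoolFormula n)
  | or (f g : BoolFormula n)

namespace BoolFormula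

/-- The Boolean function of a formula. -/
def eval {n : ℕ} : BoolFormula n → BoolFn n
  | const b => fun _ => b
  | var i => fun v => v i
  | neg f => fun v => !(f.eval v)
  | and f g => fun v => f.eval v && g.eval v
  | or f g => fun v => f.eval v || g.eval v

/-- `F[θ]`. -/
def subst {n N : ℕ} (θ : Fin n → BoolFormula N) : BoolFormula n → BoolFormula N
  | const b => const b
  | var i => θ i
  | neg f => neg (f.subst θ)
  | and f g => and (f.subst θ) (g.subst θ)
  | or f g => or (f.subst θ) (g.subst θ)

/-- The disjunction of a list of variables; the empty disjunction is the constant `0`, and the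
disjunction of one variable is that variable. -/
def disj {N : ℕ} : List (Fin N) → BoolFormula N
  | [] => const false
  | [x] => var x
  | x :: y :: l => or (var x) (disj (y :: l))

end BoolFormula

/-- A formula together with the number of its variables (some of which may not occur in it). -/
abbrev AnyFormula : Type := Σ n : ℕ, BoolFormula n

/-- `F` admits an OR-substitution into `G`: each variable `Xᵢ` of `F` is replaced by a disjunction
of `mᵢ ≥ 0` fresh variables, and `G` is over these `∑ mᵢ` variables. The bijection `e` is the
naming of the fresh variables by the variables of `G`. -/
def ORSubstitutesTo (F G : AnyFormula) : Prop :=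
  ∃ (m : Fin F.1 → ℕ) (e : (Σ i : Fin F.1, Fin (m i)) ≃ Fin G.1),
    G.2 = F.2.subst fun i => BoolFormula.disj (List.ofFn fun j : Fin (m i) => e ⟨i, j⟩)

/-- The class `C̃` of all functions obtained from functions of `C` by OR-substitutions. -/
def orClosure (C : Set AnyFormula) : Set AnyFormula := {G | ∃ F ∈ C, ORSubstitutesTo F G}

/-! ## The machine model: while-programs over trees with integer leaves, at bit cost, with an oracle -/

/-- The data of the machines: binary trees with integers at the leaves. -/
inductive Data : Type
  | int (z : ℤ)
  | pair (a b : Data)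

namespace Data

/-- Size in memory; an integer counts with its number of binary digits. -/
def size : Data → ℕ
  | int z => 1 + Nat.size z.natAbs
  | pair a b => 1 + a.size + b.size

/-- The integer at a leaf (`0` for a pair). -/
def toInt : Data → ℤ
  | int z => z
  | pair _ _ => 0

def fst : Data → Data
  | int _ => int 0
  | pair a _ => a

def snd : Data → Data
  | int _ => int 0
  | pair _ b => b

def isPair : Data → Data
  | int _ => int 0
  | pair _ _ => int 1

/-- The truth value of a test: every datum but the integer `0` counts as true. -/
def truthy : Data → Bool
  | int z => decide (z ≠ 0)
  | pair _ _ => true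

/-- Lists are nested pairs that end in `int 0`. -/
def ofList : List Data → Data
  | [] => int 0
  | a :: l => pair a (ofList l)

/-- The number `n` in unary. -/
def unary (n : ℕ) : Data := ofList (List.replicate n (int 0))

/-- A rational number: numerator and (positive) denominator, in lowest terms, in binary. -/
def ofRat (q : ℚ) : Data := pair (int q.num) (int (q.den : ℤ))

end Data

/-- A store assigns a datum to each program variable. -/
abbrev Store : Type := ℕ → Data

/-- Expressions. -/
inductive Expr : Type
  | var (x : ℕ)
  | const (z : ℤ)
  | pair (e f : Expr)
  | fst (e : Expr)
  | snd (e : Expr)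
  | isPair (e : Expr)
  | add (e f : Expr)
  | sub (e f : Expr)
  | mul (e f : Expr)
  | div (e f : Expr)
  | le (e f : Expr)

namespace Expr

/-- The value of an expression. -/
def eval (s : Store) : Expr → Data
  | var x => s x
  | const z => .int z
  | pair e f => .pair (e.eval s) (f.eval s)
  | fst e => (e.eval s).fst
  | snd e => (e.eval s).snd
  | isPair e => (e.eval s).isPair
  | add e f => .int ((e.eval s).toInt + (f.eval s).toInt)
  | sub e f => .int ((e.eval s).toInt - (f.eval s).toInt)
  | mul e f => .int ((e.eval s).toInt * (f.eval s).toInt)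
  | div e f => .int ((e.eval s).toInt / (f.eval s).toInt)
  | le e f => .int (if (e.eval s).toInt ≤ (f.eval s).toInt then 1 else 0)

/-- The time to evaluate an expression. Reading a variable, forming a pair and taking a component
cost the size of the datum copied or scanned; arithmetic and comparison cost the product of the
sizes of the two arguments (schoolbook bit cost). -/
def cost (s : Store) : Expr → ℕ
  | var x => (s x).size
  | const z => (Data.int z).size
  | pair e f => e.cost s + f.cost s + (1 + (e.eval s).size + (f.eval s).size)
  | fst e => e.cost s + (e.eval s).size
  | snd e => e.cost s + (e.eval s).size
  | isPair e => e.cost s + (e.eval s).size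
  | add e f => e.cost s + f.cost s + (e.eval s).size * (f.eval s).size
  | sub e f => e.cost s + f.cost s + (e.eval s).size * (f.eval s).size
  | mul e f => e.cost s + f.cost s + (e.eval s).size * (f.eval s).size
  | div e f => e.cost s + f.cost s + (e.eval s).size * (f.eval s).size
  | le e f => e.cost s + f.cost s + (e.eval s).size * (f.eval s).size

end Expr

/-- Programs. `query x e` asks the oracle about the value of `e` and stores the answer in `x`. -/
inductive Prog : Type
  | skip
  | assign (x : ℕ) (e : Expr)
  | query (x : ℕ) (e : Expr)
  | seq (c d : Prog)
  | ite (e : Expr) (c d : Prog)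
  | while (e : Expr) (c : Prog)

namespace Prog

/-- The program contains no oracle query. -/
def OracleFree : Prog → Prop
  | skip => True
  | assign _ _ => True
  | query _ _ => False
  | seq c d => c.OracleFree ∧ d.OracleFree
  | ite _ c d => c.OracleFree ∧ d.OracleFree
  | .while _ c => c.OracleFree

/-- `Exec O c s s' t`: with the oracle `O`, the program `c` started in the store `s` halts in the
store `s'` after time `t`. Writing the query and reading the answer of the oracle are charged with
their sizes. -/
inductive Exec (O : Data → Data) : Prog → Store → Store → ℕ → Prop
  | skip (s : Store) : Exec O .skip s s 1
  | assign (s : Store) (x : ℕ) (e : Expr) :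
      Exec O (.assign x e) s (Function.update s x (e.eval s)) (1 + e.cost s)
  | query (s : Store) (x : ℕ) (e : Expr) :
      Exec O (.query x e) s (Function.update s x (O (e.eval s)))
        (1 + e.cost s + (e.eval s).size + (O (e.eval s)).size)
  | seq {c d : Prog} {s₁ s₂ s₃ : Store} {t₁ t₂ : ℕ} (h₁ : Exec O c s₁ s₂ t₁)
      (h₂ : Exec O d s₂ s₃ t₂) : Exec O (.seq c d) s₁ s₃ (t₁ + t₂)
  | iteTrue {e : Expr} {c d : Prog} {s s' : Store} {t : ℕ} (he : (e.eval s).truthy = true)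
      (h : Exec O c s s' t) : Exec O (.ite e c d) s s' (1 + e.cost s + t)
  | iteFalse {e : Expr} {c d : Prog} {s s' : Store} {t : ℕ} (he : (e.eval s).truthy = false)
      (h : Exec O d s s' t) : Exec O (.ite e c d) s s' (1 + e.cost s + t)
  | whileTrue {e : Expr} {c : Prog} {s₁ s₂ s₃ : Store} {t₁ t₂ : ℕ}
      (he : (e.eval s₁).truthy = true) (h₁ : Exec O c s₁ s₂ t₁)
      (h₂ : Exec O (.while e c) s₂ s₃ t₂) :
      Exec O (.while e c) s₁ s₃ (1 + e.cost s₁ + t₁ + t₂)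
  | whileFalse {e : Expr} {c : Prog} {s : Store} (he : (e.eval s).truthy = false) :
      Exec O (.while e c) s s (1 + e.cost s)

/-- The input is in variable `0`, all other variables are `0`. -/
def init (d : Data) : Store := Function.update (fun _ => Data.int 0) 0 d

/-- On input `d` and with the oracle `O`, the program halts within time `T` with output `d'` (in
variable `0`). -/
def OutputsWithin (O : Data → Data) (c : Prog) (d d' : Data) (T : ℕ) : Prop :=
  ∃ (s : Store) (t : ℕ), Exec O c (init d) s t ∧ s 0 = d' ∧ t ≤ T

end Prog

/-! ## Computational problems and Cook reductions -/

/-- A (promise) function problem: given the encoding of an instance, compute the encoding of its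
answer. -/
structure Problem where
  Instance : Type
  input : Instance → Data
  answer : Instance → Data

/-- `O` is an oracle for `P`: it answers correctly on all instances of `P`, and arbitrarily on
other data. -/
def Problem.IsOracle (P : Problem) (O : Data → Data) : Prop :=
  ∀ i : P.Instance, O (P.input i) = P.answer i

/-- Polynomial-time (Cook) reduction `A ≤ᴾ B`: one program that solves `A` in polynomial time with
any oracle for `B`. -/
def PolyTimeReducible (A B : Problem) : Prop :=
  ∃ (c : Prog) (p : Polynomial ℕ), ∀ O : Data → Data, B.IsOracle O →
    ∀ i : A.Instance, c.OutputsWithin O (A.input i) (A.answer i) (p.eval (A.input i).size)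

/-- The problem is solved by a polynomial-time program without oracle. -/
def Problem.InFP (P : Problem) : Prop :=
  ∃ (c : Prog) (p : Polynomial ℕ), c.OracleFree ∧
    ∀ i : P.Instance,
      c.OutputsWithin (fun _ => .int 0) (P.input i) (P.answer i) (p.eval (P.input i).size)

/-! ## Represented classes of Boolean functions -/

/-- A class of Boolean functions together with a representation of its members by data (formulas,
circuits, lineages, …). A datum represents at most one member with a given number of variables. -/
structure FnClass where
  Rep : Type
  arity : Rep → ℕ
  fn : (F : Rep) → BoolFn (arity F)
  code : Rep → Data
  code_injective : ∀ F G : Rep, arity F = arity G → code F = code G → F = G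

namespace FnClass

/-- A member is given to a machine by its number of variables, in unary, and its
representation. -/
def input (C : FnClass) (F : C.Rep) : Data := .pair (Data.unary (C.arity F)) (C.code F)

/-- The problem `#C`: given `F ∈ C`, compute `#F`. -/
def count (C : FnClass) : Problem where
  Instance := C.Rep
  input := C.input
  answer F := .int ((C.fn F).modelCount : ℤ)

/-- The problem `#_*C`: given `F ∈ C` on `n` variables, compute `(#_0 F, …, #_n F)`. -/
def countBySize (C : FnClass) : Problem where
  Instance := C.Rep
  input := C.input
  answer F := Data.ofList (List.ofFn fun k : Fin (C.arity F + 1) =>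
    .int ((C.fn F).modelCountOfSize k : ℤ))

/-- The problem `Shap(C)`: given `F ∈ C` on `n` variables, compute its `n` Shapley values. -/
def shap (C : FnClass) : Problem where
  Instance := C.Rep
  input := C.input
  answer F := Data.ofList (List.ofFn fun i : Fin (C.arity F) => Data.ofRat ((C.fn F).shapley i))

/-- The problem of evaluating `F ∈ C` at the valuation that sets all variables to `0`. -/
def evalZero (C : FnClass) : Problem where
  Instance := C.Rep
  input := C.input
  answer F := .int (if C.fn F (fun _ => false) = true then 1 else 0)

/-- OR-substitutions of members of `C` can be computed in `C'`, in time polynomial in the sizes of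
the function and of the substitution: given `F ∈ C` and `m₁, …, mₙ` (in unary), a polynomial-time
program finds (the representation of) a member of `C'` that is the function
`F[Xᵢ := Zᵢ¹ ∨ ⋯ ∨ Zᵢ^{mᵢ}]` over the variables `Z₁¹, …, Z₁^{m₁}, Z₂¹, …`, in this order. -/
def ComputesORSubst (C C' : FnClass) : Prop :=
  ∃ σ : (F : C.Rep) → (Fin (C.arity F) → ℕ) → C'.Rep,
    (∀ (F : C.Rep) (m : Fin (C.arity F) → ℕ),
      ∃ h : ∑ i, m i = C'.arity (σ F m),
        (C.fn F).IsORSubst m (finSigmaFinEquiv.trans (finCongr h)) (C'.fn (σ F m))) ∧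
    Problem.InFP
      { Instance := Σ F : C.Rep, (Fin (C.arity F) → ℕ)
        input := fun q => .pair (C.input q.1)
          (Data.ofList (List.ofFn fun i => Data.unary (q.2 i)))
        answer := fun q => C'.input (σ q.1 q.2) }

end FnClass

/-! ## Formulas as data -/

/-- A formula as a datum: its syntax tree, with the index of a variable in binary. -/
def BoolFormula.code {n : ℕ} : BoolFormula n → Data
  | const b => .pair (.int 0) (.int (if b = true then 1 else 0))
  | var i => .pair (.int 1) (.int ((i : ℕ) : ℤ))
  | neg f => .pair (.int 2) f.code
  | and f g => .pair (.int 3) (.pair f.code g.code)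
  | or f g => .pair (.int 4) (.pair f.code g.code)

theorem BoolFormula.code_inj {n : ℕ} (f g : BoolFormula n) (h : f.code = g.code) : f = g := by
  induction f generalizing g with
  | const b =>
    cases g with
    | const b' => cases b <;> cases b' <;> simp_all [BoolFormula.code]
    | _ => simp [BoolFormula.code] at h
  | var i =>
    cases g with
    | var j => simpa [BoolFormula.code, Fin.ext_iff] using h
    | _ => simp [BoolFormula.code] at h
  | neg f ih =>
    cases g with
    | neg f' =>
      simp only [BoolFormula.code, Data.pair.injEq, true_and] at h
      rw [ih f' h]
    | _ => simp [BoolFormula.code] at h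
  | and f₁ f₂ ih₁ ih₂ =>
    cases g with
    | and g₁ g₂ =>
      simp only [BoolFormula.code, Data.pair.injEq, true_and] at h
      rw [ih₁ g₁ h.1, ih₂ g₂ h.2]
    | _ => simp [BoolFormula.code] at h
  | or f₁ f₂ ih₁ ih₂ =>
    cases g with
    | or g₁ g₂ =>
      simp only [BoolFormula.code, Data.pair.injEq, true_and] at h
      rw [ih₁ g₁ h.1, ih₂ g₂ h.2]
    | _ => simp [BoolFormula.code] at h

/-- A set of formulas as a class of represented Boolean functions. -/
def FnClass.ofFormulas (C : Set AnyFormula) : FnClass where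
  Rep := {F : AnyFormula // F ∈ C}
  arity F := F.1.1
  fn F := F.1.2.eval
  code F := F.1.2.code
  code_injective := by
    rintro ⟨⟨n, f⟩, hf⟩ ⟨⟨n', g⟩, hg⟩ h hc
    dsimp only at h hc
    subst h
    obtain rfl := BoolFormula.code_inj f g hc
    rfl

/-! ## Sizes and frames -/

/-! An OR-substitution acts on a set S of fresh variables through its projection to [n]: X_i becomes
true exactly when S contains a copy of X_i (`BoolFn.IsORSubst.valueOn_eq`). Three choices of the
multiplicities give the three reductions.

Shapley values from counts by size: each T not containing i is the set of predecessors of i in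
|T|!(n-1-|T|)! permutations (`BoolFn.card_before_eq`). Hence n!·Shap(F, X_i) is a weighted sum of
the marginal contributions of i to the t-element sets, and these are differences of counts by size
of F and of F[X_i := 0] (`BoolFn.marginal_eq`). Setting X_i to 0 is the substitution with m_i = 0.

Counts by size from counts: with L copies of every variable, T is the projection of (2^L-1)^|T|
sets, so the model count becomes the sum of #_kF·(2^L-1)^k (`BoolFn.IsORSubst.modelCount_eq`). For L
= n+2 the #_kF are its digits in base 2^L-1, and one query suffices.

Counts from Shapley values: replace X_i by x+1 copies. The marginal contribution of one copy
vanishes on sets that contain another copy, so (n+x)! times its Shapley value is Σ_t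
t!(n+x-1-t)!·M(i,t), where M(i,t) is the total marginal contribution of i to t-element sets in F.
Summing over i and dividing by x! gives R(x) = Σ_t g_t·C(x+n-1-t, x) with g_t = t!(n-1-t)!·Σ_i
M(i,t). The generating function of R is Σ_t g_t(1-X)^{-(n-t)}; multiplication by (1-X)^n leaves Σ_t
g_t(1-X)^t, and binomial inversion returns g_t from R(0), …, R(n-1) (`eq_sum_backwardDiff`). Finally
g_t/n! is the increment of #_kF/C(n,k) from k = t to k = t+1, so the g_t and F[∅] determine all
counts (`BoolFn.factorial_mul_countIn`).

Polynomial time is expressed by `Ctx.Computes`: one program serves a whole family of inputs, each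
with its own oracle. The predicate is closed under pairing, composition, arithmetic, branching,
queries with short answers, and loops with polynomially many steps and polynomially bounded states,
so the reductions are assembled from closed formulas. On formulas, substitution and evaluation at
zero are done by a stack machine that reads the subformulas in reverse prefix order
(`Ctx.Computes.formulaRec`). -/

theorem Data.size_pos (d : Data) : 1 ≤ d.size := by
  cases d <;> simp only [Data.size] <;> omega

/-- The product form matches the cost charged for an addition. For nonzero arguments it rests on u +
v ≤ uv for u, v ≥ 2, applied to powers of two; a zero argument has 2^0 = 1 and is treated apart. -/
theorem Data.size_int_add_le (x y : ℤ) :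
    (Data.int (x + y)).size ≤ (Data.int x).size * (Data.int y).size := by
  simp only [Data.size]
  have h0 : (x + y).natAbs ≤ x.natAbs + y.natAbs := Int.natAbs_add_le x y
  have h1 := Nat.lt_size_self x.natAbs
  have h2 := Nat.lt_size_self y.natAbs
  rcases Nat.eq_zero_or_pos x.natAbs with hx | hx
  · rw [Int.natAbs_eq_zero] at hx; subst hx; simp
  rcases Nat.eq_zero_or_pos y.natAbs with hy | hy
  · rw [Int.natAbs_eq_zero] at hy; subst hy; simp
  have hx' : 0 < Nat.size x.natAbs := Nat.size_pos.2 hx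
  have hy' : 0 < Nat.size y.natAbs := Nat.size_pos.2 hy
  have h3 : Nat.size (x + y).natAbs ≤ Nat.size x.natAbs + Nat.size y.natAbs := by
    rw [Nat.size_le]
    rw [pow_add]
    have ha : 2 ≤ 2 ^ Nat.size x.natAbs := Nat.le_self_pow hx'.ne' 2
    have hb : 2 ≤ 2 ^ Nat.size y.natAbs := Nat.le_self_pow hy'.ne' 2
    nlinarith
  nlinarith

theorem Data.size_int_neg (x : ℤ) : (Data.int (-x)).size = (Data.int x).size := by
  simp [Data.size]

/-- Additive bound: bit lengths add under multiplication. It keeps an iterated product within the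
total length of its factors. -/
theorem Data.size_int_mul_add_one_le (x y : ℤ) :
    (Data.int (x * y)).size + 1 ≤ (Data.int x).size + (Data.int y).size := by
  simp only [Data.size, Int.natAbs_mul]
  have h1 := Nat.lt_size_self x.natAbs
  have h2 := Nat.lt_size_self y.natAbs
  have h3 : Nat.size (x.natAbs * y.natAbs) ≤ Nat.size x.natAbs + Nat.size y.natAbs := by
    rw [Nat.size_le, pow_add]
    exact Nat.mul_lt_mul'' h1 h2
  omega

theorem Data.size_int_mul_le (x y : ℤ) :
    (Data.int (x * y)).size ≤ (Data.int x).size * (Data.int y).size := by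
  have h := Data.size_int_mul_add_one_le x y
  have h1 := (Data.int x).size_pos
  have h2 := (Data.int y).size_pos
  nlinarith

theorem Data.size_int_mono {x y : ℤ} (h : x.natAbs ≤ y.natAbs) :
    (Data.int x).size ≤ (Data.int y).size := by
  simp only [Data.size]
  have := Nat.size_le_size h
  omega

theorem Data.size_int_div_le (x y : ℤ) :
    (Data.int (x / y)).size ≤ (Data.int x).size * (Data.int y).size := by
  have h1 : (Data.int (x / y)).size ≤ (Data.int x).size :=
    Data.size_int_mono (Int.natAbs_ediv_le_natAbs x y)
  have h2 := (Data.int y).size_pos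
  nlinarith

theorem Data.size_toInt_le (d : Data) : (Data.int d.toInt).size ≤ d.size := by
  cases d with
  | int z => exact le_rfl
  | pair a b => simp [Data.toInt, Data.size]; omega

theorem Data.size_fst_le (d : Data) : d.fst.size ≤ d.size := by
  cases d <;> simp [Data.fst, Data.size]; omega

theorem Data.size_snd_le (d : Data) : d.snd.size ≤ d.size := by
  cases d <;> simp [Data.snd, Data.size]

/-! ### Cost and size of expressions -/

namespace Expr

/-- All variables of the expression are smaller than `k`. -/
def VarsBelow (k : ℕ) : Expr → Prop
  | var x => x < k
  | const _ => True
  | pair e f | add e f | sub e f | mul e f | div e f | le e f => e.VarsBelow k ∧ f.VarsBelow k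
  | fst e | snd e | isPair e => e.VarsBelow k

theorem VarsBelow.mono {k l : ℕ} (h : k ≤ l) {e : Expr} (he : e.VarsBelow k) : e.VarsBelow l := by
  induction e with
  | var x => exact lt_of_lt_of_le he h
  | const => trivial
  | fst e ih | snd e ih | isPair e ih => exact ih he
  | pair e f ih₁ ih₂ | add e f ih₁ ih₂ | sub e f ih₁ ih₂ | mul e f ih₁ ih₂ | div e f ih₁ ih₂
  | le e f ih₁ ih₂ => exact ⟨ih₁ he.1, ih₂ he.2⟩

theorem exists_varsBelow (e : Expr) : ∃ k, e.VarsBelow k := by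
  induction e with
  | var x => exact ⟨x + 1, Nat.lt_succ_self x⟩
  | const => exact ⟨0, trivial⟩
  | fst e ih | snd e ih | isPair e ih => exact ih
  | pair e f ih₁ ih₂ | add e f ih₁ ih₂ | sub e f ih₁ ih₂ | mul e f ih₁ ih₂ | div e f ih₁ ih₂
  | le e f ih₁ ih₂ =>
    obtain ⟨k, hk⟩ := ih₁
    obtain ⟨l, hl⟩ := ih₂
    exact ⟨max k l, hk.mono (le_max_left _ _), hl.mono (le_max_right _ _)⟩

theorem eval_congr {k : ℕ} {e : Expr} (he : e.VarsBelow k) {s s' : Store}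
    (h : ∀ x < k, s x = s' x) : e.eval s = e.eval s' := by
  induction e with
  | var x => exact h x he
  | const => rfl
  | fst e ih | snd e ih | isPair e ih => simp only [eval, ih he]
  | pair e f ih₁ ih₂ | add e f ih₁ ih₂ | sub e f ih₁ ih₂ | mul e f ih₁ ih₂ | div e f ih₁ ih₂
  | le e f ih₁ ih₂ => simp only [eval, ih₁ he.1, ih₂ he.2]

theorem cost_congr {k : ℕ} {e : Expr} (he : e.VarsBelow k) {s s' : Store}
    (h : ∀ x < k, s x = s' x) : e.cost s = e.cost s' := by
  induction e with
  | var x => simp only [cost, h x he]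
  | const => rfl
  | fst e ih | snd e ih | isPair e ih => simp only [cost, ih he, eval_congr (e := e) he h]
  | pair e f ih₁ ih₂ | add e f ih₁ ih₂ | sub e f ih₁ ih₂ | mul e f ih₁ ih₂ | div e f ih₁ ih₂
  | le e f ih₁ ih₂ =>
    simp only [cost, ih₁ he.1, ih₂ he.2, eval_congr he.1 h, eval_congr he.2 h]

theorem cost_pos (s : Store) (e : Expr) : 1 ≤ e.cost s := by
  induction e with
  | var x => exact Data.size_pos _
  | const => exact Data.size_pos _
  | fst | snd | isPair => simp only [cost]; omega
  | pair | add | sub | mul | div | le => simp only [cost]; omega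

/-- Each operation is charged at least the size of what it produces, so time controls memory. -/
theorem size_eval_le_cost (s : Store) (e : Expr) : (e.eval s).size ≤ e.cost s := by
  induction e with
  | var x => exact le_rfl
  | const => exact le_rfl
  | fst e ih => exact (Data.size_fst_le _).trans (by simp only [cost]; omega)
  | snd e ih => exact (Data.size_snd_le _).trans (by simp only [cost]; omega)
  | isPair e ih =>
    have h1 := cost_pos s e
    have h2 := (e.eval s).size_pos
    simp only [cost, eval]
    cases e.eval s <;> simp [Data.isPair, Data.size] at * <;> omega
  | pair e f => simp only [cost, eval, Data.size]; omega
  | add e f ih₁ ih₂ =>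
    simp only [cost, eval]
    exact (Data.size_int_add_le _ _).trans (le_add_left
      (Nat.mul_le_mul (Data.size_toInt_le _) (Data.size_toInt_le _)))
  | sub e f ih₁ ih₂ =>
    simp only [cost, eval, sub_eq_add_neg]
    refine (Data.size_int_add_le _ _).trans (le_add_left
      (Nat.mul_le_mul (Data.size_toInt_le _) ?_))
    rw [Data.size_int_neg]
    exact Data.size_toInt_le _
  | mul e f ih₁ ih₂ =>
    simp only [cost, eval]
    exact (Data.size_int_mul_le _ _).trans (le_add_left
      (Nat.mul_le_mul (Data.size_toInt_le _) (Data.size_toInt_le _)))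
  | div e f ih₁ ih₂ =>
    simp only [cost, eval]
    exact (Data.size_int_div_le _ _).trans (le_add_left
      (Nat.mul_le_mul (Data.size_toInt_le _) (Data.size_toInt_le _)))
  | le e f ih₁ ih₂ =>
    have h1 := cost_pos s e
    have h2 := cost_pos s f
    simp only [cost, eval]
    split_ifs <;> simp [Data.size] <;> omega

/-- The cost of an expression in one variable is polynomial in the size of that variable. -/
theorem exists_cost_le {e : Expr} (he : e.VarsBelow 1) :
    ∃ p : Polynomial ℕ, ∀ s : Store, e.cost s ≤ p.eval (s 0).size := by
  induction e with
  | var x =>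
    obtain rfl : x = 0 := Nat.lt_one_iff.1 he
    exact ⟨Polynomial.X, fun s => by simp [cost]⟩
  | const z => exact ⟨Polynomial.C (Data.int z).size, fun s => by simp [cost]⟩
  | fst e ih | snd e ih | isPair e ih =>
    obtain ⟨p, hp⟩ := ih he
    refine ⟨p + p, fun s => ?_⟩
    have h1 := hp s
    have h2 := size_eval_le_cost s e
    simp only [cost, Polynomial.eval_add]
    omega
  | pair e f ih₁ ih₂ =>
    obtain ⟨p, hp⟩ := ih₁ he.1
    obtain ⟨q, hq⟩ := ih₂ he.2
    refine ⟨p + q + (1 + p + q), fun s => ?_⟩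
    have h1 := hp s
    have h2 := size_eval_le_cost s e
    have h3 := hq s
    have h4 := size_eval_le_cost s f
    simp only [cost, Polynomial.eval_add, Polynomial.eval_one]
    omega
  | add e f ih₁ ih₂ | sub e f ih₁ ih₂ | mul e f ih₁ ih₂ | div e f ih₁ ih₂ | le e f ih₁ ih₂ =>
    obtain ⟨p, hp⟩ := ih₁ he.1
    obtain ⟨q, hq⟩ := ih₂ he.2
    refine ⟨p + q + p * q, fun s => ?_⟩
    have h1 := hp s
    have h2 := size_eval_le_cost s e
    have h3 := hq s
    have h4 := size_eval_le_cost s f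
    simp only [cost, Polynomial.eval_add, Polynomial.eval_mul]
    have := Nat.mul_le_mul (h2.trans h1) (h4.trans h3)
    omega

end Expr

/-! ### Frame property and programs that clean up after themselves -/

namespace Prog

/-- All variables of the program are smaller than `k`. -/
def VarsBelow (k : ℕ) : Prog → Prop
  | skip => True
  | assign x e => x < k ∧ e.VarsBelow k
  | query x e => x < k ∧ e.VarsBelow k
  | seq c d => c.VarsBelow k ∧ d.VarsBelow k
  | ite e c d => e.VarsBelow k ∧ c.VarsBelow k ∧ d.VarsBelow k
  | .while e c => e.VarsBelow k ∧ c.VarsBelow k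

theorem VarsBelow.mono {k l : ℕ} (h : k ≤ l) {c : Prog} (hc : c.VarsBelow k) : c.VarsBelow l := by
  induction c with
  | skip => trivial
  | assign x e => exact ⟨hc.1.trans_le h, hc.2.mono h⟩
  | query x e => exact ⟨hc.1.trans_le h, hc.2.mono h⟩
  | seq c d ih₁ ih₂ => exact ⟨ih₁ hc.1, ih₂ hc.2⟩
  | ite e c d ih₁ ih₂ => exact ⟨hc.1.mono h, ih₁ hc.2.1, ih₂ hc.2.2⟩
  | _ => rename_i e c ih; exact ⟨hc.1.mono h, ih hc.2⟩

theorem exists_varsBelow (c : Prog) : ∃ k, c.VarsBelow k := by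
  induction c with
  | skip => exact ⟨0, trivial⟩
  | assign x e | query x e =>
    obtain ⟨k, hk⟩ := e.exists_varsBelow
    exact ⟨max k (x + 1), by omega, hk.mono (le_max_left _ _)⟩
  | seq c d ih₁ ih₂ =>
    obtain ⟨k, hk⟩ := ih₁
    obtain ⟨l, hl⟩ := ih₂
    exact ⟨max k l, hk.mono (le_max_left _ _), hl.mono (le_max_right _ _)⟩
  | ite e c d ih₁ ih₂ =>
    obtain ⟨k, hk⟩ := ih₁
    obtain ⟨l, hl⟩ := ih₂
    obtain ⟨m, hm⟩ := e.exists_varsBelow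
    exact ⟨max m (max k l), hm.mono (le_max_left _ _), hk.mono (by simp), hl.mono (by simp)⟩
  | _ =>
    rename_i e c ih
    obtain ⟨k, hk⟩ := ih
    obtain ⟨m, hm⟩ := e.exists_varsBelow
    exact ⟨max m k, hm.mono (le_max_left _ _), hk.mono (le_max_right _ _)⟩

/-- Executions do not depend on the variables that the program does not mention, and leave them
unchanged. -/
theorem Exec.frame {O : Data → Data} {k : ℕ} {c : Prog} {s s' : Store} {t : ℕ}
    (h : Exec O c s s' t) (hc : c.VarsBelow k) {r : Store} (hr : ∀ x < k, r x = s x) :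
    ∃ r', Exec O c r r' t ∧ (∀ x < k, r' x = s' x) ∧ ∀ x, k ≤ x → r' x = r x := by
  induction h generalizing r with
  | skip s => exact ⟨r, .skip r, hr, fun _ _ => rfl⟩
  | assign s x e =>
    refine ⟨Function.update r x (e.eval r), ?_, fun y hy => ?_, fun y hy => ?_⟩
    · rw [← Expr.cost_congr hc.2 hr]; exact .assign r x e
    · rw [Expr.eval_congr hc.2 hr]
      by_cases hxy : y = x
      · subst hxy; simp
      · simp [Function.update_of_ne hxy, hr y hy]
    · exact Function.update_of_ne (by have := hc.1; omega) _ _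
  | query s x e =>
    refine ⟨Function.update r x (O (e.eval r)), ?_, fun y hy => ?_, fun y hy => ?_⟩
    · rw [← Expr.cost_congr hc.2 hr, ← Expr.eval_congr hc.2 hr]; exact .query r x e
    · rw [Expr.eval_congr hc.2 hr]
      by_cases hxy : y = x
      · subst hxy; simp
      · simp [Function.update_of_ne hxy, hr y hy]
    · exact Function.update_of_ne (by have := hc.1; omega) _ _
  | seq _ _ ih₁ ih₂ =>
    obtain ⟨r₁, h₁, hb₁, ha₁⟩ := ih₁ hc.1 hr
    obtain ⟨r₂, h₂, hb₂, ha₂⟩ := ih₂ hc.2 hb₁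
    exact ⟨r₂, .seq h₁ h₂, hb₂, fun x hx => (ha₂ x hx).trans (ha₁ x hx)⟩
  | iteTrue he _ ih =>
    obtain ⟨r₁, h₁, hb₁, ha₁⟩ := ih hc.2.1 hr
    refine ⟨r₁, ?_, hb₁, ha₁⟩
    rw [← Expr.cost_congr hc.1 hr]
    rw [← Expr.eval_congr hc.1 hr] at he
    exact .iteTrue he h₁
  | iteFalse he _ ih =>
    obtain ⟨r₁, h₁, hb₁, ha₁⟩ := ih hc.2.2 hr
    refine ⟨r₁, ?_, hb₁, ha₁⟩
    rw [← Expr.cost_congr hc.1 hr]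
    rw [← Expr.eval_congr hc.1 hr] at he
    exact .iteFalse he h₁
  | whileTrue he _ _ ih₁ ih₂ =>
    obtain ⟨r₁, h₁, hb₁, ha₁⟩ := ih₁ hc.2 hr
    obtain ⟨r₂, h₂, hb₂, ha₂⟩ := ih₂ hc hb₁
    refine ⟨r₂, ?_, hb₂, fun x hx => (ha₂ x hx).trans (ha₁ x hx)⟩
    rw [← Expr.cost_congr hc.1 hr]
    rw [← Expr.eval_congr hc.1 hr] at he
    exact .whileTrue he h₁ h₂
  | whileFalse he =>
    refine ⟨r, ?_, hr, fun _ _ => rfl⟩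
    rw [← Expr.cost_congr hc.1 hr]
    rw [← Expr.eval_congr hc.1 hr] at he
    exact .whileFalse he

theorem Exec.of_oracleFree {O : Data → Data} {c : Prog} {s s' : Store} {t : ℕ}
    (h : Exec O c s s' t) (hc : c.OracleFree) (O' : Data → Data) : Exec O' c s s' t := by
  induction h with
  | skip s => exact .skip s
  | assign s x e => exact .assign s x e
  | query s x e => exact hc.elim
  | seq _ _ ih₁ ih₂ => exact .seq (ih₁ hc.1) (ih₂ hc.2)
  | iteTrue he _ ih => exact .iteTrue he (ih hc.1)
  | iteFalse he _ ih => exact .iteFalse he (ih hc.2)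
  | whileTrue he _ _ ih₁ ih₂ => exact .whileTrue he (ih₁ hc) (ih₂ hc)
  | whileFalse he => exact .whileFalse he

/-- Every write is paid for, oracle answers included. Hence the output of a polynomial-time stage is
a polynomially long input for the next stage. -/
theorem Exec.size_le {O : Data → Data} {c : Prog} {s s' : Store} {t : ℕ}
    (h : Exec O c s s' t) (x : ℕ) : (s' x).size ≤ (s x).size + t := by
  induction h with
  | skip s => omega
  | assign s y e =>
    have := Expr.size_eval_le_cost s e
    by_cases hxy : x = y
    · subst hxy; simp; omega
    · simp [Function.update_of_ne hxy]
  | query s y e =>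
    by_cases hxy : x = y
    · subst hxy; simp; omega
    · simp [Function.update_of_ne hxy]
  | seq _ _ ih₁ ih₂ => omega
  | iteTrue _ _ ih => omega
  | iteFalse _ _ ih => omega
  | whileTrue _ _ _ ih₁ ih₂ => omega
  | whileFalse => omega

/-- The program transforms the datum `d` in variable `0` into `d'` within time `T`, whenever the
work variables (those below `k`) are clear, clears them, and leaves all other variables unchanged. -/
def Transforms (O : Data → Data) (c : Prog) (k : ℕ) (d d' : Data) (T : ℕ) : Prop :=
  ∀ s : Store, s 0 = d → (∀ x, 0 < x → x < k → s x = .int 0) →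
    ∃ t ≤ T, Exec O c s (Function.update s 0 d') t

theorem Transforms.mono {O : Data → Data} {c : Prog} {k l : ℕ} {d d' : Data} {T T' : ℕ}
    (h : Transforms O c k d d' T) (hkl : k ≤ l) (hT : T ≤ T') : Transforms O c l d d' T' :=
  fun s h0 hs => by
    obtain ⟨t, ht, he⟩ := h s h0 fun x hx hk => hs x hx (hk.trans_le hkl)
    exact ⟨t, ht.trans hT, he⟩

theorem Transforms.outputsWithin {O : Data → Data} {c : Prog} {k : ℕ} {d d' : Data} {T : ℕ}
    (h : Transforms O c k d d' T) : c.OutputsWithin O d d' T := by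
  obtain ⟨t, ht, he⟩ := h (init d) (by simp [init]) fun x hx _ => by
    simp [init, Function.update_of_ne hx.ne']
  exact ⟨_, t, he, by simp, ht⟩

theorem Transforms.size_le {O : Data → Data} {c : Prog} {k : ℕ} {d d' : Data} {T : ℕ}
    (h : Transforms O c k d d' T) : d'.size ≤ d.size + T := by
  obtain ⟨s, t, he, rfl, ht⟩ := h.outputsWithin
  have := he.size_le 0
  simp only [init, Function.update_self] at this
  omega

/-- Set the variables `1, …, k` to `0`. -/
def clear : ℕ → Prog
  | 0 => .skip
  | k + 1 => .seq (clear k) (.assign (k + 1) (.const 0))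

theorem exec_clear (O : Data → Data) (k : ℕ) (s : Store) :
    Exec O (clear k) s (fun x => if 0 < x ∧ x ≤ k then .int 0 else s x) (1 + 2 * k) := by
  induction k with
  | zero =>
    have : (fun x => if 0 < x ∧ x ≤ 0 then Data.int 0 else s x) = s := by
      funext x; rw [if_neg (by omega)]
    rw [this]
    exact .skip s
  | succ k ih =>
    have h := Exec.seq ih (Exec.assign (O := O) _ (k + 1) (.const 0))
    rw [clear]
    convert h using 1
    · funext x
      by_cases hx : x = k + 1
      · subst hx; simp [Expr.eval]
      · rw [Function.update_of_ne hx]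
        congr 1
        simp only [eq_iff_iff]
        omega
    · simp [Expr.cost, Data.size]; omega

/-- The frame property transfers the run from the initial store to any store with clear work
variables; clearing them afterwards makes the program composable. -/
theorem OutputsWithin.transforms {O : Data → Data} {c : Prog} {k : ℕ} (hc : c.VarsBelow (k + 1))
    {d d' : Data} {T : ℕ} (h : c.OutputsWithin O d d' T) :
    Transforms O (.seq c (clear k)) (k + 1) d d' (T + (1 + 2 * k)) := by
  obtain ⟨s, t, he, rfl, ht⟩ := h
  intro r hr0 hr
  obtain ⟨r', he', hb, ha⟩ := he.frame hc (r := r) fun x hx => by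
    rcases Nat.eq_zero_or_pos x with rfl | hx0
    · simp [init, hr0]
    · simp [init, Function.update_of_ne hx0.ne', hr x hx0 hx]
  refine ⟨_, Nat.add_le_add_right ht _, ?_⟩
  convert Exec.seq he' (exec_clear O k r') using 1
  funext x
  rcases Nat.eq_zero_or_pos x with rfl | hx0
  · simp [hb 0 (by omega)]
  · rw [Function.update_of_ne hx0.ne']
    split_ifs with hk
    · exact hr x hx0 (by omega)
    · exact (ha x (by omega)).symm

theorem Transforms.seq {O : Data → Data} {c₁ c₂ : Prog} {k₁ k₂ : ℕ} {d₁ d₂ d₃ : Data} {T₁ T₂ : ℕ}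
    (h₁ : Transforms O c₁ k₁ d₁ d₂ T₁) (h₂ : Transforms O c₂ k₂ d₂ d₃ T₂) :
    Transforms O (.seq c₁ c₂) (max k₁ k₂) d₁ d₃ (T₁ + T₂) := by
  intro s h0 hs
  obtain ⟨t₁, ht₁, he₁⟩ := h₁ s h0 fun x hx hk => hs x hx (hk.trans_le (le_max_left _ _))
  obtain ⟨t₂, ht₂, he₂⟩ := h₂ (Function.update s 0 d₂) (by simp) fun x hx hk => by
    rw [Function.update_of_ne hx.ne']
    exact hs x hx (hk.trans_le (le_max_right _ _))
  rw [Function.update_idem] at he₂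
  exact ⟨_, add_le_add ht₁ ht₂, .seq he₁ he₂⟩

/-- Run `c₁` and `c₂` on the same input and pair the results. -/
def both (c₁ c₂ : Prog) (k : ℕ) : Prog :=
  .seq (.assign k (.var 0)) (.seq c₁ (.seq (.assign (k + 1) (.var 0)) (.seq (.assign 0 (.var k))
    (.seq c₂ (.seq (.assign 0 (.pair (.var (k + 1)) (.var 0)))
      (.seq (.assign k (.const 0)) (.assign (k + 1) (.const 0))))))))

theorem Transforms.both {O : Data → Data} {c₁ c₂ : Prog} {k : ℕ} (hk : 0 < k) {d d₁ d₂ : Data}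
    {T₁ T₂ : ℕ} (h₁ : Transforms O c₁ k d d₁ T₁) (h₂ : Transforms O c₂ k d d₂ T₂) :
    Transforms O (both c₁ c₂ k) (k + 2) d (.pair d₁ d₂)
      (T₁ + T₂ + (2 * d.size + 3 * d₁.size + 2 * d₂.size + 10)) := by
  intro s h0 hs
  have hk0 : k ≠ 0 := hk.ne'
  obtain ⟨t₁, ht₁, he₁⟩ := h₁ (Function.update s k d) (by simp [Ne.symm hk0, h0])
    fun x hx hxk => by rw [Function.update_of_ne hxk.ne]; exact hs x hx (by omega)
  have e1 := Exec.assign (O := O) s k (.var 0)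
  simp only [Expr.eval, Expr.cost, h0] at e1
  obtain ⟨t₂, ht₂, he₂⟩ := h₂ (Function.update (Function.update (Function.update
    (Function.update s k d) 0 d₁) (k + 1) d₁) 0 d) (by simp)
    fun x hx hxk => by
      rw [Function.update_of_ne hx.ne', Function.update_of_ne (by omega),
        Function.update_of_ne hx.ne', Function.update_of_ne hxk.ne]
      exact hs x hx (by omega)
  have e2 := Exec.assign (O := O) (Function.update (Function.update s k d) 0 d₁) (k + 1) (.var 0)
  simp only [Expr.eval, Expr.cost, Function.update_self] at e2
  have e3 := Exec.assign (O := O) (Function.update (Function.update (Function.update s k d) 0 d₁)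
    (k + 1) d₁) 0 (.var k)
  have hk1 : k ≠ k + 1 := by omega
  simp only [Expr.eval, Expr.cost, Function.update_of_ne hk0, Function.update_of_ne hk1,
    Function.update_self] at e3
  have e4 := Exec.seq e1 (.seq he₁ (.seq e2 (.seq e3 (.seq he₂ (.seq
    (Exec.assign _ 0 (.pair (.var (k + 1)) (.var 0))) (.seq (Exec.assign _ k (.const 0))
      (Exec.assign _ (k + 1) (.const 0))))))))
  -- The final store and the time of the run come out as nested updates and sums; they are compared
  -- with the desired ones separately.
  suffices key : ∀ {s' t T}, Exec O (Prog.both c₁ c₂ k) s s' t →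
      s' = Function.update s 0 (.pair d₁ d₂) → t ≤ T →
      ∃ t ≤ T, Exec O (Prog.both c₁ c₂ k) s (Function.update s 0 (.pair d₁ d₂)) t by
    refine key e4 ?_ ?_
    · funext x
      simp only [Expr.eval, Function.update_apply]
      have hs1 := hs k hk (by omega)
      have hs2 := hs (k + 1) (by omega) (by omega)
      rcases Nat.eq_zero_or_pos x with rfl | hx
      · simp [Ne.symm hk0]
      · simp only [hx.ne', if_false]
        split_ifs <;> simp_all
    · simp only [Expr.eval, Expr.cost, Function.update_apply, Data.size]
      simp
      omega
  rintro s' t T he rfl ht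
  exact ⟨t, ht, he⟩

end Prog

/-! ## Families of polynomial-time computations -/

/-- There are N rounds and one last failing test. A test costs at most 1 + 2S: the state is read
once and then scanned for its first component. -/
theorem Prog.Transforms.while {O : Data → Data} {c : Prog} {k : ℕ} {T S : ℕ} {N : ℕ}
    {st : ℕ → Data} (hS : ∀ j ≤ N, (st j).size ≤ S)
    (hc : ∀ j < N, Transforms O c k (st j) (st (j + 1)) T)
    (htrue : ∀ j < N, (st j).fst.truthy = true) (hfalse : (st N).fst.truthy = false) :
    Transforms O (.while (.fst (.var 0)) c) k (st 0) (st N) ((N + 1) * (1 + 2 * S + T)) := by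
  induction N generalizing st with
  | zero =>
    intro s h0 hs
    refine ⟨_, ?_, by rw [← h0, Function.update_eq_self]; exact .whileFalse (by simp [Expr.eval, h0, hfalse])⟩
    have := hS 0 le_rfl
    simp only [Expr.cost, Expr.eval, h0]
    omega
  | succ N ih =>
    intro s h0 hs
    obtain ⟨t₁, ht₁, he₁⟩ := hc 0 (by omega) s h0 hs
    obtain ⟨t₂, ht₂, he₂⟩ := ih (st := fun j => st (j + 1)) (fun j hj => hS _ (by omega))
      (fun j hj => hc _ (by omega)) (fun j hj => htrue _ (by omega)) hfalse
      (Function.update s 0 (st 1)) (by simp)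
      (fun x hx hk => by rw [Function.update_of_ne hx.ne']; exact hs x hx hk)
    rw [Function.update_idem] at he₂
    refine ⟨_, ?_, .whileTrue (by simpa [Expr.eval, h0] using htrue 0 (by omega)) he₁ he₂⟩
    have := hS 0 (by omega)
    simp only [Expr.cost, Expr.eval, h0]
    rw [add_mul _ 1 (1 + 2 * S + T)]
    omega

/-- Data types that machines can handle. -/
class Enc (α : Type) where
  enc : α → Data

open Enc

instance : Enc Data := ⟨id⟩
instance : Enc ℤ := ⟨Data.int⟩
instance : Enc ℕ := ⟨fun n => Data.int n⟩
instance : Enc Unit := ⟨fun _ => Data.int 0⟩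
instance : Enc Bool := ⟨fun b => Data.int (if b = true then 1 else 0)⟩
instance {α β : Type} [Enc α] [Enc β] : Enc (α × β) := ⟨fun q => Data.pair (enc q.1) (enc q.2)⟩
instance {α : Type} [Enc α] : Enc (List α) := ⟨fun l => Data.ofList (l.map enc)⟩

section EncLemmas

variable {α β : Type} [Enc α] [Enc β]

@[simp] theorem enc_data (d : Data) : enc d = d := rfl
@[simp] theorem enc_int (z : ℤ) : enc z = Data.int z := rfl
@[simp] theorem enc_nat (n : ℕ) : enc n = Data.int n := rfl
@[simp] theorem enc_unit (u : Unit) : enc u = Data.int 0 := rfl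
@[simp] theorem enc_prod (q : α × β) : enc q = Data.pair (enc q.1) (enc q.2) := rfl
@[simp] theorem enc_nil : enc ([] : List α) = Data.int 0 := rfl
@[simp] theorem enc_cons (a : α) (l : List α) : enc (a :: l) = Data.pair (enc a) (enc l) := rfl
theorem enc_list (l : List α) : enc l = Data.ofList (l.map enc) := rfl

theorem size_enc_append (l₁ l₂ : List α) :
    (enc (l₁ ++ l₂)).size + 1 = (enc l₁).size + (enc l₂).size := by
  induction l₁ with
  | nil => simp [Data.size]; omega
  | cons a l ih => simp only [List.cons_append, enc_cons, Data.size]; omega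

theorem length_lt_size_enc (l : List α) : l.length < (enc l).size := by
  induction l with
  | nil => simp [Data.size]
  | cons a l ih => simp only [List.length_cons, enc_cons, Data.size]; omega

theorem size_enc_le_of_mem {l : List α} {x : α} (h : x ∈ l) : (enc x).size ≤ (enc l).size := by
  induction l with
  | nil => simp at h
  | cons a l ih =>
    simp only [enc_cons, Data.size]
    rcases List.mem_cons.1 h with rfl | h
    · omega
    · have := ih h; omega

theorem size_enc_list_le {l : List α} {B : ℕ} (h : ∀ x ∈ l, (enc x).size ≤ B) :
    (enc l).size ≤ 1 + l.length * (B + 1) := by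
  induction l with
  | nil => simp [Data.size]
  | cons a l ih =>
    have h1 := ih fun x hx => h x (List.mem_cons_of_mem _ hx)
    have h2 := h a (by simp)
    simp only [enc_cons, Data.size, List.length_cons, add_mul]
    omega

theorem enc_replicate_unit (n : ℕ) : enc (List.replicate n ()) = Data.unary n := by
  simp [enc_list, Data.unary]

end EncLemmas

theorem Polynomial.eval_mono_nat (p : Polynomial ℕ) {x y : ℕ} (h : x ≤ y) :
    p.eval x ≤ p.eval y := by
  simp only [Polynomial.eval_eq_sum, Polynomial.sum]
  exact Finset.sum_le_sum fun i _ => Nat.mul_le_mul_left _ (Nat.pow_le_pow_left h i)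

/-- A family of machine inputs, each with an oracle. -/
structure Ctx where
  Index : Type
  oracle : Index → Data → Data
  input : Index → Data

/-! ### Closure properties of polynomial-time computation -/

namespace Ctx

variable {Γ Δ : Ctx} {α β γ : Type} [Enc α] [Enc β] [Enc γ]

/-- The numbers `u i` are polynomially bounded in the sizes of the inputs. -/
def Bdd (Γ : Ctx) (u : Γ.Index → ℕ) : Prop :=
  ∃ p : Polynomial ℕ, ∀ i, u i ≤ p.eval (Γ.input i).size

/-- Some program computes the data `b i` from the inputs of the family in polynomial time. -/
def Computes (Γ : Ctx) (b : Γ.Index → α) : Prop :=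
  ∃ (c : Prog) (k : ℕ) (T : Γ.Index → ℕ), Γ.Bdd T ∧
    ∀ i, Prog.Transforms (Γ.oracle i) c k (Γ.input i) (enc (b i)) (T i)

theorem Bdd.mono {u v : Γ.Index → ℕ} (hu : Γ.Bdd u) (h : ∀ i, v i ≤ u i) : Γ.Bdd v := by
  obtain ⟨p, hp⟩ := hu
  exact ⟨p, fun i => (h i).trans (hp i)⟩

theorem Bdd.const (Γ : Ctx) (c : ℕ) : Γ.Bdd fun _ => c := ⟨Polynomial.C c, fun i => by simp⟩

theorem Bdd.size (Γ : Ctx) : Γ.Bdd fun i => (Γ.input i).size := ⟨Polynomial.X, fun i => by simp⟩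

theorem Bdd.add {u v : Γ.Index → ℕ} (hu : Γ.Bdd u) (hv : Γ.Bdd v) : Γ.Bdd fun i => u i + v i := by
  obtain ⟨p, hp⟩ := hu
  obtain ⟨q, hq⟩ := hv
  exact ⟨p + q, fun i => by simpa using add_le_add (hp i) (hq i)⟩

theorem Bdd.mul {u v : Γ.Index → ℕ} (hu : Γ.Bdd u) (hv : Γ.Bdd v) : Γ.Bdd fun i => u i * v i := by
  obtain ⟨p, hp⟩ := hu
  obtain ⟨q, hq⟩ := hv
  exact ⟨p * q, fun i => by simpa using Nat.mul_le_mul (hp i) (hq i)⟩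

theorem Bdd.eval {u : Γ.Index → ℕ} (hu : Γ.Bdd u) (p : Polynomial ℕ) :
    Γ.Bdd fun i => p.eval (u i) := by
  obtain ⟨q, hq⟩ := hu
  exact ⟨p.comp q, fun i => by
    rw [Polynomial.eval_comp]; exact p.eval_mono_nat (hq i)⟩

theorem Computes.congr {b b' : Γ.Index → α} (h : Γ.Computes b) (hb : ∀ i, b i = b' i) :
    Γ.Computes b' := by
  obtain rfl : b = b' := funext hb
  exact h

/-- Only the encodings of the results matter. -/
theorem Computes.recode {b : Γ.Index → α} {b' : Γ.Index → β} (h : Γ.Computes b)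
    (hb : ∀ i, enc (b i) = enc (b' i)) : Γ.Computes b' := by
  obtain ⟨c, k, T, hT, hc⟩ := h
  exact ⟨c, k, T, hT, fun i => hb i ▸ hc i⟩

/-- The output takes time to write. This is the source of the size bounds needed for composition and
for loops. -/
theorem Computes.bdd_size {b : Γ.Index → α} (h : Γ.Computes b) :
    Γ.Bdd fun i => (enc (b i)).size := by
  obtain ⟨c, k, T, hT, hc⟩ := h
  exact ((Bdd.size Γ).add hT).mono fun i => (hc i).size_le

/-- Composition and reindexing. -/
theorem Computes.subst {b : Δ.Index → α} (h : Δ.Computes b) (φ : Γ.Index → Δ.Index)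
    (hO : ∀ i, Δ.oracle (φ i) = Γ.oracle i) (hφ : Γ.Computes fun i => Δ.input (φ i)) :
    Γ.Computes fun i => b (φ i) := by
  have hsz := hφ.bdd_size
  obtain ⟨c, k, T, ⟨p, hp⟩, hc⟩ := h
  obtain ⟨c', k', T', hT', hc'⟩ := hφ
  refine ⟨.seq c' c, max k' k, fun i => T' i + T (φ i),
    hT'.add ((hsz.eval p).mono fun i => hp (φ i)), fun i => (hc' i).seq ?_⟩
  have := hc (φ i)
  rwa [hO i] at this

theorem Computes.expr (Γ : Ctx) {e : Expr} (he : e.VarsBelow 1) :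
    Γ.Computes fun i => e.eval fun _ => Γ.input i := by
  obtain ⟨p, hp⟩ := Expr.exists_cost_le he
  refine ⟨.assign 0 e, 1, fun i => 1 + p.eval (Γ.input i).size,
    (Bdd.const Γ 1).add ((Bdd.size Γ).eval p), fun i s h0 _ => ?_⟩
  refine ⟨1 + e.cost s, Nat.add_le_add_left (h0 ▸ hp s) 1, ?_⟩
  have : e.eval (fun _ => Γ.input i) = e.eval s :=
    Expr.eval_congr he fun x hx => by rw [Nat.lt_one_iff.1 hx, h0]
  simp only [enc_data, this]
  exact .assign s 0 e

theorem Computes.input (Γ : Ctx) : Γ.Computes fun i => Γ.input i :=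
  Computes.expr Γ (e := .var 0) Nat.one_pos

theorem Computes.prodMk {a : Γ.Index → α} {b : Γ.Index → β} (ha : Γ.Computes a)
    (hb : Γ.Computes b) : Γ.Computes fun i => (a i, b i) := by
  have hsa := ha.bdd_size
  have hsb := hb.bdd_size
  obtain ⟨c, k, T, hT, hc⟩ := ha
  obtain ⟨c', k', T', hT', hc'⟩ := hb
  exact ⟨_, _, _, (hT.add hT').add (((((Bdd.const Γ 2).mul (Bdd.size Γ)).add
    ((Bdd.const Γ 3).mul hsa)).add ((Bdd.const Γ 2).mul hsb)).add (Bdd.const Γ 10)),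
    fun i => Prog.Transforms.both (k := max 1 (max k k')) (by omega)
      ((hc i).mono (by omega) le_rfl) ((hc' i).mono (by omega) le_rfl)⟩

/-- Apply an expression to a computed datum. -/
theorem Computes.exprOn {a : Γ.Index → α} (ha : Γ.Computes a) {e : Expr} (he : e.VarsBelow 1)
    {b : Γ.Index → β} (hb : ∀ i, e.eval (fun _ => enc (a i)) = enc (b i)) : Γ.Computes b := by
  have h := Computes.expr ⟨Γ.Index, Γ.oracle, fun i => enc (a i)⟩ he
  exact (h.subst (Γ := Γ) id (fun _ => rfl) (ha.recode fun i => rfl)).recode hb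

theorem Computes.const (Γ : Ctx) (z : ℤ) : Γ.Computes fun _ => z :=
  (Computes.input Γ).exprOn (e := .const z) trivial fun _ => rfl

theorem Computes.constNat (Γ : Ctx) (n : ℕ) : Γ.Computes fun _ => n :=
  (Computes.const Γ n).recode fun _ => rfl

theorem Computes.unit (Γ : Ctx) : Γ.Computes fun _ => () :=
  (Computes.const Γ 0).recode fun _ => rfl

theorem Computes.nil (Γ : Ctx) : Γ.Computes fun _ => ([] : List α) :=
  (Computes.const Γ 0).recode fun _ => rfl

theorem Computes.cons {a : Γ.Index → α} {l : Γ.Index → List α} (ha : Γ.Computes a)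
    (hl : Γ.Computes l) : Γ.Computes fun i => a i :: l i :=
  (ha.prodMk hl).recode fun _ => rfl

theorem Computes.dataFst {a : Γ.Index → Data} (ha : Γ.Computes a) :
    Γ.Computes fun i => (a i).fst :=
  ha.exprOn (e := .fst (.var 0)) Nat.one_pos fun _ => rfl

theorem Computes.dataSnd {a : Γ.Index → Data} (ha : Γ.Computes a) :
    Γ.Computes fun i => (a i).snd :=
  ha.exprOn (e := .snd (.var 0)) Nat.one_pos fun _ => rfl

theorem Computes.toInt {a : Γ.Index → Data} (ha : Γ.Computes a) :
    Γ.Computes fun i => (a i).toInt :=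
  -- Adding 0 coerces a datum to an integer, since arithmetic reads a pair as 0.
  ha.exprOn (e := .add (.var 0) (.const 0)) ⟨Nat.one_pos, trivial⟩ fun i => by
    simp [Expr.eval, Data.toInt]

theorem Computes.fst {a : Γ.Index → α × β} (ha : Γ.Computes a) : Γ.Computes fun i => (a i).1 :=
  ha.exprOn (e := .fst (.var 0)) Nat.one_pos fun _ => rfl

theorem Computes.snd {a : Γ.Index → α × β} (ha : Γ.Computes a) : Γ.Computes fun i => (a i).2 :=
  ha.exprOn (e := .snd (.var 0)) Nat.one_pos fun _ => rfl

theorem Computes.dataPair {a b : Γ.Index → Data} (ha : Γ.Computes a) (hb : Γ.Computes b) :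
    Γ.Computes fun i => Data.pair (a i) (b i) :=
  (ha.prodMk hb).recode fun _ => rfl

theorem Computes.data {a : Γ.Index → α} (ha : Γ.Computes a) : Γ.Computes fun i => enc (a i) :=
  ha.recode fun _ => rfl

section Arithmetic

variable {x y : Γ.Index → ℤ} {m n : Γ.Index → ℕ}

theorem Computes.add (hx : Γ.Computes x) (hy : Γ.Computes y) : Γ.Computes fun i => x i + y i :=
  (hx.prodMk hy).exprOn (e := .add (.fst (.var 0)) (.snd (.var 0))) ⟨Nat.one_pos, Nat.one_pos⟩
    fun _ => rfl

theorem Computes.sub (hx : Γ.Computes x) (hy : Γ.Computes y) : Γ.Computes fun i => x i - y i :=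
  (hx.prodMk hy).exprOn (e := .sub (.fst (.var 0)) (.snd (.var 0))) ⟨Nat.one_pos, Nat.one_pos⟩
    fun _ => rfl

theorem Computes.mul (hx : Γ.Computes x) (hy : Γ.Computes y) : Γ.Computes fun i => x i * y i :=
  (hx.prodMk hy).exprOn (e := .mul (.fst (.var 0)) (.snd (.var 0))) ⟨Nat.one_pos, Nat.one_pos⟩
    fun _ => rfl

theorem Computes.div (hx : Γ.Computes x) (hy : Γ.Computes y) : Γ.Computes fun i => x i / y i :=
  (hx.prodMk hy).exprOn (e := .div (.fst (.var 0)) (.snd (.var 0))) ⟨Nat.one_pos, Nat.one_pos⟩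
    fun _ => rfl

theorem Computes.mod (hx : Γ.Computes x) (hy : Γ.Computes y) : Γ.Computes fun i => x i % y i :=
  (hx.sub (hy.mul (hx.div hy))).congr fun i => by rw [Int.emod_def]

theorem Computes.le (hx : Γ.Computes x) (hy : Γ.Computes y) :
    Γ.Computes fun i => decide (x i ≤ y i) :=
  (hx.prodMk hy).exprOn (e := .le (.fst (.var 0)) (.snd (.var 0))) ⟨Nat.one_pos, Nat.one_pos⟩
    fun i => by
      change _ = Data.int (if decide (x i ≤ y i) = true then 1 else 0)
      simp only [decide_eq_true_eq]
      rfl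

theorem Computes.cast (hn : Γ.Computes n) : Γ.Computes fun i => (n i : ℤ) := hn.recode fun _ => rfl

theorem Computes.ofCast (hn : Γ.Computes fun i => (n i : ℤ)) : Γ.Computes n :=
  hn.recode fun _ => rfl

theorem Computes.natAdd (hm : Γ.Computes m) (hn : Γ.Computes n) : Γ.Computes fun i => m i + n i :=
  Computes.ofCast ((hm.cast.add hn.cast).congr fun i => by push_cast; rfl)

theorem Computes.natDiv (hm : Γ.Computes m) (hn : Γ.Computes n) : Γ.Computes fun i => m i / n i :=
  Computes.ofCast ((hm.cast.div hn.cast).congr fun i => by push_cast; rfl)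

theorem Computes.natMod (hm : Γ.Computes m) (hn : Γ.Computes n) : Γ.Computes fun i => m i % n i :=
  Computes.ofCast ((hm.cast.mod hn.cast).congr fun i => by push_cast; rfl)

theorem Computes.natLe (hm : Γ.Computes m) (hn : Γ.Computes n) :
    Γ.Computes fun i => decide (m i ≤ n i) :=
  (hm.cast.le hn.cast).congr fun i => by simp

theorem Computes.natLt (hm : Γ.Computes m) (hn : Γ.Computes n) :
    Γ.Computes fun i => decide (m i < n i) :=
  ((hm.natAdd (constNat Γ 1)).natLe hn).congr fun i => by simp

end Arithmetic

theorem Computes.dataIte {t a b : Γ.Index → Data} (ht : Γ.Computes t) (ha : Γ.Computes a)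
    (hb : Γ.Computes b) : Γ.Computes fun i => if (t i).truthy = true then a i else b i := by
  have h := ht.prodMk (Computes.input Γ)
  -- The test value travels next to the original input, which either branch then restores before
  -- running.
  let Δ : Ctx := ⟨Γ.Index, Γ.oracle, fun i => .pair (t i) (Γ.input i)⟩
  refine Computes.subst (Γ := Γ) (Δ := Δ) (b := fun i : Γ.Index =>
    if (t i).truthy = true then a i else b i) ?_ id (fun _ => rfl) (h.recode fun i => rfl)
  obtain ⟨c, k, T, hT, hc⟩ := ha
  obtain ⟨c', k', T', hT', hc'⟩ := hb
  have hin : Δ.Bdd fun i => (Γ.input i).size := (Bdd.size Δ).mono fun i => by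
    simp only [Δ, Data.size]; omega
  have hT1 : Δ.Bdd T := by
    obtain ⟨p, hp⟩ := hT
    exact (hin.eval p).mono hp
  have hT2 : Δ.Bdd T' := by
    obtain ⟨p, hp⟩ := hT'
    exact (hin.eval p).mono hp
  refine ⟨.ite (.fst (.var 0)) (.seq (.assign 0 (.snd (.var 0))) c)
    (.seq (.assign 0 (.snd (.var 0))) c'), max k k', _,
    ((Bdd.const Δ 2).add (((Bdd.const Δ 4).mul (Bdd.size Δ)))).add (hT1.add hT2),
    fun i s h0 hs => ?_⟩
  have hassign := Prog.Exec.assign (O := Γ.oracle i) s 0 (.snd (.var 0))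
  have hsnd : Expr.eval s (.snd (.var 0)) = Γ.input i := by simp [Expr.eval, h0, Δ, Data.snd]
  rw [hsnd] at hassign
  have hfst : Expr.eval s (.fst (.var 0)) = t i := by simp [Expr.eval, h0, Δ, Data.fst]
  have hclear : ∀ x, 0 < x → x < max k k' → Function.update s 0 (Γ.input i) x = .int 0 := by
    intro x hx hk
    rw [Function.update_of_ne hx.ne']
    exact hs x hx hk
  by_cases hti : (t i).truthy = true
  · obtain ⟨t₁, ht₁, he₁⟩ := hc i (Function.update s 0 (Γ.input i)) (by simp)
      fun x hx hk => hclear x hx (by omega)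
    rw [Function.update_idem] at he₁
    refine ⟨_, ?_, .iteTrue (by rw [hfst, hti]) (.seq hassign (by simpa [hti] using he₁))⟩
    simp only [Expr.cost, Expr.eval, h0]
    omega
  · obtain ⟨t₁, ht₁, he₁⟩ := hc' i (Function.update s 0 (Γ.input i)) (by simp)
      fun x hx hk => hclear x hx (by omega)
    rw [Function.update_idem] at he₁
    refine ⟨_, ?_, .iteFalse (by simpa [hfst] using hti) (.seq hassign (by simpa [hti] using he₁))⟩
    simp only [Expr.cost, Expr.eval, h0]
    omega

theorem Computes.ite {p : Γ.Index → Prop} [DecidablePred p] {a b : Γ.Index → α}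
    (hp : Γ.Computes fun i => decide (p i)) (ha : Γ.Computes a) (hb : Γ.Computes b) :
    Γ.Computes fun i => if p i then a i else b i := by
  refine (hp.data.dataIte ha.data hb.data).recode fun i => ?_
  change (if (Data.int (if decide (p i) = true then 1 else 0)).truthy = true then _ else _) = _
  by_cases h : p i <;> simp [h, Data.truthy]

theorem Computes.natSub {m n : Γ.Index → ℕ} (hm : Γ.Computes m) (hn : Γ.Computes n) :
    Γ.Computes fun i => m i - n i :=
  Computes.ofCast (((hn.natLe hm).ite (hm.cast.sub hn.cast) (const Γ 0)).congr fun i => by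
    split_ifs <;> omega)

/-- Reading the answer is charged, and nothing about an arbitrary oracle limits its length, so the
bound on the answers is a separate hypothesis. -/
theorem Computes.query {b : Γ.Index → α} (hb : Γ.Computes b) {r : Γ.Index → β}
    (hr : ∀ i, Γ.oracle i (enc (b i)) = enc (r i)) (hs : Γ.Bdd fun i => (enc (r i)).size) :
    Γ.Computes r := by
  have hsb := hb.bdd_size
  obtain ⟨c, k, T, hT, hc⟩ := hb
  refine ⟨.seq c (.query 0 (.var 0)), max k 1, _,
    hT.add (((Bdd.const Γ 1).add ((Bdd.const Γ 2).mul hsb)).add hs),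
    fun i => (hc i).seq fun s h0 _ => ?_⟩
  have h := Prog.Exec.query (O := Γ.oracle i) s 0 (.var 0)
  simp only [Expr.eval, Expr.cost, h0, hr i] at h
  exact ⟨_, by omega, h⟩

theorem Computes.callFP {P : Problem} (hP : P.InFP) {q : Γ.Index → P.Instance}
    (hq : Γ.Computes fun i => P.input (q i)) : Γ.Computes fun i => P.answer (q i) := by
  obtain ⟨c, p, hc, hcp⟩ := hP
  obtain ⟨k, hk⟩ := c.exists_varsBelow
  -- All oracles are admitted: a program without queries runs alike under each of them.
  let Δ : Ctx := ⟨P.Instance × (Data → Data), fun j => j.2, fun j => P.input j.1⟩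
  have h : Δ.Computes fun j => P.answer j.1 := by
    refine ⟨_, k + 1, _, ((Bdd.size Δ).eval p).add (Bdd.const Δ (1 + 2 * k)), fun j =>
      Prog.OutputsWithin.transforms (hk.mono (by omega)) ?_⟩
    obtain ⟨s, t, he, hs, ht⟩ := hcp j.1
    exact ⟨s, t, he.of_oracleFree hc _, hs, ht⟩
  exact h.subst (fun i => (q i, Γ.oracle i)) (fun _ => rfl) hq

/-- A loop, given by the sequence of its states. It runs as long as the first component of the
state is true. -/
theorem Computes.while {st : Γ.Index → ℕ → Data} {N : Γ.Index → ℕ} {S : Γ.Index → ℕ}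
    (h0 : Γ.Computes fun i => st i 0) (hN : Γ.Bdd N) (hS : Γ.Bdd S)
    (hst : ∀ i, ∀ j ≤ N i, (st i j).size ≤ S i)
    (hbody : Computes ⟨{q : Γ.Index × ℕ // q.2 < N q.1}, fun q => Γ.oracle q.1.1,
      fun q => st q.1.1 q.1.2⟩ fun q => st q.1.1 (q.1.2 + 1))
    (htrue : ∀ i, ∀ j < N i, (st i j).fst.truthy = true)
    (hfalse : ∀ i, (st i (N i)).fst.truthy = false) : Γ.Computes fun i => st i (N i) := by
  obtain ⟨c, k, T, hT, hc⟩ := h0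
  obtain ⟨c', k', T', ⟨p, hp⟩, hc'⟩ := hbody
  refine ⟨_, _, _, hT.add ((hN.add (Bdd.const Γ 1)).mul
    (((Bdd.const Γ 1).add ((Bdd.const Γ 2).mul hS)).add (hS.eval p))),
    fun i => (hc i).seq (Prog.Transforms.while (c := c') (k := k') (hst i) (fun j hj => ?_) (htrue i)
      (hfalse i))⟩
  exact (hc' ⟨(i, j), hj⟩).mono le_rfl
    ((hp ⟨(i, j), hj⟩).trans (p.eval_mono_nat (hst i j hj.le)))

/-- Extension of the inputs by the value of one more variable. -/
def ext (Γ : Ctx) (P : Γ.Index → α → Prop) : Ctx where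
  Index := {q : Γ.Index × α // P q.1 q.2}
  oracle q := Γ.oracle q.1.1
  input q := .pair (Γ.input q.1.1) (enc q.1.2)

theorem Computes.lift {P : Γ.Index → β → Prop} {b : Γ.Index → α} (h : Γ.Computes b) :
    (Γ.ext P).Computes fun q => b q.1.1 :=
  h.subst (Γ := Γ.ext P) (fun q => q.1.1) (fun _ => rfl)
    ((Computes.input _).dataFst.recode fun _ => rfl)

theorem Computes.newVar (Γ : Ctx) (P : Γ.Index → α → Prop) : (Γ.ext P).Computes fun q => q.1.2 :=
  (Computes.input _).dataSnd.recode fun _ => rfl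

theorem Bdd.lift {P : Γ.Index → α → Prop} {u : Γ.Index → ℕ} (h : Γ.Bdd u) :
    (Γ.ext P).Bdd fun q => u q.1.1 := by
  obtain ⟨p, hp⟩ := h
  exact ⟨p, fun q => (hp _).trans (p.eval_mono_nat (by simp only [ext, Data.size]; omega))⟩

/-- Bounds in an extended family whose new variable is polynomially bounded. -/
theorem Bdd.unlift {P : Γ.Index → α → Prop} {u : (Γ.ext P).Index → ℕ} (h : (Γ.ext P).Bdd u)
    {B : Γ.Index → ℕ} (hB : Γ.Bdd B) (hP : ∀ i a, P i a → (enc a).size ≤ B i) :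
    ∃ v, Γ.Bdd v ∧ ∀ q, u q ≤ v q.1.1 := by
  obtain ⟨p, hp⟩ := h
  refine ⟨_, (((Bdd.const Γ 1).add (Bdd.size Γ)).add hB).eval p, fun q => (hp q).trans
    (p.eval_mono_nat ?_)⟩
  have := hP _ _ q.2
  simp only [ext, Data.size]
  omega

/-- The predicate `P` confines the step function to the pairs of accumulator and entry that really
occur, so it need be computable only there. -/
theorem Computes.foldl {l : Γ.Index → List α} {b : Γ.Index → β} {f : Γ.Index → β → α → β}
    {P : Γ.Index → β × α → Prop} {S : Γ.Index → ℕ} (hl : Γ.Computes l) (hb : Γ.Computes b)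
    (hf : (Γ.ext P).Computes fun q => f q.1.1 q.1.2.1 q.1.2.2)
    (hP : ∀ i l₁ x l₂, l i = l₁ ++ x :: l₂ → P i (l₁.foldl (f i) (b i), x))
    (hS : Γ.Bdd S) (hfS : ∀ i l₁ l₂, l i = l₁ ++ l₂ → (enc (l₁.foldl (f i) (b i))).size ≤ S i) :
    Γ.Computes fun i => (l i).foldl (f i) (b i) := by
  -- The remaining list comes first because it is the loop guard: the empty list is encoded by the
  -- false datum `int 0`. The input is carried along for use by the step function.
  let st : Γ.Index → ℕ → Data := fun i j =>
    .pair (enc ((l i).drop j)) (.pair (Γ.input i) (enc (((l i).take j).foldl (f i) (b i))))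
  have h : Γ.Computes fun i => st i (l i).length := by
    refine Computes.while (S := fun i => 2 + (enc (l i)).size + (Γ.input i).size + S i)
      ((hl.prodMk ((Computes.input Γ).prodMk hb)).recode fun i => ?_)
      (hl.bdd_size.mono fun i => (length_lt_size_enc _).le)
      ((((Bdd.const Γ 2).add hl.bdd_size).add (Bdd.size Γ)).add hS) (fun i j _ => ?_) ?_
      (fun i j hj => ?_) fun i => ?_
    · simp [st]
    · have h1 := hfS i ((l i).take j) ((l i).drop j) (by simp)
      have h2 := size_enc_append ((l i).take j) ((l i).drop j)
      rw [List.take_append_drop] at h2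
      have h3 := (enc ((l i).take j)).size_pos
      simp only [st, Data.size]
      omega
    · set Δ : Ctx := ⟨{q : Γ.Index × ℕ // q.2 < (l q.1).length}, fun q => Γ.oracle q.1.1,
        fun q => st q.1.1 q.1.2⟩
      have hin := Computes.input Δ
      have hbody := hf.subst (Γ := Δ) (fun q => ⟨(q.1.1,
        (((l q.1.1).take q.1.2).foldl (f q.1.1) (b q.1.1), (l q.1.1)[q.1.2]'q.2)),
        hP _ _ _ ((l q.1.1).drop (q.1.2 + 1)) (by simp)⟩) (fun _ => rfl)
        ((hin.dataSnd.dataFst.dataPair (hin.dataSnd.dataSnd.dataPair hin.dataFst.dataFst)).recode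
          fun q => by
            simp only [Δ, st, List.drop_eq_getElem_cons q.2]
            rfl)
      refine (hin.dataFst.dataSnd.dataPair (hin.dataSnd.dataFst.dataPair hbody.data)).recode
        fun q => ?_
      simp only [Δ, st, List.drop_eq_getElem_cons q.2, List.take_succ_eq_append_getElem q.2,
        List.foldl_append]
      rfl
    · simp only [st, List.drop_eq_getElem_cons hj]
      rfl
    · simp [st, Data.fst, Data.truthy]
  refine h.dataSnd.dataSnd.recode fun i => ?_
  simp [st, Data.snd]

/-- A loop over a list that adds a polynomially bounded amount to the accumulator in each step. -/
theorem Computes.foldl_of_growth {l : Γ.Index → List α} {b : Γ.Index → β}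
    {f : Γ.Index → β → α → β} {g : Γ.Index → ℕ} (hl : Γ.Computes l) (hb : Γ.Computes b)
    (hf : (Γ.ext fun i (q : β × α) => q.2 ∈ l i).Computes fun q => f q.1.1 q.1.2.1 q.1.2.2)
    (hg : Γ.Bdd g)
    (hfg : ∀ i y, ∀ x ∈ l i, (enc (f i y x)).size ≤ (enc y).size + g i) :
    Γ.Computes fun i => (l i).foldl (f i) (b i) := by
  refine Computes.foldl hl hb hf (fun i l₁ x l₂ h => by simp [h])
    (hb.bdd_size.add (hl.bdd_size.mul hg)) fun i l₁ l₂ h => ?_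
  have key : ∀ l' : List α, (∀ x ∈ l', x ∈ l i) → ∀ y,
      (enc (l'.foldl (f i) y)).size ≤ (enc y).size + l'.length * g i := by
    intro l'
    induction l' with
    | nil => simp
    | cons a l' ih =>
      intro hl' y
      have h1 := ih (fun x hx => hl' x (List.mem_cons_of_mem _ hx)) (f i y a)
      have h2 := hfg i y a (hl' a (by simp))
      simp only [List.foldl_cons, List.length_cons, add_mul]
      omega
  refine (key l₁ (fun x hx => by simp [h, hx]) (b i)).trans (Nat.add_le_add_left
    (Nat.mul_le_mul_right _ ?_) _)
  have := length_lt_size_enc (l i)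
  rw [h, List.length_append] at this
  rw [h]
  omega

theorem Computes.reverse {l : Γ.Index → List α} (hl : Γ.Computes l) :
    Γ.Computes fun i => (l i).reverse := by
  refine (Computes.foldl_of_growth (f := fun _ y x => x :: y) (g := fun i => 1 + (enc (l i)).size)
    hl (nil Γ) ((newVar _ _).snd.cons (newVar _ _).fst) ((Bdd.const Γ 1).add hl.bdd_size)
    fun i y x hx => ?_).congr fun i => ?_
  · have := size_enc_le_of_mem hx
    simp only [enc_cons, Data.size]
    omega
  · simp

/-- A loop over the reversed list that puts each value in front; every entry is bounded by the
input, hence so is every value. -/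
theorem Computes.map {l : Γ.Index → List α} {f : Γ.Index → α → β} (hl : Γ.Computes l)
    (hf : (Γ.ext fun i x => x ∈ l i).Computes fun q => f q.1.1 q.1.2) :
    Γ.Computes fun i => (l i).map (f i) := by
  obtain ⟨v, hv, hfv⟩ := hf.bdd_size.unlift hl.bdd_size fun i x hx => size_enc_le_of_mem hx
  refine (Computes.foldl_of_growth (f := fun i y x => f i x :: y) (g := fun i => 1 + v i)
    hl.reverse (nil Γ) (Computes.cons (Computes.subst hf
      (Γ := Γ.ext fun i (q : List β × α) => q.2 ∈ (l i).reverse)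
      (fun q => ⟨(q.1.1, q.1.2.2), by simpa using q.2⟩) (fun _ => rfl)
      (((Computes.input Γ).lift.dataPair (newVar _ _).snd.data).recode fun _ => rfl))
      (newVar _ _).fst) ((Bdd.const Γ 1).add hv) fun i y x hx => ?_).congr fun i => ?_
  · have := hfv ⟨(i, x), by simpa using hx⟩
    simp only [enc_cons, Data.size] at this ⊢
    omega
  · rw [List.foldl_reverse]
    induction l i with
    | nil => rfl
    | cons a l ih => simp [ih]

end Ctx

/-! ## Polynomial-time arithmetic -/

/-- The product bound would let an accumulator's length multiply in each round; the additive one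
keeps long sums polynomial. -/
theorem Data.size_int_add_le_add (x y : ℤ) :
    (Data.int (x + y)).size ≤ (Data.int x).size + (Data.int y).size := by
  simp only [Data.size]
  have h0 : (x + y).natAbs ≤ x.natAbs + y.natAbs := Int.natAbs_add_le x y
  have h1 := Nat.lt_size_self x.natAbs
  have h2 := Nat.lt_size_self y.natAbs
  have h3 : Nat.size (x + y).natAbs ≤ Nat.size x.natAbs + Nat.size y.natAbs + 1 := by
    rw [Nat.size_le, pow_succ, pow_add]
    have ha : 1 ≤ 2 ^ Nat.size x.natAbs := Nat.one_le_two_pow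
    have hb : 1 ≤ 2 ^ Nat.size y.natAbs := Nat.one_le_two_pow
    nlinarith
  omega

theorem Data.size_int_le_of_natAbs_le {x : ℤ} {n : ℕ} (h : x.natAbs ≤ n) :
    (Data.int x).size ≤ n + 1 := by
  simp only [Data.size]
  have : Nat.size x.natAbs ≤ n := Nat.size_le.2 (h.trans_lt Nat.lt_two_pow_self)
  omega

namespace Ctx

variable {Γ : Ctx} {α β : Type} [Enc α] [Enc β]

theorem Computes.restrict {P Q : Γ.Index → α → Prop} {f : Γ.Index → α → β}
    (h : (Γ.ext Q).Computes fun q => f q.1.1 q.1.2) (hPQ : ∀ i a, P i a → Q i a) :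
    (Γ.ext P).Computes fun q => f q.1.1 q.1.2 :=
  h.subst (Γ := Γ.ext P) (fun q => ⟨q.1, hPQ _ _ q.2⟩) (fun _ => rfl) (Computes.input _)

theorem Computes.listSum {l : Γ.Index → List ℤ} (hl : Γ.Computes l) :
    Γ.Computes fun i => (l i).sum := by
  refine (Computes.foldl_of_growth (f := fun _ y x => y + x) (g := fun i => (enc (l i)).size)
    hl (const Γ 0) ((newVar _ _).fst.add (newVar _ _).snd) hl.bdd_size
    fun i y x hx => ?_).congr fun i => (List.sum_eq_foldl ..).symm
  have := size_enc_le_of_mem hx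
  have := Data.size_int_add_le_add y x
  simp only [enc_int] at *
  omega

theorem Computes.listProd {l : Γ.Index → List ℤ} (hl : Γ.Computes l) :
    Γ.Computes fun i => (l i).prod := by
  refine (Computes.foldl_of_growth (f := fun _ y x => y * x) (g := fun i => (enc (l i)).size)
    hl (const Γ 1) ((newVar _ _).fst.mul (newVar _ _).snd) hl.bdd_size
    fun i y x hx => ?_).congr fun i => (List.prod_eq_foldl ..).symm
  have := size_enc_le_of_mem hx
  have := Data.size_int_mul_add_one_le y x
  simp only [enc_int] at *
  omega

/-- Computable numbers that are polynomially bounded, so that a loop can run up to them. -/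
structure Small (Γ : Ctx) (n : Γ.Index → ℕ) : Prop where
  computes : Γ.Computes n
  bdd : Γ.Bdd n

section Small

variable {m n : Γ.Index → ℕ}

theorem Small.const (Γ : Ctx) (c : ℕ) : Γ.Small fun _ => c := ⟨.constNat Γ c, .const Γ c⟩

theorem Small.add (hm : Γ.Small m) (hn : Γ.Small n) : Γ.Small fun i => m i + n i :=
  ⟨hm.1.natAdd hn.1, hm.2.add hn.2⟩

theorem Small.sub (hm : Γ.Small m) (hn : Γ.Small n) : Γ.Small fun i => m i - n i :=
  ⟨hm.1.natSub hn.1, hm.2.mono fun _ => Nat.sub_le _ _⟩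

theorem Small.lift (hn : Γ.Small n) {P : Γ.Index → α → Prop} :
    (Γ.ext P).Small fun q => n q.1.1 :=
  ⟨hn.1.lift, hn.2.lift⟩

theorem Small.newVar (hn : Γ.Small n) :
    (Γ.ext fun i k => k < n i).Small fun q => q.1.2 :=
  ⟨Computes.newVar _ _, hn.2.lift.mono fun q => q.2.le⟩

theorem Small.ite {p : Γ.Index → Prop} [DecidablePred p] (hp : Γ.Computes fun i => decide (p i))
    (hm : Γ.Small m) (hn : Γ.Small n) : Γ.Small fun i => if p i then m i else n i :=
  ⟨hp.ite hm.1 hn.1, (hm.2.add hn.2).mono fun i => by split_ifs <;> omega⟩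

theorem Small.range (hn : Γ.Small n) : Γ.Computes fun i => List.range (n i) := by
  -- Counting down makes the counter the loop guard and lets the list grow at its front in
  -- increasing order.
  let st : Γ.Index → ℕ → Data := fun i j => enc (n i - j, List.range' (n i - j) j)
  have h : Γ.Computes fun i => st i (n i) := by
    refine Computes.while (S := fun i => 1 + (n i + 1) + (1 + n i * (n i + 1 + 1)))
      (((hn.1.prodMk (Computes.nil (α := ℕ) Γ))).recode fun i => ?_) hn.2
      (((Bdd.const Γ 1).add (hn.2.add (Bdd.const Γ 1))).add ((Bdd.const Γ 1).add
        (hn.2.mul ((hn.2.add (Bdd.const Γ 1)).add (Bdd.const Γ 1)))))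
      (fun i j hj => ?_) ?_ (fun i j hj => ?_) fun i => ?_
    · simp [st]
    · have h1 : (enc (List.range' (n i - j) j)).size ≤ 1 + j * (n i + 1 + 1) := by
        have := size_enc_list_le (l := List.range' (n i - j) j) (B := n i + 1) fun x hx => by
          rw [enc_nat]
          rw [List.mem_range'_1] at hx
          exact Data.size_int_le_of_natAbs_le (by simp; omega)
        simpa using this
      have h2 : (Data.int (n i - j : ℕ)).size ≤ n i + 1 :=
        Data.size_int_le_of_natAbs_le (by simp)
      have h3 := Nat.mul_le_mul_right (n i + 1 + 1) hj
      simp only [st, enc_prod, Data.size, enc_nat] at *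
      omega
    · set Δ : Ctx := ⟨{q : Γ.Index × ℕ // q.2 < n q.1}, fun q => Γ.oracle q.1.1,
        fun q => st q.1.1 q.1.2⟩
      have hin : Δ.Computes fun q => (n q.1.1 - q.1.2, List.range' (n q.1.1 - q.1.2) q.1.2) :=
        (Computes.input Δ).recode fun _ => rfl
      have hc : Δ.Computes fun q => n q.1.1 - q.1.2 - 1 := hin.fst.natSub (.constNat Δ 1)
      refine (hc.prodMk (hc.cons hin.snd)).recode fun q => ?_
      obtain ⟨⟨i, j⟩, hj⟩ := q
      simp only [st, enc_data]
      dsimp only at hj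
      rw [show n i - (j + 1) = n i - j - 1 by omega, List.range'_succ,
        show n i - j - 1 + 1 = n i - j by omega]
    · simp only [st, enc_prod, Data.fst, enc_nat, Data.truthy]
      simpa using Nat.sub_ne_zero_of_lt hj
    · simp [st, Data.fst, Data.truthy]
  refine h.dataSnd.recode fun i => ?_
  simp [st, Data.snd, List.range_eq_range']

theorem Small.map_range (hn : Γ.Small n) {f : Γ.Index → ℕ → α}
    (hf : (Γ.ext fun i k => k < n i).Computes fun q => f q.1.1 q.1.2) :
    Γ.Computes fun i => (List.range (n i)).map (f i) :=
  hn.range.map (hf.restrict fun _ _ => List.mem_range.1)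

theorem Small.sum (hn : Γ.Small n) {f : Γ.Index → ℕ → ℤ}
    (hf : (Γ.ext fun i k => k < n i).Computes fun q => f q.1.1 q.1.2) :
    Γ.Computes fun i => ∑ k ∈ Finset.range (n i), f i k :=
  (hn.map_range hf).listSum.congr fun i => by
    rw [← List.sum_toFinset _ List.nodup_range, List.toFinset_range]

theorem Small.prod (hn : Γ.Small n) {f : Γ.Index → ℕ → ℤ}
    (hf : (Γ.ext fun i k => k < n i).Computes fun q => f q.1.1 q.1.2) :
    Γ.Computes fun i => ∏ k ∈ Finset.range (n i), f i k :=
  (hn.map_range hf).listProd.congr fun i => by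
    rw [← List.prod_toFinset _ List.nodup_range, List.toFinset_range]

theorem Small.pow (hn : Γ.Small n) {x : Γ.Index → ℤ} (hx : Γ.Computes x) :
    Γ.Computes fun i => x i ^ n i :=
  (hn.prod (f := fun i _ => x i) hx.lift).congr fun i => by simp

theorem Small.factorial (hn : Γ.Small n) : Γ.Computes fun i => ((n i).factorial : ℤ) :=
  (hn.prod (f := fun _ k => ((k + 1 : ℕ) : ℤ))
    (hn.newVar.add (Small.const _ 1)).1.cast).congr fun i => by
      rw [← Finset.prod_range_add_one_eq_factorial]; push_cast; rfl

theorem Small.choose (hn : Γ.Small n) (hm : Γ.Small m) :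
    Γ.Computes fun i => ((n i).choose (m i) : ℤ) :=
  ((hm.1.natLe hn.1).ite (hn.factorial.div (hm.factorial.mul (hn.sub hm).factorial))
    (Computes.const Γ 0)).congr fun i => by
      split_ifs with h
      · rw [Nat.choose_eq_factorial_div_factorial h]; push_cast; rfl
      · rw [Nat.choose_eq_zero_of_lt (by omega)]; rfl

theorem Small.unary (hn : Γ.Small n) : Γ.Computes fun i => Data.unary (n i) :=
  (hn.map_range (f := fun _ _ => ()) (Computes.unit _)).recode fun i => by
    rw [enc_data, ← enc_replicate_unit]
    congr 1
    rw [List.map_const', List.length_range]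

end Small

theorem Computes.length {l : Γ.Index → List α} (hl : Γ.Computes l) :
    Γ.Small fun i => (l i).length := by
  refine ⟨?_, hl.bdd_size.mono fun i => (length_lt_size_enc _).le⟩
  refine (Computes.foldl_of_growth (f := fun _ y _ => y + 1) (g := fun i => 2)
    hl (constNat Γ 0) ((newVar _ _).fst.natAdd (constNat _ 1)) (Bdd.const Γ 2)
    fun i y x hx => ?_).congr fun i => ?_
  · have := Data.size_int_add_le_add y 1
    simpa [Data.size] using this
  · simp

theorem Computes.tail {l : Γ.Index → List α} (hl : Γ.Computes l) :
    Γ.Computes fun i => (l i).tail :=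
  hl.data.dataSnd.recode fun i => by cases l i <;> rfl

theorem Computes.drop {l : Γ.Index → List α} {k : Γ.Index → ℕ} (hl : Γ.Computes l)
    (hk : Γ.Small k) : Γ.Computes fun i => (l i).drop (k i) := by
  refine (Computes.foldl_of_growth (f := fun _ (y : List α) (_ : ℕ) => y.tail) (g := fun i => 0)
    hk.range hl (newVar _ _).fst.tail (Bdd.const Γ 0) fun i y x hx => ?_).congr fun i => ?_
  · cases y with
    | nil => simp
    | cons a y => simp [Data.size]
  · generalize k i = n
    induction n with
    | zero => simp
    | succ n ih => rw [List.range_succ, List.foldl_append, ih]; simp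

theorem Computes.getData {l : Γ.Index → List α} {k : Γ.Index → ℕ} (hl : Γ.Computes l)
    (hk : Γ.Small k) : Γ.Computes fun i => ((l i).map enc).getD (k i) (.int 0) := by
  -- The machine's first component of an exhausted list is `int 0`, which dictates the default
  -- value.
  refine (hl.drop hk).data.dataFst.congr fun i => ?_
  rw [List.getD_eq_getElem?_getD, List.getElem?_map, ← List.head?_drop]
  cases (l i).drop (k i) <;> rfl

theorem Computes.getD {l : Γ.Index → List ℤ} {k : Γ.Index → ℕ} (hl : Γ.Computes l)
    (hk : Γ.Small k) : Γ.Computes fun i => (l i).getD (k i) 0 :=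
  (hl.getData hk).recode fun i => by
    rw [show Data.int 0 = enc (0 : ℤ) from rfl, List.getD_map]; rfl

theorem Computes.foldr_of_growth {l : Γ.Index → List α} {b : Γ.Index → β}
    {f : Γ.Index → α → β → β} {g : Γ.Index → ℕ} (hl : Γ.Computes l) (hb : Γ.Computes b)
    (hf : (Γ.ext fun i (q : β × α) => q.2 ∈ l i).Computes fun q => f q.1.1 q.1.2.2 q.1.2.1)
    (hg : Γ.Bdd g)
    (hfg : ∀ i y, ∀ x ∈ l i, (enc (f i x y)).size ≤ (enc y).size + g i) :
    Γ.Computes fun i => (l i).foldr (f i) (b i) :=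
  (Computes.foldl_of_growth (f := fun i y x => f i x y) hl.reverse hb
    (hf.restrict (f := fun i (q : β × α) => f i q.2 q.1) fun _ _ => List.mem_reverse.1) hg
    fun i y x hx => hfg i y x (List.mem_reverse.1 hx)).congr fun i => by simp

/-! ### The Euclidean algorithm -/

/-- One step of the Euclidean algorithm. -/
def euclidStep (q : ℕ × ℕ) : ℕ × ℕ := (q.2 % q.1, q.1)

theorem gcd_euclidStep_iterate (q : ℕ × ℕ) (j : ℕ) :
    Nat.gcd (euclidStep^[j] q).1 (euclidStep^[j] q).2 = Nat.gcd q.1 q.2 := by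
  induction j with
  | zero => rfl
  | succ j ih =>
    rw [Function.iterate_succ_apply', euclidStep, ← Nat.gcd_rec, ih]

theorem euclidStep_iterate_le (q : ℕ × ℕ) (j : ℕ) :
    (euclidStep^[j] q).1 ≤ q.1 + q.2 ∧ (euclidStep^[j] q).2 ≤ q.1 + q.2 := by
  induction j with
  | zero => simp
  | succ j ih =>
    rw [Function.iterate_succ_apply']
    exact ⟨(Nat.mod_le _ _).trans ih.2, ih.1⟩

/-- For 0 < a ≤ b one has b ≥ a + (b mod a) > 2(b mod a), so replacing b by the remainder loses at
least one bit in every step. -/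
theorem exists_euclidStep_iterate_eq_zero (s : ℕ) (q : ℕ × ℕ) (hq : q.1 ≤ q.2)
    (hs : Nat.size q.1 + Nat.size q.2 ≤ s) : ∃ j ≤ s, (euclidStep^[j] q).1 = 0 := by
  induction s generalizing q with
  | zero =>
    refine ⟨0, le_rfl, ?_⟩
    have : Nat.size q.1 = 0 := by omega
    simpa [Nat.size_eq_zero] using this
  | succ s ih =>
    rcases Nat.eq_zero_or_pos q.1 with h | h
    · exact ⟨0, by omega, h⟩
    have hlt : q.2 % q.1 < q.1 := Nat.mod_lt _ h
    have hsize : Nat.size (q.2 % q.1) + 1 ≤ Nat.size q.2 := by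
      have h2 : 0 < Nat.size q.2 := Nat.size_pos.2 (h.trans_le hq)
      obtain ⟨a, ha⟩ := Nat.exists_eq_succ_of_ne_zero h2.ne'
      rw [ha, Nat.succ_eq_add_one, Nat.add_le_add_iff_right, Nat.size_le]
      have h3 := Nat.lt_size_self q.2
      rw [ha, pow_succ] at h3
      have h4 := Nat.div_add_mod q.2 q.1
      have h5 : 1 ≤ q.2 / q.1 := (Nat.one_le_div_iff h).2 hq
      nlinarith
    obtain ⟨j, hj, hj0⟩ := ih (euclidStep q) hlt.le (by simp only [euclidStep]; omega)
    exact ⟨j + 1, by omega, hj0⟩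

theorem Computes.gcd {m n : Γ.Index → ℕ} (hm : Γ.Computes m) (hn : Γ.Computes n) :
    Γ.Computes fun i => Nat.gcd (m i) (n i) := by
  have hex : ∀ i, ∃ j ≤ Nat.size (m i) + Nat.size (n i) + 1,
      (euclidStep^[j] (m i, n i)).1 = 0 := fun i => by
    rcases Nat.eq_zero_or_pos (m i) with h | h
    · exact ⟨0, by omega, h⟩
    -- One preliminary step puts the pair in order, which accounts for the extra 1 in the bound.
    obtain ⟨j, hj, hj0⟩ := exists_euclidStep_iterate_eq_zero (Nat.size (m i) + Nat.size (n i))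
      (euclidStep (m i, n i)) (Nat.mod_lt _ h).le (by
        have := Nat.size_le_size (Nat.mod_le (n i) (m i))
        simp only [euclidStep]
        omega)
    exact ⟨j + 1, by omega, hj0⟩
  have hex' : ∀ i, ∃ j, (euclidStep^[j] (m i, n i)).1 = 0 := fun i =>
    (hex i).imp fun _ h => h.2
  -- The loop stops at the first zero, so the number of rounds must be the first hitting time.
  let N : Γ.Index → ℕ := fun i => Nat.find (hex' i)
  have hN : ∀ i, (euclidStep^[N i] (m i, n i)).1 = 0 := fun i => Nat.find_spec (hex' i)
  let st : Γ.Index → ℕ → Data := fun i j => enc (euclidStep^[j] (m i, n i))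
  have h : Γ.Computes fun i => st i (N i) := by
    refine Computes.while (S := fun i => 1 + 2 * (enc (m i + n i)).size)
      ((hm.prodMk hn).recode fun i => rfl) ((hm.bdd_size.add hn.bdd_size).mono fun i => ?_)
      ((Bdd.const Γ 1).add ((Bdd.const Γ 2).mul (hm.natAdd hn).bdd_size)) (fun i j hj => ?_) ?_
      (fun i j hj => ?_) fun i => ?_
    · obtain ⟨j, hj, hj0⟩ := hex i
      have : N i ≤ j := Nat.find_min' _ hj0
      simp only [enc_nat, Data.size, Int.natAbs_natCast]
      omega
    · obtain ⟨h1, h2⟩ := euclidStep_iterate_le (m i, n i) j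
      have h3 := Data.size_int_mono (x := (euclidStep^[j] (m i, n i)).1) (y := (m i + n i : ℕ)) h1
      have h4 := Data.size_int_mono (x := (euclidStep^[j] (m i, n i)).2) (y := (m i + n i : ℕ)) h2
      simp only [st, enc_prod, Data.size, enc_nat] at *
      omega
    · set Δ : Ctx := ⟨{q : Γ.Index × ℕ // q.2 < N q.1}, fun q => Γ.oracle q.1.1,
        fun q => st q.1.1 q.1.2⟩
      have hin : Δ.Computes fun q => euclidStep^[q.1.2] (m q.1.1, n q.1.1) :=
        (Computes.input Δ).recode fun _ => rfl
      refine ((hin.snd.natMod hin.fst).prodMk hin.fst).recode fun q => ?_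
      simp only [st, enc_data, Function.iterate_succ_apply']
      rfl
    · have := Nat.find_min (hex' i) hj
      simp only [st, enc_prod, Data.fst, enc_nat, Data.truthy]
      simpa using this
    · simp [st, Data.fst, Data.truthy, hN]
  refine h.dataSnd.recode fun i => ?_
  have := gcd_euclidStep_iterate (m i, n i) (N i)
  rw [hN, Nat.gcd_zero_left] at this
  simp only [st, enc_prod, Data.snd, enc_data, this]

theorem Computes.natAbs {x : Γ.Index → ℤ} (hx : Γ.Computes x) :
    Γ.Computes fun i => (x i).natAbs :=
  Computes.ofCast (((const Γ 0).le hx).ite hx ((const Γ 0).sub hx) |>.congr fun i => by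
    split_ifs <;> omega)

/-- Reduction of fractions. -/
theorem Computes.ofRat {x : Γ.Index → ℤ} {d : Γ.Index → ℕ} (hx : Γ.Computes x)
    (hd : Γ.Computes d) (hd0 : ∀ i, d i ≠ 0) :
    Γ.Computes fun i => Data.ofRat ((x i : ℚ) / (d i : ℚ)) := by
  have hg : Γ.Computes fun i => Nat.gcd (x i).natAbs (d i) := hx.natAbs.gcd hd
  refine ((hx.div hg.cast).prodMk (hd.natDiv hg)).recode fun i => ?_
  have h : (x i : ℚ) / (d i : ℚ) = Rat.normalize (x i) (d i) (hd0 i) := by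
    rw [Rat.normalize_eq_mkRat, Rat.mkRat_eq_div]
  rw [h]
  simp [Data.ofRat, Rat.normalize_eq]

end Ctx

/-! ## Shapley values and model counts -/

namespace BoolFn

variable {n : ℕ}

-- Swapping two positions shows that all n fibres of the position of i have the same size; together
-- they make up n! permutations.
open Finset in
theorem card_perm_symm_apply_eq (i t : Fin n) :
    #{p : Equiv.Perm (Fin n) | p.symm i = t} = (n - 1).factorial := by
  have hconst : ∀ t' : Fin n, #{p : Equiv.Perm (Fin n) | p.symm i = t'} =
      #{p : Equiv.Perm (Fin n) | p.symm i = t} := fun t' => by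
    refine Finset.card_equiv (Equiv.mulRight (Equiv.swap t t')) fun p => ?_
    simp only [Finset.mem_filter_univ, Equiv.coe_mulRight]
    rw [Equiv.symm_apply_eq, Equiv.symm_apply_eq]
    simp
  have hsum := Finset.card_eq_sum_card_fiberwise (s := (Finset.univ : Finset (Equiv.Perm (Fin n))))
    (t := Finset.univ) (f := fun p => p.symm i) (fun _ _ => Finset.mem_coe.2 (Finset.mem_univ _))
  simp only [hconst, Finset.card_univ, Fintype.card_perm, Fintype.card_fin, Finset.sum_const,
    smul_eq_mul] at hsum
  have hn : 0 < n := i.pos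
  rw [← Nat.mul_factorial_pred hn.ne'] at hsum
  exact (Nat.eq_of_mul_eq_mul_left hn hsum).symm

theorem card_before (p : Equiv.Perm (Fin n)) (i : Fin n) : (before p i).card = p.symm i := by
  have : before p i = (Finset.Iio (p.symm i)).map p.toEmbedding := by
    ext j
    simp [before]
  rw [this, Finset.card_map, Fin.card_Iio]

theorem notMem_before (p : Equiv.Perm (Fin n)) (i : Fin n) : i ∉ before p i := by
  simp [before]

theorem before_mul (σ p : Equiv.Perm (Fin n)) (i : Fin n) (hσ : σ i = i) :
    before (σ * p) i = (before p i).map σ.toEmbedding := by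
  ext j
  have : σ.symm i = i := by rw [Equiv.symm_apply_eq, hσ]
  simp only [before, Finset.mem_filter_univ, Finset.mem_map, Equiv.coe_toEmbedding]
  constructor
  · intro h
    exact ⟨σ.symm j, by simpa [Equiv.Perm.mul_def, this] using h, by simp⟩
  · rintro ⟨j, h, rfl⟩
    simpa [Equiv.Perm.mul_def, this] using h

-- A relabelling that fixes i and carries T to T' induces a bijection between the two sets of
-- permutations.
open Finset in
theorem card_before_eq_of_card_eq (i : Fin n) {T T' : Finset (Fin n)} (hT : i ∉ T) (hT' : i ∉ T')
    (h : #T = #T') :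
    #{p : Equiv.Perm (Fin n) | before p i = T} = #{p : Equiv.Perm (Fin n) | before p i = T'} := by
  obtain ⟨σ, hσ⟩ : ∃ σ : Equiv.Perm (Fin n), σ i = i ∧ T.map σ.toEmbedding = T' := by
    let e : {x // x ∈ T} ≃ {x // x ∈ T'} := Finset.equivOfCardEq h
    have hi : e.extendSubtype i ∉ T' := e.extendSubtype_not_mem i hT
    -- The extended bijection may move i, but only to a point outside T'. Swapping that point back
    -- with i leaves T' alone.
    have hsub : T.map (Equiv.swap (e.extendSubtype i) i * e.extendSubtype).toEmbedding ⊆ T' := by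
      intro x hx
      obtain ⟨j, hj, rfl⟩ := Finset.mem_map.1 hx
      have hj' := e.extendSubtype_mem j hj
      simp only [Equiv.coe_toEmbedding, Equiv.Perm.coe_mul, Function.comp_apply]
      rwa [Equiv.swap_apply_of_ne_of_ne (ne_of_mem_of_not_mem hj' hi)
        (ne_of_mem_of_not_mem hj' hT')]
    exact ⟨_, by simp, Finset.eq_of_subset_of_card_le hsub (by rw [Finset.card_map, h])⟩
  refine Finset.card_equiv (Equiv.mulLeft σ) fun p => ?_
  simp only [Finset.mem_filter_univ, Equiv.coe_mulLeft, before_mul σ p i hσ.1, ← hσ.2]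
  exact (Finset.map_inj).symm

-- The (n-1)! permutations with i in position |T| are distributed evenly over the C(n-1, |T|)
-- possible sets of predecessors; divide.
open Finset in
theorem card_before_eq (i : Fin n) {T : Finset (Fin n)} (hT : i ∉ T) :
    #{p : Equiv.Perm (Fin n) | before p i = T} = (#T).factorial * (n - 1 - #T).factorial := by
  have hn : 0 < n := i.pos
  have hTn : #T ≤ n - 1 := by
    have := Finset.card_le_card (Finset.subset_erase.2 ⟨Finset.subset_univ T, hT⟩)
    simpa using this
  have h := Finset.card_eq_sum_card_fiberwise
    (s := ({p | p.symm i = ⟨#T, by omega⟩} : Finset (Equiv.Perm (Fin n))))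
    (t := powersetCard #T (univ.erase i)) (f := fun p => before p i) (fun p hp => by
      simp only [coe_filter, Finset.mem_univ, true_and, Set.mem_ofPred_eq] at hp
      rw [Finset.mem_coe, Finset.mem_powersetCard, card_before, hp]
      exact ⟨Finset.subset_erase.2 ⟨Finset.subset_univ _, notMem_before p i⟩, rfl⟩)
  have hterm : ∀ T' ∈ powersetCard #T (univ.erase i),
      #{p ∈ ({p | p.symm i = ⟨#T, by omega⟩} : Finset (Equiv.Perm (Fin n))) | before p i = T'} =
      #{p : Equiv.Perm (Fin n) | before p i = T} := by
    intro T' hT'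
    obtain ⟨hT1, hT2⟩ := Finset.mem_powersetCard.1 hT'
    rw [card_before_eq_of_card_eq i hT (Finset.subset_erase.1 hT1).2 hT2.symm, Finset.filter_filter]
    congr 1
    ext p
    simp only [Finset.mem_filter_univ, and_iff_right_iff_imp]
    intro hp
    rw [Fin.ext_iff, ← card_before, hp, hT2]
  rw [Finset.sum_congr rfl hterm, card_perm_symm_apply_eq, Finset.sum_const, smul_eq_mul,
    Finset.card_powersetCard, Finset.card_erase_of_mem (Finset.mem_univ i), Finset.card_univ,
    Fintype.card_fin, ← Nat.choose_mul_factorial_mul_factorial hTn, mul_assoc] at h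
  exact (Nat.eq_of_mul_eq_mul_left (Nat.choose_pos hTn) h).symm

/-- The sum of `F[T]` over the `k`-element subsets `T` of `A`. -/
def countIn (F : BoolFn n) (A : Finset (Fin n)) (k : ℕ) : ℤ :=
  ∑ T ∈ A.powersetCard k, (F.valueOn T : ℤ)

/-- The sum of the marginal contributions of `i` to the `t`-element sets. -/
def marginal (F : BoolFn n) (i : Fin n) (t : ℕ) : ℤ :=
  ∑ T ∈ (Finset.univ.erase i).powersetCard t, ((F.valueOn (insert i T) : ℤ) - F.valueOn T)

theorem countIn_univ (F : BoolFn n) (k : ℕ) :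
    F.countIn Finset.univ k = (F.modelCountOfSize k : ℤ) := by
  simp [countIn, modelCountOfSize]

-- Permutations are grouped by the set of predecessors of i, then these sets by cardinality.
-- Multiplication by n! keeps the right side in the integers.
open Nat in
theorem factorial_mul_shapley (F : BoolFn n) (i : Fin n) :
    (n ! : ℚ) * F.shapley i =
      ((∑ t ∈ Finset.range n, (t ! : ℤ) * ((n - 1 - t)! : ℤ) * F.marginal i t : ℤ) : ℚ) := by
  have hn : (n ! : ℚ) ≠ 0 := by exact_mod_cast n.factorial_ne_zero
  rw [shapley, ← mul_assoc, mul_one_div_cancel hn, one_mul]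
  have h1 : (∑ p : Equiv.Perm (Fin n),
      ((F.valueOn (before p i ∪ {i}) : ℚ) - (F.valueOn (before p i) : ℚ))) =
      ((∑ p : Equiv.Perm (Fin n),
        ((F.valueOn (insert i (before p i)) : ℤ) - (F.valueOn (before p i) : ℤ)) : ℤ) : ℚ) := by
    push_cast
    refine Finset.sum_congr rfl fun p _ => ?_
    rw [Finset.union_comm, ← Finset.insert_eq]
  rw [h1]
  congr 1
  rw [← Finset.sum_fiberwise_of_maps_to (s := Finset.univ) (t := (Finset.univ.erase i).powerset)
    (g := fun p => before p i) (fun p _ => Finset.mem_powerset.2 (Finset.subset_erase.2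
      ⟨Finset.subset_univ _, notMem_before p i⟩))]
  have hcard : (Finset.univ.erase i).card + 1 = n := by
    have := i.pos
    simp
    omega
  rw [Finset.sum_powerset, hcard]
  refine Finset.sum_congr rfl fun t _ => ?_
  rw [marginal, Finset.mul_sum]
  refine Finset.sum_congr rfl fun T hT => ?_
  obtain ⟨hT1, hT2⟩ := Finset.mem_powersetCard.1 hT
  have h2 : ∀ p ∈ Finset.univ.filter (fun p => before p i = T),
      ((F.valueOn (insert i (before p i)) : ℤ) - (F.valueOn (before p i) : ℤ)) =
      (F.valueOn (insert i T) : ℤ) - F.valueOn T := fun p hp => by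
    rw [(Finset.mem_filter.1 hp).2]
  rw [Finset.sum_congr rfl h2, Finset.sum_const, card_before_eq i (Finset.subset_erase.1 hT1).2,
    hT2, nsmul_eq_mul]
  push_cast
  rfl

/-- The (t+1)-sets that contain i are the sets T ∪ {i}; their total is the full count minus the
count over sets that avoid i. Only counts by size of F and of F with X_i set to 0 remain. -/
theorem marginal_eq (F : BoolFn n) (i : Fin n) (t : ℕ) :
    F.marginal i t = F.countIn Finset.univ (t + 1) - F.countIn (Finset.univ.erase i) (t + 1) -
      F.countIn (Finset.univ.erase i) t := by
  have hi : i ∉ (Finset.univ.erase i : Finset (Fin n)) := Finset.notMem_erase _ _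
  have h : F.countIn Finset.univ (t + 1) = F.countIn (Finset.univ.erase i) (t + 1) +
      ∑ T ∈ (Finset.univ.erase i).powersetCard t, (F.valueOn (insert i T) : ℤ) := by
    simp only [countIn]
    conv_lhs => rw [← Finset.insert_erase (Finset.mem_univ i), Finset.powersetCard_succ_insert hi]
    rw [Finset.sum_union, Finset.sum_image]
    · intro T hT T' hT' h
      have h1 := (Finset.mem_powersetCard.1 hT).1
      have h2 := (Finset.mem_powersetCard.1 hT').1
      rw [← Finset.erase_insert (fun h => hi (h1 h)), h, Finset.erase_insert (fun h => hi (h2 h))]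
    · rw [Finset.disjoint_left]
      intro T hT hT'
      obtain ⟨U, -, rfl⟩ := Finset.mem_image.1 hT'
      exact hi ((Finset.mem_powersetCard.1 hT).1 (Finset.mem_insert_self i U))
  rw [h, marginal, Finset.sum_sub_distrib, countIn, countIn]
  ring

/-- Double counting: a k-element set is avoided by n - k indices. -/
theorem sum_countIn_erase (F : BoolFn n) (k : ℕ) :
    ∑ i, F.countIn (Finset.univ.erase i) k = ((n : ℤ) - k) * F.countIn Finset.univ k := by
  have h : ∀ i, F.countIn (Finset.univ.erase i) k =
      ∑ T ∈ (Finset.univ : Finset (Fin n)).powersetCard k,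
        if i ∉ T then (F.valueOn T : ℤ) else 0 := fun i => by
    rw [countIn, ← Finset.sum_filter]
    refine Finset.sum_congr ?_ fun _ _ => rfl
    ext T
    simp [Finset.mem_powersetCard, Finset.subset_erase, and_comm]
  simp only [h]
  rw [Finset.sum_comm, countIn, Finset.mul_sum]
  refine Finset.sum_congr rfl fun T hT => ?_
  have hk := (Finset.mem_powersetCard.1 hT).2
  rw [← Finset.sum_filter, Finset.sum_const, nsmul_eq_mul]
  congr 1
  have h2 : (Finset.univ.filter fun i => i ∉ T) = Tᶜ := by ext; simp
  rw [h2, Finset.card_compl, hk, Fintype.card_fin, Nat.cast_sub]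
  rw [← hk]
  simpa using T.card_le_univ

/-- Summation over i removes the dependence on individual variables and leaves a two-term recurrence
for the counts by size. -/
theorem sum_marginal (F : BoolFn n) (t : ℕ) :
    ∑ i, F.marginal i t = ((t : ℤ) + 1) * F.countIn Finset.univ (t + 1) -
      ((n : ℤ) - t) * F.countIn Finset.univ t := by
  simp only [marginal_eq, Finset.sum_sub_distrib, sum_countIn_erase, Finset.sum_const,
    Finset.card_univ, Fintype.card_fin, nsmul_eq_mul]
  push_cast
  ring

theorem modelCount_eq_sum (F : BoolFn n) :
    F.modelCount = ∑ k ∈ Finset.range (n + 1), F.modelCountOfSize k := by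
  simp only [modelCount, modelCountOfSize]
  rw [← Finset.powerset_univ, Finset.sum_powerset]
  simp

theorem modelCountOfSize_le (F : BoolFn n) (k : ℕ) : F.modelCountOfSize k ≤ 2 ^ n := by
  have h1 : F.modelCountOfSize k ≤ ∑ T ∈ (Finset.univ : Finset (Fin n)).powersetCard k, 1 :=
    Finset.sum_le_sum fun T _ => by rw [valueOn]; split_ifs <;> omega
  rw [Finset.sum_const, Finset.card_powersetCard, Finset.card_univ, Fintype.card_fin, smul_eq_mul,
    mul_one] at h1
  exact h1.trans (Nat.choose_le_two_pow n k)

theorem modelCount_le (F : BoolFn n) : F.modelCount ≤ 2 ^ n := by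
  have h1 : F.modelCount ≤ ∑ T : Finset (Fin n), 1 :=
    Finset.sum_le_sum fun T _ => by rw [valueOn]; split_ifs <;> omega
  simpa using h1

/-! ### OR-substitutions -/

variable {N : ℕ} {m : Fin n → ℕ} {e : (Σ i : Fin n, Fin (m i)) ≃ Fin N} {F : BoolFn n}
  {G : BoolFn N}

theorem IsORSubst.valueOn_eq (h : F.IsORSubst m e G) (S : Finset (Fin N)) :
    G.valueOn S = F.valueOn (S.image fun z => (e.symm z).1) := by
  rw [valueOn, valueOn, h]
  congr 3
  funext i
  simp only [decide_eq_true_eq, Finset.mem_image, decide_eq_decide]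
  constructor
  · rintro ⟨j, hj⟩
    exact ⟨_, hj, by simp⟩
  · rintro ⟨z, hz, rfl⟩
    exact ⟨(e.symm z).2, by simpa using hz⟩

/-- With at most one copy of each variable the projection is injective and preserves cardinality;
the variables without a copy are set to 0. -/
theorem IsORSubst.modelCountOfSize_eq (h : F.IsORSubst m e G) (hm : ∀ i, m i ≤ 1) (k : ℕ) :
    (G.modelCountOfSize k : ℤ) = F.countIn (Finset.univ.filter fun i => m i ≠ 0) k := by
  let φ : Fin N ↪ Fin n := ⟨fun z => (e.symm z).1, fun z z' hz => by
    apply e.symm.injective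
    refine Sigma.ext hz ?_
    have : ∀ (a b : Σ i : Fin n, Fin (m i)), a.1 = b.1 → HEq a.2 b.2 := by
      rintro ⟨i, a⟩ ⟨i', b⟩ (rfl : i = i')
      have := hm i
      rw [heq_eq_eq, Fin.ext_iff]
      dsimp only
      omega
    exact this _ _ hz⟩
  have hφ_apply : ∀ z, φ z = (e.symm z).1 := fun _ => rfl
  have hφ : (Finset.univ.filter fun i => m i ≠ 0) = Finset.univ.map φ := by
    ext i
    simp only [Finset.mem_filter_univ, Finset.mem_map, Finset.mem_univ, true_and]
    constructor
    · intro hi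
      exact ⟨e ⟨i, ⟨0, Nat.pos_of_ne_zero hi⟩⟩, by rw [hφ_apply, Equiv.symm_apply_apply]⟩
    · rintro ⟨z, rfl⟩
      exact ((e.symm z).2.pos).ne'
  rw [hφ, countIn, Finset.powersetCard_map, Finset.sum_map, modelCountOfSize, Nat.cast_sum]
  refine Finset.sum_congr rfl fun S _ => ?_
  rw [h.valueOn_eq, RelEmbedding.coe_toEmbedding, Finset.mapEmbedding_apply, Finset.map_eq_image]
  rfl

/-- If a set already contains another copy of X_i, adding the chosen copy does not change its
projection. The sets without such copies correspond to the subsets of [n] that avoid i, since all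
other variables have a single copy. -/
theorem IsORSubst.marginal_eq (h : F.IsORSubst m e G) (hm : ∀ i, 0 < m i) (i : Fin n)
    (hi : ∀ i', i' ≠ i → m i' = 1) (t : ℕ) :
    G.marginal (e ⟨i, ⟨0, hm i⟩⟩) t = F.marginal i t := by
  let ψ : Fin n ↪ Fin N := ⟨fun i => e ⟨i, ⟨0, hm i⟩⟩, fun i i' hii => by
    simpa using congrArg Sigma.fst (e.injective hii)⟩
  have hψ_apply : ∀ i, ψ i = e ⟨i, ⟨0, hm i⟩⟩ := fun _ => rfl
  set z := e ⟨i, ⟨0, hm i⟩⟩ with hz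
  have hψ : (Finset.univ.erase i).map ψ = Finset.univ.filter fun w => (e.symm w).1 ≠ i := by
    ext w
    obtain ⟨⟨i', j⟩, rfl⟩ := e.surjective w
    simp only [Finset.mem_map, Finset.mem_erase, Finset.mem_univ, and_true, Finset.mem_filter_univ,
      Equiv.symm_apply_apply]
    constructor
    · rintro ⟨a, ha, hae⟩
      have := congrArg Sigma.fst (e.injective hae)
      simp only at this
      exact this ▸ ha
    · intro hi'
      refine ⟨i', hi', ?_⟩
      have := hi i' hi'
      rw [hψ_apply]
      congr 2
      rw [Fin.ext_iff]
      dsimp only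
      omega
  have hsub : ((Finset.univ.erase i).map ψ).powersetCard t ⊆
      (Finset.univ.erase z).powersetCard t := by
    refine Finset.powersetCard_mono fun w hw => ?_
    rw [hψ, Finset.mem_filter_univ] at hw
    rw [Finset.mem_erase]
    refine ⟨fun h => hw ?_, Finset.mem_univ _⟩
    simp [h, hz]
  rw [marginal, ← Finset.sum_subset hsub, Finset.powersetCard_map, Finset.sum_map, marginal]
  · refine Finset.sum_congr rfl fun T _ => ?_
    have h1 : (T.map ψ).image (fun z => (e.symm z).1) = T := by
      rw [Finset.map_eq_image, Finset.image_image]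
      exact (Finset.image_congr fun j _ => by simp [hψ_apply]).trans Finset.image_id
    rw [h.valueOn_eq, h.valueOn_eq, Finset.image_insert, RelEmbedding.coe_toEmbedding,
      Finset.mapEmbedding_apply, h1]
    simp [hz]
  · intro S hS hS'
    have hiS : i ∈ S.image (fun z => (e.symm z).1) := by
      by_contra hcon
      refine hS' (Finset.mem_powersetCard.2 ⟨fun w hw => ?_, (Finset.mem_powersetCard.1 hS).2⟩)
      rw [hψ, Finset.mem_filter_univ]
      exact fun hwi => hcon (Finset.mem_image.2 ⟨w, hw, hwi⟩)
    rw [h.valueOn_eq, h.valueOn_eq, Finset.image_insert, sub_eq_zero]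
    congr 2
    rw [hz, Equiv.symm_apply_apply]
    exact Finset.insert_eq_of_mem hiS

/-- A set projects to T exactly when it has a nonempty set of copies over each i in T and none
elsewhere, which leaves 2^L - 1 choices for each element of T. -/
theorem IsORSubst.modelCount_eq {L : ℕ} {e : (Σ _ : Fin n, Fin L) ≃ Fin N}
    (h : F.IsORSubst (fun _ => L) e G) :
    G.modelCount = ∑ k ∈ Finset.range (n + 1), F.modelCountOfSize k * (2 ^ L - 1) ^ k := by
  have hcard : ∀ T : Finset (Fin n), (Finset.univ.filter fun S : Finset (Fin N) =>
      S.image (fun z => (e.symm z).1) = T).card = (2 ^ L - 1) ^ T.card := by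
    intro T
    have h1 : (Fintype.piFinset fun i : Fin n =>
        if i ∈ T then (Finset.univ : Finset (Finset (Fin L))).erase ∅ else {∅}).card =
        (2 ^ L - 1) ^ T.card := by
      rw [Fintype.card_piFinset]
      have : ∀ i : Fin n, (if i ∈ T then (Finset.univ : Finset (Finset (Fin L))).erase ∅
          else {∅}).card = if i ∈ T then 2 ^ L - 1 else 1 := fun i => by
        split_ifs <;> simp
      simp [this, Finset.prod_ite_mem]
    rw [← h1]
    refine Finset.card_nbij' (fun S i => Finset.univ.filter fun j => e ⟨i, j⟩ ∈ S)
      (fun g => Finset.univ.filter fun z => (e.symm z).2 ∈ g (e.symm z).1) ?_ ?_ ?_ ?_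
    · intro S hS
      rw [Finset.mem_coe, Finset.mem_filter_univ] at hS
      rw [Finset.mem_coe, Fintype.mem_piFinset]
      intro i
      have hi : i ∈ T ↔ ∃ j, e ⟨i, j⟩ ∈ S := by
        rw [← hS, Finset.mem_image]
        constructor
        · rintro ⟨z, hz, rfl⟩
          exact ⟨(e.symm z).2, by simpa using hz⟩
        · rintro ⟨j, hj⟩
          exact ⟨_, hj, by simp⟩
      split_ifs with hT
      · obtain ⟨j, hj⟩ := hi.1 hT
        rw [Finset.mem_erase, ← Finset.nonempty_iff_ne_empty]
        exact ⟨⟨j, by simpa using hj⟩, Finset.mem_univ _⟩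
      · rw [Finset.mem_singleton, Finset.filter_eq_empty_iff]
        exact fun j _ hj => hT (hi.2 ⟨j, hj⟩)
    · intro g hg
      rw [Finset.mem_coe, Fintype.mem_piFinset] at hg
      rw [Finset.mem_coe, Finset.mem_filter_univ]
      ext i
      have hgi := hg i
      rw [Finset.mem_image]
      constructor
      · rintro ⟨z, hz, rfl⟩
        by_contra hT
        rw [if_neg hT, Finset.mem_singleton] at hgi
        rw [Finset.mem_filter_univ, hgi] at hz
        simp at hz
      · intro hT
        rw [if_pos hT, Finset.mem_erase, ← Finset.nonempty_iff_ne_empty] at hgi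
        obtain ⟨j, hj⟩ := hgi.1
        exact ⟨e ⟨i, j⟩, by simpa using hj, by simp⟩
    · intro S _
      ext z
      simp
    · intro g _
      funext i
      ext j
      simp
  have h2 : G.modelCount = ∑ T : Finset (Fin n), F.valueOn T * (2 ^ L - 1) ^ T.card := by
    rw [modelCount, ← Finset.sum_fiberwise_of_maps_to (s := Finset.univ) (t := Finset.univ)
      (g := fun S : Finset (Fin N) => S.image (fun z => (e.symm z).1))
      (fun _ _ => Finset.mem_univ _)]
    refine Finset.sum_congr rfl fun T _ => ?_
    rw [← hcard T, mul_comm, ← smul_eq_mul, ← Finset.sum_const]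
    refine Finset.sum_congr rfl fun S hS => ?_
    rw [h.valueOn_eq, (Finset.mem_filter.1 hS).2]
  rw [h2, ← Finset.powerset_univ, Finset.sum_powerset, Finset.card_univ, Fintype.card_fin]
  refine Finset.sum_congr rfl fun k _ => ?_
  rw [modelCountOfSize, Finset.sum_mul]
  refine Finset.sum_congr rfl fun T hT => ?_
  rw [(Finset.mem_powersetCard.1 hT).2]

end BoolFn

/-! ## Recovering model counts -/

/-- The c k are base-b digits; the induction strips off the lowest one. -/
theorem sum_mul_pow_div_pow_mod {b : ℕ} (K : ℕ) (c : ℕ → ℕ) (hc : ∀ k, c k < b) {k : ℕ}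
    (hk : k < K) : (∑ j ∈ Finset.range K, c j * b ^ j) / b ^ k % b = c k := by
  induction K generalizing c k with
  | zero => omega
  | succ K ih =>
    have h : ∑ j ∈ Finset.range (K + 1), c j * b ^ j =
        c 0 + b * ∑ j ∈ Finset.range K, c (j + 1) * b ^ j := by
      rw [Finset.sum_range_succ', Finset.mul_sum, add_comm]
      congr 1
      · simp
      · exact Finset.sum_congr rfl fun j _ => by ring
    have hb : 0 < b := (Nat.zero_le _).trans_lt (hc 0)
    rw [h]
    cases k with
    | zero => simp [Nat.mod_eq_of_lt (hc 0)]
    | succ k =>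
      rw [pow_succ', ← Nat.div_div_eq_div_mul, Nat.add_mul_div_left _ _ hb,
        Nat.div_eq_of_lt (hc 0), zero_add]
      exact ih (fun j => c (j + 1)) (fun j => hc _) (by omega)

/-! ### Inversion of the binomial system by power series -/

open PowerSeries in
theorem PowerSeries.coeff_one_sub_X_pow (n k : ℕ) :
    coeff k ((1 - X : ℤ⟦X⟧) ^ n) = (-1) ^ k * (n.choose k : ℤ) := by
  induction n generalizing k with
  | zero => cases k <;> simp [coeff_one]
  | succ n ih =>
    rw [pow_succ, mul_sub, mul_one, map_sub]
    cases k with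
    | zero => simp [ih]
    | succ k =>
      rw [coeff_succ_mul_X, ih, ih, Nat.choose_succ_succ]
      push_cast
      ring

-- Compare the coefficients of X^j in (1-X)^{-(d+1)} · (1-X)^{t+d+1} = (1-X)^t.
open PowerSeries in
theorem sum_neg_one_pow_mul_choose_mul_choose (t d j : ℕ) :
    ∑ x ∈ Finset.range (j + 1), (-1 : ℤ) ^ (j - x) * ((t + (d + 1)).choose (j - x) : ℤ) *
      ((x + d).choose x : ℤ) = (-1) ^ j * (t.choose j : ℤ) := by
  have h : (mk fun x => ((d + x).choose d : ℤ)) * (1 - X : ℤ⟦X⟧) ^ (t + (d + 1)) = (1 - X) ^ t := by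
    rw [pow_add, mul_left_comm]
    have := mk_add_choose_mul_one_sub_pow_eq_one ℤ d
    rw [this, mul_one]
  have h2 := congrArg (coeff j) h
  rw [coeff_mul, coeff_one_sub_X_pow, Finset.Nat.sum_antidiagonal_eq_sum_range_succ_mk] at h2
  rw [← h2]
  refine Finset.sum_congr rfl fun x _ => ?_
  rw [coeff_mk, coeff_one_sub_X_pow, Nat.choose_symm_add, add_comm d x]
  ring

/-- The `n`-fold backward difference of a sequence (extended by zero). -/
def backwardDiff (n : ℕ) (R : ℕ → ℤ) (j : ℕ) : ℤ :=
  ∑ x ∈ Finset.range (j + 1), (-1) ^ (j - x) * (n.choose (j - x) : ℤ) * R x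

/-- The n-fold difference is multiplication by (1-X)^n. With d = n-1-t it turns the term
(1-X)^{-(n-t)} of index t into (1-X)^t; only the values of R up to j enter. -/
theorem backwardDiff_eq {n : ℕ} {g R : ℕ → ℤ} {j : ℕ} (hR : ∀ x ≤ j,
    R x = ∑ t ∈ Finset.range n, g t * ((x + (n - 1 - t)).choose x : ℤ)) :
    backwardDiff n R j = ∑ t ∈ Finset.range n, g t * ((-1) ^ j * (t.choose j : ℤ)) := by
  have h : ∀ x ∈ Finset.range (j + 1), (-1) ^ (j - x) * (n.choose (j - x) : ℤ) * R x =
      ∑ t ∈ Finset.range n, g t * ((-1) ^ (j - x) * (n.choose (j - x) : ℤ) *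
        ((x + (n - 1 - t)).choose x : ℤ)) := fun x hx => by
    rw [hR x (by simpa [Nat.lt_succ_iff] using hx), Finset.mul_sum]
    exact Finset.sum_congr rfl fun t _ => by ring
  rw [backwardDiff, Finset.sum_congr rfl h, Finset.sum_comm]
  refine Finset.sum_congr rfl fun t ht => ?_
  rw [← Finset.mul_sum, ← sum_neg_one_pow_mul_choose_mul_choose t (n - 1 - t) j,
    show t + (n - 1 - t + 1) = n by have := Finset.mem_range.1 ht; omega]

/-- Orthogonality of binomial coefficients: C(s,j)C(j,t) = C(s,t)C(s-t,j-t), and an alternating row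
sum vanishes unless the row is row 0. -/
theorem sum_neg_one_pow_mul_choose_mul_choose_eq_ite {n s : ℕ} (hs : s < n) (t : ℕ) :
    ∑ j ∈ Finset.range n, (-1 : ℤ) ^ j * ((s.choose j : ℤ) * (j.choose t : ℤ)) =
      if s = t then (-1) ^ t else 0 := by
  have h0 : ∑ j ∈ Finset.range n, (-1 : ℤ) ^ j * ((s.choose j : ℤ) * (j.choose t : ℤ)) =
      ∑ j ∈ Finset.Ico t (s + 1), (-1 : ℤ) ^ j * ((s.choose j : ℤ) * (j.choose t : ℤ)) := by
    symm
    refine Finset.sum_subset (fun j hj => ?_) fun j _ hj => ?_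
    · simp only [Finset.mem_Ico, Finset.mem_range] at *
      omega
    · simp only [Finset.mem_Ico, not_and, not_lt] at hj
      by_cases h : t ≤ j
      · rw [Nat.choose_eq_zero_of_lt (hj h)]; simp
      · rw [Nat.choose_eq_zero_of_lt (not_le.1 h)]; simp
  rw [h0]
  rcases lt_or_ge s t with hst | hst
  · rw [if_neg hst.ne, Finset.Ico_eq_empty (by omega), Finset.sum_empty]
  rw [Finset.sum_Ico_eq_sum_range, show s + 1 - t = s - t + 1 by omega]
  have h1 : ∀ k ∈ Finset.range (s - t + 1),
      (-1 : ℤ) ^ (t + k) * ((s.choose (t + k) : ℤ) * ((t + k).choose t : ℤ)) =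
      (-1) ^ t * (s.choose t : ℤ) * ((-1) ^ k * ((s - t).choose k : ℤ)) := fun k _ => by
    have h2 := Nat.choose_mul (n := s) (k := t + k) (s := t) (by omega)
    rw [show t + k - t = k by omega] at h2
    rw [← Nat.cast_mul, h2]
    push_cast
    ring
  rw [Finset.sum_congr rfl h1, ← Finset.mul_sum, Int.alternating_sum_range_choose]
  by_cases h : s = t
  · subst h; simp
  · rw [if_neg h, if_neg (by omega), mul_zero]

/-- Differencing makes the system triangular, with entries (-1)^j C(t,j), and orthogonality inverts
it. The formula is explicit, so no linear system has to be solved by the machine. -/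
theorem eq_sum_backwardDiff {n : ℕ} {g R : ℕ → ℤ} (hR : ∀ x < n,
    R x = ∑ t ∈ Finset.range n, g t * ((x + (n - 1 - t)).choose x : ℤ)) {t : ℕ} (ht : t < n) :
    g t = (-1) ^ t * ∑ j ∈ Finset.range n, (j.choose t : ℤ) * backwardDiff n R j := by
  have h : ∀ j ∈ Finset.range n, (j.choose t : ℤ) * backwardDiff n R j =
      ∑ s ∈ Finset.range n, g s * ((-1) ^ j * ((s.choose j : ℤ) * (j.choose t : ℤ))) :=
    fun j hj => by
      rw [backwardDiff_eq fun x hx => hR x (hx.trans_lt (Finset.mem_range.1 hj)), Finset.mul_sum]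
      exact Finset.sum_congr rfl fun s _ => by ring
  rw [Finset.sum_congr rfl h, Finset.sum_comm]
  have h2 : ∀ s ∈ Finset.range n, ∑ j ∈ Finset.range n,
      g s * ((-1) ^ j * ((s.choose j : ℤ) * (j.choose t : ℤ))) =
      if s = t then (-1) ^ t * g s else 0 := fun s hs => by
    rw [← Finset.mul_sum, sum_neg_one_pow_mul_choose_mul_choose_eq_ite (Finset.mem_range.1 hs)]
    split_ifs <;> ring
  rw [Finset.sum_congr rfl h2, Finset.sum_ite_eq' _ _ _, if_pos (Finset.mem_range.2 ht),
    ← mul_assoc, ← pow_add, Even.neg_one_pow ⟨t, rfl⟩, one_mul]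

/-! ### Counts from marginal contributions, and the size of Shapley values -/

namespace BoolFn

open Nat

variable {n : ℕ}

/-- `t! (n - 1 - t)!` times the sum of all marginal contributions to `t`-element sets. -/
def scaledMarginal (F : BoolFn n) (t : ℕ) : ℤ :=
  (t ! : ℤ) * ((n - 1 - t)! : ℤ) * ∑ i, F.marginal i t

/-- The normalised counts #_kF/C(n,k) telescope: by `sum_marginal`, the increment from k to k+1 is
the scaled marginal at k divided by n!. The start is #_0F = F[∅]. -/
theorem factorial_mul_countIn (F : BoolFn n) {k : ℕ} (hk : k ≤ n) :
    (n ! : ℤ) * F.countIn Finset.univ k = (n.choose k : ℤ) *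
      ((n ! : ℤ) * F.valueOn ∅ + ∑ t ∈ Finset.range k, F.scaledMarginal t) := by
  induction k with
  | zero => simp [countIn]
  | succ k ih =>
    have ih := ih (by omega)
    have h1 : ((k : ℤ) + 1) * (n.choose (k + 1) : ℤ) = ((n : ℤ) - k) * n.choose k := by
      have := Nat.choose_succ_right_eq n k
      rw [← Nat.cast_sub (by omega : k ≤ n)]
      exact_mod_cast (by linarith)
    have h2 : (n ! : ℤ) = (n.choose k : ℤ) * (((n : ℤ) - k) * ((n - 1 - k)! : ℤ) * (k ! : ℤ)) := by
      rw [← Nat.choose_mul_factorial_mul_factorial (by omega : k ≤ n)]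
      have h3 : (n - k)! = (n - k) * (n - 1 - k)! := by
        rw [← Nat.mul_factorial_pred (by omega : n - k ≠ 0), show n - k - 1 = n - 1 - k by omega]
      rw [h3]
      push_cast [Nat.cast_sub (by omega : k ≤ n)]
      ring
    have h4 := F.sum_marginal k
    have hpos : ((k : ℤ) + 1) ≠ 0 := by positivity
    -- The recurrence gives (k+1)·#_{k+1}F, so the claim is proved after multiplication by k+1.
    apply mul_left_cancel₀ hpos
    rw [Finset.sum_range_succ, scaledMarginal]
    set c := F.countIn Finset.univ (k + 1)
    set c' := F.countIn Finset.univ k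
    set D := ∑ i, F.marginal i k
    set S := ∑ t ∈ Finset.range k, F.scaledMarginal t
    have h5 : ((k : ℤ) + 1) * c = D + ((n : ℤ) - k) * c' := by rw [h4]; ring
    calc ((k : ℤ) + 1) * ((n ! : ℤ) * c) = (n ! : ℤ) * D + ((n : ℤ) - k) * ((n ! : ℤ) * c') := by
          linear_combination (n ! : ℤ) * h5
      _ = _ := by
          rw [ih]
          linear_combination D * h2 -
            ((n ! : ℤ) * F.valueOn ∅ + (S + (k ! : ℤ) * ((n - 1 - k)! : ℤ) * D)) * h1

/-- Summation over k: the scaled marginal at t enters every count with k > t, and the constant F[∅]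
receives the full binomial sum 2^n. -/
theorem factorial_mul_modelCount (F : BoolFn n) :
    (n ! : ℤ) * F.modelCount = (n ! : ℤ) * (2 ^ n * F.valueOn ∅) + ∑ t ∈ Finset.range n,
      (∑ k ∈ Finset.range (n + 1), if t < k then (n.choose k : ℤ) else 0) * F.scaledMarginal t := by
  have h : ∀ k ∈ Finset.range (n + 1), (n ! : ℤ) * (F.modelCountOfSize k : ℤ) =
      (n.choose k : ℤ) * ((n ! : ℤ) * F.valueOn ∅) +
      ∑ t ∈ Finset.range n, (if t < k then (n.choose k : ℤ) else 0) * F.scaledMarginal t :=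
    fun k hk => by
      have hkn : k ≤ n := by simpa [Nat.lt_succ_iff] using hk
      rw [← countIn_univ, F.factorial_mul_countIn hkn, mul_add, Finset.mul_sum]
      congr 1
      simp only [ite_mul, zero_mul]
      rw [← Finset.sum_filter]
      refine Finset.sum_congr ?_ fun _ _ => rfl
      ext t
      simp only [Finset.mem_range, Finset.mem_filter]
      omega
  rw [modelCount_eq_sum, Nat.cast_sum, Finset.mul_sum, Finset.sum_congr rfl h,
    Finset.sum_add_distrib, ← Finset.sum_mul, Finset.sum_comm]
  have h2 : ∑ k ∈ Finset.range (n + 1), (n.choose k : ℤ) = 2 ^ n := by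
    exact_mod_cast Nat.sum_range_choose n
  rw [h2]
  simp only [Finset.sum_mul]
  ring

theorem abs_shapley_le_one (F : BoolFn n) (i : Fin n) : |F.shapley i| ≤ 1 := by
  have hn : (0 : ℚ) < (n ! : ℚ) := by exact_mod_cast n.factorial_pos
  rw [shapley, abs_mul, abs_of_pos (by positivity)]
  have h : |∑ p : Equiv.Perm (Fin n),
      ((F.valueOn (before p i ∪ {i}) : ℚ) - (F.valueOn (before p i) : ℚ))| ≤
      ∑ _p : Equiv.Perm (Fin n), (1 : ℚ) := by
    refine (Finset.abs_sum_le_sum_abs _ _).trans (Finset.sum_le_sum fun p _ => ?_)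
    simp only [valueOn]
    split_ifs <;> simp
  rw [Finset.sum_const, Finset.card_univ, Fintype.card_perm, Fintype.card_fin, nsmul_eq_mul,
    mul_one] at h
  rw [one_div, inv_mul_le_iff₀ hn]
  simpa using h

theorem exists_factorial_mul_shapley (F : BoolFn n) (i : Fin n) :
    ∃ z : ℤ, (n ! : ℚ) * F.shapley i = z :=
  ⟨_, F.factorial_mul_shapley i⟩

theorem den_shapley_dvd (F : BoolFn n) (i : Fin n) : (F.shapley i).den ∣ n ! := by
  obtain ⟨z, hz⟩ := F.exists_factorial_mul_shapley i
  have hn : (n ! : ℚ) ≠ 0 := by exact_mod_cast n.factorial_ne_zero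
  have h : F.shapley i = Rat.divInt z (n !) := by
    rw [Rat.divInt_eq_div, ← hz]
    push_cast
    field_simp
  have := Rat.den_dvd z (n !)
  rw [← h] at this
  exact_mod_cast this

theorem natAbs_num_shapley_le (F : BoolFn n) (i : Fin n) :
    (F.shapley i).num.natAbs ≤ (F.shapley i).den := by
  have h := F.abs_shapley_le_one i
  rw [Rat.abs_def, Rat.divInt_eq_div, div_le_one (by exact_mod_cast (F.shapley i).pos)] at h
  exact_mod_cast h

/-- The denominator divides N!, so exact integer division recovers N!·Shap from the reduced
fraction. The equation n = N spares transports when the arity is known only up to a proof. -/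
theorem num_mul_factorial_div_den (F : BoolFn n) (i : Fin n) {N : ℕ} (hN : n = N) :
    (F.shapley i).num * ((N ! : ℤ) / ((F.shapley i).den : ℤ)) =
      ∑ t ∈ Finset.range N, (t ! : ℤ) * ((N - 1 - t)! : ℤ) * F.marginal i t := by
  subst hN
  obtain ⟨c, hc⟩ := F.den_shapley_dvd i
  have hd : (F.shapley i).den ≠ 0 := (F.shapley i).den_nz
  have h := F.factorial_mul_shapley i
  rw [hc] at h ⊢
  push_cast at h ⊢
  rw [Int.mul_ediv_cancel_left _ (by exact_mod_cast hd)]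
  have h2 : ((F.shapley i).den : ℚ) * F.shapley i = (F.shapley i).num := Rat.den_mul_eq_num _
  have h3 : (((F.shapley i).num * (c : ℤ) : ℤ) : ℚ) =
      ((∑ t ∈ Finset.range n, (t ! : ℤ) * ((n - 1 - t)! : ℤ) * F.marginal i t : ℤ) : ℚ) := by
    push_cast
    rw [← h, ← h2]
    ring
  exact_mod_cast h3

/-- The relation between the Shapley values of the functions in which the variable `i` is replaced
by `x + 1` copies, and the marginal contributions. -/
theorem sum_marginal_eq (F : BoolFn n) (x : ℕ) :
    ∑ i, ∑ t ∈ Finset.range (n + x), (t ! : ℤ) * ((n + x - 1 - t)! : ℤ) * F.marginal i t =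
      (x ! : ℤ) * ∑ t ∈ Finset.range n,
        F.scaledMarginal t * ((x + (n - 1 - t)).choose x : ℤ) := by
  rw [Finset.sum_comm, Finset.mul_sum]
  have hsub : Finset.range n ⊆ Finset.range (n + x) := Finset.range_mono (by omega)
  -- The indices t ≥ n contribute nothing: no t-element subset of [n] avoids i.
  rw [← Finset.sum_subset hsub]
  · refine Finset.sum_congr rfl fun t ht => ?_
    have ht := Finset.mem_range.1 ht
    have h1 : ((x + (n - 1 - t)).choose x : ℤ) * (x ! : ℤ) * ((n - 1 - t)! : ℤ) =
        ((n + x - 1 - t)! : ℤ) := by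
      rw [show n + x - 1 - t = x + (n - 1 - t) by omega]
      rw [Nat.choose_symm_add]
      exact_mod_cast Nat.add_choose_mul_factorial_mul_factorial x (n - 1 - t)
    rw [← Finset.mul_sum, ← h1, scaledMarginal]
    ring
  · intro t _ ht
    rw [Finset.mem_range, not_lt] at ht
    refine Finset.sum_eq_zero fun i _ => ?_
    have : F.marginal i t = 0 := by
      rw [marginal, Finset.powersetCard_eq_empty.2, Finset.sum_empty]
      rw [Finset.card_erase_of_mem (Finset.mem_univ i), Finset.card_univ, Fintype.card_fin]
      have := i.pos
      omega
    rw [this, mul_zero]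

end BoolFn

/-! ## The reductions -/

theorem List.ofFn_eq_map_range {α : Type} {n : ℕ} (f : ℕ → α) :
    List.ofFn (fun i : Fin n => f i) = (List.range n).map f :=
  List.ext_getElem (by simp) (by simp)

theorem size_unary (n : ℕ) : (Data.unary n).size = 2 * n + 1 := by
  induction n with
  | zero => simp [Data.unary, Data.ofList, Data.size]
  | succ n ih =>
    simp only [Data.unary, List.replicate_succ, Data.ofList, Data.size] at *
    simp
    omega

theorem Data.size_int_natCast_le {m k : ℕ} (h : m < 2 ^ k) : (Data.int m).size ≤ 1 + k := by
  simp only [Data.size, Int.natAbs_natCast]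
  have := Nat.size_le.2 h
  omega

/-! ### Lengths of correct oracle answers -/

namespace FnClass

theorem arity_le_size_input (C : FnClass) (F : C.Rep) : C.arity F ≤ (C.input F).size := by
  simp only [input, Data.size, size_unary]
  omega

theorem size_count_answer_le (C : FnClass) (F : C.Rep) :
    (C.count.answer F).size ≤ 2 + C.arity F := by
  have h : (C.fn F).modelCount < 2 ^ (C.arity F + 1) :=
    (C.fn F).modelCount_le.trans_lt (by rw [pow_succ]; have := Nat.one_le_two_pow (n := C.arity F); omega)
  have := Data.size_int_natCast_le h
  simp only [count]
  omega

theorem countBySize_answer (C : FnClass) (F : C.Rep) : C.countBySize.answer F =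
    enc ((List.range (C.arity F + 1)).map fun k => ((C.fn F).modelCountOfSize k : ℤ)) := by
  rw [← List.ofFn_eq_map_range, enc_list, List.map_ofFn]
  rfl

theorem size_countBySize_answer_le (C : FnClass) (F : C.Rep) :
    (C.countBySize.answer F).size ≤ 1 + (C.arity F + 1) * (2 + C.arity F + 1) := by
  rw [countBySize_answer]
  refine (size_enc_list_le (B := 2 + C.arity F) fun x hx => ?_).trans (by simp)
  obtain ⟨k, -, rfl⟩ := List.mem_map.1 hx
  have h : (C.fn F).modelCountOfSize k < 2 ^ (C.arity F + 1) :=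
    ((C.fn F).modelCountOfSize_le k).trans_lt
      (by rw [pow_succ]; have := Nat.one_le_two_pow (n := C.arity F); omega)
  have := Data.size_int_natCast_le h
  rw [enc_int]
  omega

theorem shap_answer (C : FnClass) (F : C.Rep) : C.shap.answer F =
    enc (List.ofFn fun i : Fin (C.arity F) => Data.ofRat ((C.fn F).shapley i)) := by
  rw [enc_list, List.map_ofFn]
  rfl

theorem factorial_lt_two_pow (N : ℕ) : N.factorial < 2 ^ (N * N + 1) := by
  have h1 : N.factorial ≤ N ^ N := Nat.factorial_le_pow N
  have h2 : N ^ N ≤ (2 ^ N) ^ N := Nat.pow_le_pow_left Nat.lt_two_pow_self.le N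
  rw [← pow_mul] at h2
  rw [pow_succ]
  have := Nat.one_le_two_pow (n := N * N)
  omega

/-- Denominators divide n! < 2^(n²+1), and numerators are no larger in absolute value, because
Shapley values lie in [-1, 1]. -/
theorem size_shap_answer_le (C : FnClass) (F : C.Rep) : (C.shap.answer F).size ≤
    1 + C.arity F * (5 + 2 * (C.arity F * C.arity F) + 1) := by
  rw [shap_answer]
  refine (size_enc_list_le (B := 5 + 2 * (C.arity F * C.arity F)) fun x hx => ?_).trans (by simp)
  obtain ⟨i, rfl⟩ := (List.mem_ofFn' _ _).1 hx
  have h1 : ((C.fn F).shapley i).den < 2 ^ (C.arity F * C.arity F + 1) :=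
    (Nat.le_of_dvd (Nat.factorial_pos _) ((C.fn F).den_shapley_dvd i)).trans_lt
      (factorial_lt_two_pow _)
  have h2 := ((C.fn F).natAbs_num_shapley_le i).trans_lt h1
  have h3 := Nat.size_le.2 h1
  have h4 := Nat.size_le.2 h2
  simp only [enc_data, Data.ofRat, Data.size, Int.natAbs_natCast]
  omega

end FnClass

namespace Ctx

variable {Γ : Ctx} {C C' : FnClass} {F : Γ.Index → C.Rep}

theorem Computes.arity (hF : Γ.Computes fun i => C.input (F i)) :
    Γ.Small fun i => C.arity (F i) := by
  have h : Γ.Computes fun i => List.replicate (C.arity (F i)) () :=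
    hF.dataFst.recode fun i => by rw [enc_replicate_unit]; rfl
  have h2 := h.length
  simpa using h2

theorem Computes.bdd_arity (hF : Γ.Computes fun i => C.input (F i)) :
    Γ.Bdd fun i => C.arity (F i) :=
  hF.bdd_size.mono fun i => C.arity_le_size_input (F i)

theorem Computes.queryCount (hF : Γ.Computes fun i => C.input (F i))
    (hO : ∀ i, C.count.IsOracle (Γ.oracle i)) :
    Γ.Computes fun i => ((C.fn (F i)).modelCount : ℤ) :=
  hF.query (fun i => hO i (F i)) (((Bdd.const Γ 2).add hF.bdd_arity).mono fun i =>
    C.size_count_answer_le (F i))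

theorem Computes.queryCountBySize (hF : Γ.Computes fun i => C.input (F i))
    (hO : ∀ i, C.countBySize.IsOracle (Γ.oracle i)) {k : Γ.Index → ℕ} (hk : Γ.Small k) :
    Γ.Computes fun i => ((C.fn (F i)).modelCountOfSize (k i) : ℤ) := by
  have h : Γ.Computes fun i => (List.range (C.arity (F i) + 1)).map fun k =>
      ((C.fn (F i)).modelCountOfSize k : ℤ) :=
    hF.query (fun i => (hO i (F i)).trans (C.countBySize_answer (F i)))
      (((Bdd.const Γ 1).add ((hF.bdd_arity.add (Bdd.const Γ 1)).mul
        (((Bdd.const Γ 2).add hF.bdd_arity).add (Bdd.const Γ 1)))).mono fun i => by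
          rw [← C.countBySize_answer]
          exact C.size_countBySize_answer_le (F i))
  refine (h.getD hk).congr fun i => ?_
  by_cases hki : k i < C.arity (F i) + 1
  · rw [List.getD_eq_getElem _ _ (by simpa using hki)]
    simp
  -- Beyond the arity the default 0 is the true count.
  · rw [List.getD_eq_default _ _ (by simpa using hki), BoolFn.modelCountOfSize,
      Finset.powersetCard_eq_empty.2 (by simpa using hki)]
    simp

theorem Computes.queryShap (hF : Γ.Computes fun i => C.input (F i))
    (hO : ∀ i, C.shap.IsOracle (Γ.oracle i)) {k : (i : Γ.Index) → Fin (C.arity (F i))}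
    (hk : Γ.Computes fun i => (k i : ℕ)) :
    Γ.Computes fun i => Data.ofRat ((C.fn (F i)).shapley (k i)) := by
  have h : Γ.Computes fun i => List.ofFn fun j : Fin (C.arity (F i)) =>
      Data.ofRat ((C.fn (F i)).shapley j) :=
    hF.query (fun i => (hO i (F i)).trans (C.shap_answer (F i)))
      (((Bdd.const Γ 1).add (hF.bdd_arity.mul
        (((Bdd.const Γ 5).add ((Bdd.const Γ 2).mul (hF.bdd_arity.mul hF.bdd_arity))).add
          (Bdd.const Γ 1)))).mono fun i => by
          rw [← C.shap_answer]
          exact C.size_shap_answer_le (F i))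
  refine (h.getData ⟨hk, hF.bdd_arity.mono fun i => (k i).2.le⟩).congr fun i => ?_
  rw [List.getD_eq_getElem _ _ (by simp)]
  simp

/-- The computation of OR-substitutions, with the sizes of the disjunctions given by a function on
the natural numbers. -/
theorem Computes.orSubst (h : C.ComputesORSubst C') (hF : Γ.Computes fun i => C.input (F i))
    {m : Γ.Index → ℕ → ℕ}
    (hm : (Γ.ext fun i k => k < C.arity (F i)).Small fun q => m q.1.1 q.1.2) :
    ∃ G : Γ.Index → C'.Rep, (Γ.Computes fun i => C'.input (G i)) ∧ ∀ i,
      ∃ h : ∑ k : Fin (C.arity (F i)), m i k = C'.arity (G i),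
        (C.fn (F i)).IsORSubst (fun k => m i k) (finSigmaFinEquiv.trans (finCongr h))
          (C'.fn (G i)) := by
  obtain ⟨σ, hσ, hFP⟩ := h
  refine ⟨fun i => σ (F i) fun k => m i k, ?_, fun i => hσ _ _⟩
  have hms : Γ.Computes fun i => (List.range (C.arity (F i))).map fun k => Data.unary (m i k) :=
    hF.arity.map_range hm.unary
  refine Computes.callFP hFP (q := fun i => ⟨F i, fun k => m i k⟩)
    ((hF.dataPair hms.data).congr fun i => ?_)
  dsimp only
  rw [← List.ofFn_eq_map_range, enc_list, List.map_ofFn]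
  rfl

end Ctx

/-- Applied to the family of all pairs of an oracle for B and an instance of A, computability yields
one program and one polynomial for all of them. -/
theorem PolyTimeReducible.of_computes {A B : Problem} (h : ∀ (Γ : Ctx) (q : Γ.Index → A.Instance),
    (∀ i, B.IsOracle (Γ.oracle i)) → (Γ.Computes fun i => A.input (q i)) →
      Γ.Computes fun i => A.answer (q i)) : PolyTimeReducible A B := by
  let Γ : Ctx := ⟨{O : Data → Data // B.IsOracle O} × A.Instance, fun q => q.1.1,
    fun q => A.input q.2⟩
  obtain ⟨c, k, T, ⟨p, hp⟩, hc⟩ := h Γ (fun q => q.2) (fun q => q.1.2) (Ctx.Computes.input Γ)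
  refine ⟨c, p, fun O hO i => ?_⟩
  exact ((hc (⟨O, hO⟩, i)).mono le_rfl (hp _)).outputsWithin

namespace Ctx

variable {Γ : Ctx} {C C' : FnClass} {F : Γ.Index → C.Rep}

theorem Computes.countIn_ne (h : C.ComputesORSubst C') (hF : Γ.Computes fun i => C.input (F i))
    (hO : ∀ i, C'.countBySize.IsOracle (Γ.oracle i)) {k t : Γ.Index → ℕ} (hk : Γ.Small k)
    (ht : Γ.Small t) : Γ.Computes fun i => (C.fn (F i)).countIn
      (Finset.univ.filter fun j : Fin (C.arity (F i)) => (j : ℕ) ≠ k i) (t i) := by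
  have hv := hF.arity.newVar
  -- The two comparisons test j = k. The variable k gets no copy, all others get one; if k is the
  -- arity, nothing is deleted.
  obtain ⟨G, hG, hGF⟩ := Computes.orSubst h hF (m := fun i j => if j ≤ k i then
      if k i ≤ j then 0 else 1 else 1)
    (Small.ite (hv.1.natLe hk.lift.1) (Small.ite (hk.lift.1.natLe hv.1) (Small.const _ 0)
      (Small.const _ 1)) (Small.const _ 1))
  refine (hG.queryCountBySize hO ht).congr fun i => ?_
  obtain ⟨hN, hs⟩ := hGF i
  rw [hs.modelCountOfSize_eq fun j => by split_ifs <;> omega]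
  congr 1
  ext j
  simp only [Finset.mem_filter_univ]
  split_ifs <;> simp <;> omega

theorem Computes.shapley (h : C.ComputesORSubst C') (hF : Γ.Computes fun i => C.input (F i))
    (hO : ∀ i, C'.countBySize.IsOracle (Γ.oracle i)) {k : (i : Γ.Index) → Fin (C.arity (F i))}
    (hk : Γ.Computes fun i => (k i : ℕ)) :
    Γ.Computes fun i => Data.ofRat ((C.fn (F i)).shapley (k i)) := by
  have hn := hF.arity
  have hk' : Γ.Small fun i => (k i : ℕ) := ⟨hk, hn.2.mono fun i => (k i).2.le⟩
  have hv := hn.newVar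
  -- Excluding the out-of-range index `C.arity (F i)` gives the full counts. They too are asked
  -- about a function in `C'`, as the oracle requires.
  have h1 := fun t ht => Computes.countIn_ne (Γ := Γ.ext fun i t => t < C.arity (F i)) h hF.lift
    (fun q => hO q.1.1) hn.lift (t := t) ht
  have h2 := fun t ht => Computes.countIn_ne (Γ := Γ.ext fun i t => t < C.arity (F i)) h hF.lift
    (fun q => hO q.1.1) hk'.lift (t := t) ht
  have hv1 := hv.add (Small.const _ 1)
  have hsum := hn.sum (f := fun i t => (t.factorial : ℤ) * ((C.arity (F i) - 1 - t).factorial : ℤ) *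
    ((C.fn (F i)).countIn (Finset.univ.filter fun j : Fin (C.arity (F i)) =>
        (j : ℕ) ≠ C.arity (F i)) (t + 1) -
      (C.fn (F i)).countIn (Finset.univ.filter fun j : Fin (C.arity (F i)) => (j : ℕ) ≠ k i) (t + 1) -
      (C.fn (F i)).countIn (Finset.univ.filter fun j : Fin (C.arity (F i)) => (j : ℕ) ≠ k i) t))
    ((hv.factorial.mul ((hn.lift.sub (Small.const _ 1)).sub hv).factorial).mul
      (((h1 _ hv1).sub (h2 _ hv1)).sub (h2 _ hv)))
  refine (hsum.ofRat (Computes.ofCast hn.factorial) fun i => Nat.factorial_ne_zero _).congr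
    fun i => ?_
  congr 1
  have hfac : ((C.arity (F i)).factorial : ℚ) ≠ 0 := by
    exact_mod_cast Nat.factorial_ne_zero _
  rw [div_eq_iff hfac, mul_comm, (C.fn (F i)).factorial_mul_shapley]
  congr 1
  refine Finset.sum_congr rfl fun t _ => ?_
  rw [BoolFn.marginal_eq]
  have e1 : (Finset.univ.filter fun j : Fin (C.arity (F i)) => (j : ℕ) ≠ C.arity (F i)) =
      Finset.univ := by
    ext j; simp [j.2.ne]
  have e2 : (Finset.univ.filter fun j : Fin (C.arity (F i)) => (j : ℕ) ≠ k i) =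
      Finset.univ.erase (k i) := by
    ext j; simp [Fin.ext_iff]
  rw [e1, e2]

end Ctx

theorem shap_reducible_countBySize {C C' : FnClass} (h : C.ComputesORSubst C') :
    PolyTimeReducible C.shap C'.countBySize := by
  refine PolyTimeReducible.of_computes fun Γ (F : Γ.Index → C.Rep) hO
    (hF : Γ.Computes fun i => C.input (F i)) => ?_
  have hsh := Ctx.Computes.shapley (Γ := Γ.ext fun i k => k < C.arity (F i)) h hF.lift
    (fun q => hO q.1.1) (k := fun q => ⟨q.1.2, q.2⟩) hF.arity.newVar.1
  have := hF.arity.map_range (f := fun i k => if hk : k < C.arity (F i) then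
    Data.ofRat ((C.fn (F i)).shapley ⟨k, hk⟩) else .int 0) (hsh.congr fun q => by
      rw [dif_pos (show q.1.2 < C.arity (F q.1.1) from q.2)])
  refine this.recode fun i => ?_
  rw [enc_data, C.shap_answer, ← List.ofFn_eq_map_range]
  simp

theorem countBySize_reducible_count {C C' : FnClass} (h : C.ComputesORSubst C') :
    PolyTimeReducible C.countBySize C'.count := by
  refine PolyTimeReducible.of_computes fun Γ (F : Γ.Index → C.Rep) hO
    (hF : Γ.Computes fun i => C.input (F i)) => ?_
  have hn := hF.arity
  have hn2 := hn.add (Ctx.Small.const Γ 2)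
  -- The base 2^(n+2) - 1 exceeds 2^n ≥ #_kF for every n. With n + 1 copies it would be 1 for n = 0,
  -- too small for a digit 1.
  obtain ⟨G, hG, hGF⟩ := Ctx.Computes.orSubst h hF (m := fun i _ => C.arity (F i) + 2) hn2.lift
  have hM := hG.queryCount hO
  have hb : Γ.Computes fun i => (2 : ℤ) ^ (C.arity (F i) + 2) - 1 :=
    (hn2.pow (Ctx.Computes.const Γ 2)).sub (Ctx.Computes.const Γ 1)
  have hn1 := hn.add (Ctx.Small.const Γ 1)
  have hres := hn1.map_range (f := fun i k => ((C'.fn (G i)).modelCount : ℤ) /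
      ((2 : ℤ) ^ (C.arity (F i) + 2) - 1) ^ k % ((2 : ℤ) ^ (C.arity (F i) + 2) - 1))
    ((hM.lift.div (hn1.newVar.pow hb.lift)).mod hb.lift)
  refine hres.recode fun i => ?_
  rw [enc_data, C.countBySize_answer]
  congr 1
  refine List.map_congr_left fun k hk => ?_
  obtain ⟨hN, hs⟩ := hGF i
  have hpow : 1 ≤ 2 ^ C.arity (F i) := Nat.one_le_two_pow
  have hbase : ((2 : ℤ) ^ (C.arity (F i) + 2) - 1) = ((2 ^ (C.arity (F i) + 2) - 1 : ℕ) : ℤ) := by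
    rw [Nat.cast_sub Nat.one_le_two_pow]
    push_cast
    rfl
  rw [hbase, hs.modelCount_eq]
  norm_cast
  refine sum_mul_pow_div_pow_mod _ _ (fun k => ?_) (List.mem_range.1 hk)
  have := (C.fn (F i)).modelCountOfSize_le k
  rw [pow_add]
  omega

/-! ### Marginal contributions from Shapley values of substituted functions -/

namespace Ctx

variable {Γ : Ctx} {C C' : FnClass} {F : Γ.Index → C.Rep}

theorem sum_ite_eq_add (n k x : ℕ) (hk : k < n) :
    (∑ j : Fin n, if (j : ℕ) ≤ k then if k ≤ j then x + 1 else 1 else 1) = n + x := by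
  have h : ∀ j : Fin n, (if (j : ℕ) ≤ k then if k ≤ j then x + 1 else 1 else 1) =
      1 + if j = ⟨k, hk⟩ then x else 0 := fun j => by
    simp only [Fin.ext_iff]
    split_ifs <;> omega
  simp [h, Finset.sum_add_distrib]

theorem Computes.sum_marginal (h : C.ComputesORSubst C') (hF : Γ.Computes fun i => C.input (F i))
    (hO : ∀ i, C'.shap.IsOracle (Γ.oracle i)) {k : (i : Γ.Index) → Fin (C.arity (F i))}
    (hk : Γ.Computes fun i => (k i : ℕ)) {x : Γ.Index → ℕ} (hx : Γ.Small x) :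
    Γ.Computes fun i => ∑ t ∈ Finset.range (C.arity (F i) + x i),
      (t.factorial : ℤ) * ((C.arity (F i) + x i - 1 - t).factorial : ℤ) *
        (C.fn (F i)).marginal (k i) t := by
  have hn := hF.arity
  have hk' : Γ.Small fun i => (k i : ℕ) := ⟨hk, hn.2.mono fun i => (k i).2.le⟩
  have hv := hn.newVar
  obtain ⟨G, hG, hGF⟩ := Computes.orSubst h hF (m := fun i j => if j ≤ k i then
      if k i ≤ j then x i + 1 else 1 else 1)
    (Small.ite (hv.1.natLe hk'.lift.1) (Small.ite (hk'.lift.1.natLe hv.1)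
      (hx.lift.add (Small.const _ 1)) (Small.const _ 1)) (Small.const _ 1))
  have hN : ∀ i, C'.arity (G i) = C.arity (F i) + x i := fun i => by
    obtain ⟨hN, -⟩ := hGF i
    rw [← hN, sum_ite_eq_add _ _ _ (k i).2]
  -- The first copy of variable k has number k again, since every earlier variable has exactly one
  -- copy.
  have hsh := hG.queryShap hO (k := fun i => ⟨k i, by rw [hN]; have := (k i).2; omega⟩) hk
  refine (hsh.dataFst.toInt.mul ((hn.add hx).factorial.div hsh.dataSnd.toInt)).congr fun i => ?_
  obtain ⟨hNi, hs⟩ := hGF i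
  have hnum := (C'.fn (G i)).num_mul_factorial_div_den ⟨k i, by rw [hN]; have := (k i).2; omega⟩
    (hN i)
  simp only [Data.ofRat, Data.fst, Data.snd, Data.toInt]
  rw [hnum]
  refine Finset.sum_congr rfl fun t _ => ?_
  congr 1
  rw [← hs.marginal_eq (fun j => by split_ifs <;> omega) (k i) (fun j hj => by
    have := Fin.val_ne_of_ne hj
    split_ifs <;> omega)]
  congr 1
  rw [Fin.ext_iff]
  simp only [Equiv.trans_apply, finCongr_apply, Fin.val_cast, finSigmaFinEquiv_apply]
  rw [add_zero]
  symm
  trans ∑ j : Fin (k i), 1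
  · refine Finset.sum_congr rfl fun j _ => ?_
    have := j.2
    simp only [Fin.val_castLE]
    split_ifs <;> omega
  · simp

theorem Computes.sum_scaledMarginal (h : C.ComputesORSubst C')
    (hF : Γ.Computes fun i => C.input (F i)) (hO : ∀ i, C'.shap.IsOracle (Γ.oracle i))
    {x : Γ.Index → ℕ} (hx : Γ.Small x) :
    Γ.Computes fun i => ∑ t ∈ Finset.range (C.arity (F i)), (C.fn (F i)).scaledMarginal t *
      ((x i + (C.arity (F i) - 1 - t)).choose (x i) : ℤ) := by
  have h1 := Computes.sum_marginal (Γ := Γ.ext fun i k => k < C.arity (F i)) h hF.lift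
    (fun q => hO q.1.1) (k := fun q => ⟨q.1.2, q.2⟩) hF.arity.newVar.1 hx.lift
  have h2 := hF.arity.sum (f := fun i k => if hk : k < C.arity (F i) then
    ∑ t ∈ Finset.range (C.arity (F i) + x i), (t.factorial : ℤ) *
      ((C.arity (F i) + x i - 1 - t).factorial : ℤ) * (C.fn (F i)).marginal ⟨k, hk⟩ t else 0)
    (h1.congr fun q => by rw [dif_pos (show q.1.2 < C.arity (F q.1.1) from q.2)])
  refine (h2.div hx.factorial).congr fun i => ?_
  rw [Finset.sum_range]
  simp only [Fin.is_lt, dif_pos, Fin.eta]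
  rw [BoolFn.sum_marginal_eq, Int.mul_ediv_cancel_left]
  exact_mod_cast Nat.factorial_ne_zero _

theorem Computes.backwardDiff {n j : Γ.Index → ℕ} (hn : Γ.Small n) (hj : Γ.Small j)
    {R : Γ.Index → ℕ → ℤ} (hR : (Γ.ext fun i x => x < j i + 1).Computes fun q => R q.1.1 q.1.2) :
    Γ.Computes fun i => backwardDiff (n i) (R i) (j i) := by
  have hj1 := hj.add (Small.const Γ 1)
  have hd := hj.lift.sub hj1.newVar
  exact hj1.sum (f := fun i x => (-1) ^ (j i - x) * ((n i).choose (j i - x) : ℤ) * R i x)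
    (((hd.pow (Computes.const _ (-1))).mul (hn.lift.choose hd)).mul hR)

theorem Computes.scaledMarginal (h : C.ComputesORSubst C')
    (hF : Γ.Computes fun i => C.input (F i)) (hO : ∀ i, C'.shap.IsOracle (Γ.oracle i))
    {t : Γ.Index → ℕ} (ht : Γ.Computes t) (htn : ∀ i, t i < C.arity (F i)) :
    Γ.Computes fun i => (C.fn (F i)).scaledMarginal (t i) := by
  have hn := hF.arity
  have ht' : Γ.Small t := ⟨ht, hn.2.mono fun i => (htn i).le⟩
  have hj := hn.newVar
  -- Two nested extensions: j is the index of a backward difference, and x ≤ j the number of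
  -- additional copies.
  have hR := Computes.sum_scaledMarginal
    (Γ := (Γ.ext fun i j => j < C.arity (F i)).ext fun q x => x < q.1.2 + 1) h hF.lift.lift
    (fun q => hO q.1.1.1.1) (hj.add (Small.const _ 1)).newVar
  have hb := Computes.backwardDiff hn.lift hj (R := fun q x =>
    ∑ s ∈ Finset.range (C.arity (F q.1.1)), (C.fn (F q.1.1)).scaledMarginal s *
      ((x + (C.arity (F q.1.1) - 1 - s)).choose x : ℤ)) hR
  have hs := hn.sum (f := fun i j => (j.choose (t i) : ℤ) * _root_.backwardDiff (C.arity (F i))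
    (fun x => ∑ s ∈ Finset.range (C.arity (F i)), (C.fn (F i)).scaledMarginal s *
      ((x + (C.arity (F i) - 1 - s)).choose x : ℤ)) j) ((hj.choose ht'.lift).mul hb)
  exact ((ht'.pow (Computes.const Γ (-1))).mul hs).congr fun i =>
    (eq_sum_backwardDiff (fun x _ => rfl) (htn i)).symm

end Ctx

/-- Shapley values see only differences of F; the constants 0 and 1 have the same ones. Hence F[∅]
has to be supplied separately. -/
theorem count_reducible_shap {C C' : FnClass} (h : C.ComputesORSubst C') (h0 : C.evalZero.InFP) :
    PolyTimeReducible C.count C'.shap := by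
  refine PolyTimeReducible.of_computes fun Γ (F : Γ.Index → C.Rep) hO
    (hF : Γ.Computes fun i => C.input (F i)) => ?_
  have hn := hF.arity
  have hn1 := hn.add (Ctx.Small.const Γ 1)
  have hz : Γ.Computes fun i => ((C.fn (F i)).valueOn ∅ : ℤ) :=
    (Ctx.Computes.callFP h0 (q := F) hF).recode fun i => by
      simp [FnClass.evalZero, BoolFn.valueOn]
  have hg := Ctx.Computes.scaledMarginal (Γ := Γ.ext fun i t => t < C.arity (F i)) h hF.lift
    (fun q => hO q.1.1) hn.newVar.1 fun q => q.2
  have hN1 := hn1.lift (P := fun i t => t < C.arity (F i))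
  have hW := hN1.sum
    (f := fun q k => if q.1.2 < k then ((C.arity (F q.1.1)).choose k : ℤ) else 0)
    ((hn.newVar.lift.1.natLt hN1.newVar.1).ite (hn.lift.lift.choose hN1.newVar)
      (Ctx.Computes.const _ 0))
  have hs := hn.sum (f := fun i t => (∑ k ∈ Finset.range (C.arity (F i) + 1),
    if t < k then ((C.arity (F i)).choose k : ℤ) else 0) * (C.fn (F i)).scaledMarginal t)
    (hW.mul hg)
  have hres := ((hn.factorial.mul ((hn.pow (Ctx.Computes.const Γ 2)).mul hz)).add hs).div
    hn.factorial
  refine hres.recode fun i => ?_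
  rw [← (C.fn (F i)).factorial_mul_modelCount, Int.mul_ediv_cancel_left]
  · rfl
  · exact_mod_cast Nat.factorial_ne_zero _

/-! ## Formulas -/

namespace Prog

/-- Replace all oracle queries by the constant `0`. -/
def withoutQueries : Prog → Prog
  | skip => skip
  | assign x e => assign x e
  | query x _ => assign x (.const 0)
  | seq c d => seq c.withoutQueries d.withoutQueries
  | ite e c d => ite e c.withoutQueries d.withoutQueries
  | .while e c => .while e c.withoutQueries

theorem oracleFree_withoutQueries (c : Prog) : c.withoutQueries.OracleFree := by
  induction c <;> simp_all [withoutQueries, OracleFree]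

theorem Exec.withoutQueries {c : Prog} {s s' : Store} {t : ℕ}
    (h : Exec (fun _ => .int 0) c s s' t) :
    ∃ t' ≤ t, Exec (fun _ => .int 0) c.withoutQueries s s' t' := by
  induction h with
  | skip s => exact ⟨_, le_rfl, .skip s⟩
  | assign s x e => exact ⟨_, le_rfl, .assign s x e⟩
  | query s x e =>
    refine ⟨_, ?_, .assign s x (.const 0)⟩
    simp only [Expr.cost]
    omega
  | seq _ _ ih₁ ih₂ =>
    obtain ⟨t₁, h₁, e₁⟩ := ih₁
    obtain ⟨t₂, h₂, e₂⟩ := ih₂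
    exact ⟨_, by omega, .seq e₁ e₂⟩
  | iteTrue he _ ih =>
    obtain ⟨t₁, h₁, e₁⟩ := ih
    exact ⟨_, by omega, .iteTrue he e₁⟩
  | iteFalse he _ ih =>
    obtain ⟨t₁, h₁, e₁⟩ := ih
    exact ⟨_, by omega, .iteFalse he e₁⟩
  | whileTrue he _ _ ih₁ ih₂ =>
    obtain ⟨t₁, h₁, e₁⟩ := ih₁
    obtain ⟨t₂, h₂, e₂⟩ := ih₂
    exact ⟨_, by omega, .whileTrue he e₁ e₂⟩
  | whileFalse he => exact ⟨_, le_rfl, .whileFalse he⟩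

end Prog

/-- The program obtained may still contain queries. Under the oracle that always answers 0 they can
be replaced by assignments, at no greater cost. -/
theorem Problem.InFP.of_computes {P : Problem}
    (h : ∀ (Γ : Ctx) (q : Γ.Index → P.Instance), (Γ.Computes fun i => P.input (q i)) →
      Γ.Computes fun i => P.answer (q i)) : P.InFP := by
  let Γ : Ctx := ⟨P.Instance, fun _ _ => .int 0, P.input⟩
  obtain ⟨c, k, T, ⟨p, hp⟩, hc⟩ := h Γ id (Ctx.Computes.input Γ)
  refine ⟨c.withoutQueries, p, c.oracleFree_withoutQueries, fun i => ?_⟩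
  obtain ⟨s, t, he, hs, ht⟩ := ((hc i).mono le_rfl (hp i)).outputsWithin
  obtain ⟨t', ht', he'⟩ := he.withoutQueries
  exact ⟨s, t', he', hs, ht'.trans ht⟩

/-! ### Traversal of syntax trees with a worklist -/

namespace BoolFormula

variable {n N : ℕ}

def children : BoolFormula n → List (BoolFormula n)
  | const _ => []
  | var _ => []
  | neg f => [f]
  | and f g => [f, g]
  | or f g => [f, g]

/-- All occurrences of subformulas, in prefix order. -/
def subformulas : BoolFormula n → List (BoolFormula n)
  | const b => [const b]
  | var i => [var i]
  | neg f => neg f :: f.subformulas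
  | and f g => and f g :: (f.subformulas ++ g.subformulas)
  | or f g => or f g :: (f.subformulas ++ g.subformulas)

theorem subformulas_eq (f : BoolFormula n) :
    f.subformulas = f :: f.children.flatMap subformulas := by
  cases f <;> simp [subformulas, children]

theorem size_code_of_mem_children {f g : BoolFormula n} (h : g ∈ f.children) :
    g.code.size ≤ f.code.size := by
  cases f <;> simp only [children, List.not_mem_nil, List.mem_cons, or_false] at h
  · subst h; simp [code, Data.size]
  · rcases h with rfl | rfl <;> simp only [code, Data.size] <;> omega
  · rcases h with rfl | rfl <;> simp only [code, Data.size] <;> omega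

theorem length_subformulas_le (f : BoolFormula n) : f.subformulas.length ≤ f.code.size := by
  induction f <;> simp only [subformulas, code, Data.size, List.length_cons, List.length_append,
    List.length_nil] at * <;> omega

theorem truthy_code (f : BoolFormula n) : f.code.truthy = true := by
  cases f <;> rfl

/-- One step of the traversal of a list of formulas. -/
def visit (q : List (BoolFormula n) × List (BoolFormula n)) :
    List (BoolFormula n) × List (BoolFormula n) :=
  match q.1 with
  | [] => q
  | f :: W => (f.children ++ W, f :: q.2)

/-- The number of subformula occurrences in the worklist counts the remaining steps: a visit removes
one root and keeps everything below it. -/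
theorem length_flatMap_visit {q : List (BoolFormula n) × List (BoolFormula n)} {k : ℕ}
    (h : (q.1.flatMap subformulas).length = k + 1) :
    ((visit q).1.flatMap subformulas).length = k := by
  obtain ⟨W, out⟩ := q
  cases W with
  | nil => simp at h
  | cons f W =>
    rw [List.flatMap_cons, subformulas_eq] at h
    simp only [List.cons_append, List.length_cons, List.length_append] at h
    simp only [visit, List.flatMap_append, List.length_append]
    omega

theorem length_flatMap_visit_iterate (q : List (BoolFormula n) × List (BoolFormula n)) (j : ℕ)
    (h : j ≤ (q.1.flatMap subformulas).length) :
    ((visit^[j] q).1.flatMap subformulas).length = (q.1.flatMap subformulas).length - j := by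
  induction j with
  | zero => rfl
  | succ j ih =>
    rw [Function.iterate_succ_apply']
    refine length_flatMap_visit ?_
    rw [ih (by omega)]
    omega

theorem length_le_length_flatMap (W : List (BoolFormula n)) :
    W.length ≤ (W.flatMap subformulas).length := by
  induction W with
  | nil => simp
  | cons f W ih =>
    rw [List.flatMap_cons, subformulas_eq]
    simp only [List.cons_append, List.length_cons, List.length_append]
    omega

theorem visit_iterate_eq (q : List (BoolFormula n) × List (BoolFormula n)) :
    visit^[(q.1.flatMap subformulas).length] q =
      ([], (q.1.flatMap subformulas).reverse ++ q.2) := by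
  generalize hk : (q.1.flatMap subformulas).length = k
  induction k generalizing q with
  | zero =>
    obtain ⟨W, out⟩ := q
    have := length_le_length_flatMap W
    obtain rfl : W = [] := List.eq_nil_of_length_eq_zero (by dsimp only at hk; omega)
    simp
  | succ k ih =>
    rw [Function.iterate_succ_apply, ih _ (length_flatMap_visit hk)]
    obtain ⟨W, out⟩ := q
    cases W with
    | nil => simp at hk
    | cons f W =>
      simp only [visit]
      rw [List.flatMap_cons, subformulas_eq f]
      simp

/-- Only subformulas of f ever enter the two lists, and each step outputs at most one; this keeps
the states of the traversal small. -/
theorem visit_iterate_bounds (f : BoolFormula n) (j : ℕ) :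
    (∀ g ∈ (visit^[j] ([f], [])).1, g.code.size ≤ f.code.size) ∧
    (∀ g ∈ (visit^[j] ([f], [])).2, g.code.size ≤ f.code.size) ∧
    (visit^[j] ([f], [])).2.length ≤ j := by
  induction j with
  | zero => simp
  | succ j ih =>
    rw [Function.iterate_succ_apply']
    obtain ⟨h1, h2, h3⟩ := ih
    generalize visit^[j] ([f], []) = q at *
    obtain ⟨W, out⟩ := q
    cases W with
    | nil => exact ⟨h1, h2, h3.trans (Nat.le_succ j)⟩
    | cons g W =>
      simp only [visit, List.mem_append, List.mem_cons, List.length_cons] at *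
      refine ⟨?_, ?_, by omega⟩
      · rintro g' (hg' | hg')
        · exact (size_code_of_mem_children hg').trans (h1 g (Or.inl rfl))
        · exact h1 g' (Or.inr hg')
      · rintro g' (rfl | hg')
        · exact h1 g' (Or.inl rfl)
        · exact h2 g' hg'

/-- Evaluation of a formula with a stack. -/
theorem foldr_subformulas {v : BoolFormula n → Data} {step : Data → Data → Data}
    (h : ∀ g s, step ((g.children.map v).foldr Data.pair s) g.code = .pair (v g) s)
    (f : BoolFormula n) (s : Data) :
    f.subformulas.foldr (fun g s => step s g.code) s = .pair (v f) s := by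
  induction f generalizing s with
  | const b => exact h (const b) s
  | var i => exact h (var i) s
  | neg f ih => simpa [subformulas, ih, children] using h (neg f) s
  | and f g ihf ihg => simpa [subformulas, ihf, ihg, children] using h (and f g) s
  | or f g ihf ihg => simpa [subformulas, ihf, ihg, children] using h (or f g) s

end BoolFormula

namespace Ctx

variable {Γ : Ctx} {n : Γ.Index → ℕ} {f : (i : Γ.Index) → BoolFormula (n i)}

open BoolFormula in
theorem Computes.subformulas (hf : Γ.Computes fun i => (f i).code) :
    Γ.Computes fun i => (f i).subformulas.reverse.map BoolFormula.code := by
  let tr : (i : Γ.Index) → ℕ → List (BoolFormula (n i)) × List (BoolFormula (n i)) :=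
    fun i j => visit^[j] ([f i], [])
  let st : Γ.Index → ℕ → Data := fun i j =>
    enc ((tr i j).1.map BoolFormula.code, (tr i j).2.map BoolFormula.code)
  have hlen : ∀ i, ([f i].flatMap BoolFormula.subformulas).length =
      (f i).subformulas.length := fun i => by simp
  have h : Γ.Computes fun i => st i (f i).subformulas.length := by
    have hB : Γ.Bdd fun i => (f i).subformulas.length :=
      hf.bdd_size.mono fun i => (f i).length_subformulas_le
    have hsz : Γ.Bdd fun i => (f i).code.size := hf.bdd_size
    refine Computes.while
      (S := fun i => 1 + 2 * (1 + (f i).subformulas.length * ((f i).code.size + 1)))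
      (((hf.cons (Computes.nil Γ)).prodMk (Computes.nil (α := Data) Γ)).recode fun i => ?_) hB
      ((Bdd.const Γ 1).add ((Bdd.const Γ 2).mul ((Bdd.const Γ 1).add (hB.mul (hsz.add
        (Bdd.const Γ 1)))))) (fun i j hj => ?_) ?_ (fun i j hj => ?_) fun i => ?_
    · simp [st, tr]
    · obtain ⟨h1, h2, h3⟩ := visit_iterate_bounds (f i) j
      have h4 := length_le_length_flatMap (tr i j).1
      rw [length_flatMap_visit_iterate _ _ (by rw [hlen]; exact hj), hlen] at h4
      have h5 := size_enc_list_le (l := (tr i j).1.map BoolFormula.code) (B := (f i).code.size)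
        (by simpa using h1)
      have h6 := size_enc_list_le (l := (tr i j).2.map BoolFormula.code) (B := (f i).code.size)
        (by simpa using h2)
      have h7 := Nat.mul_le_mul_right ((f i).code.size + 1) (h4.trans (Nat.sub_le _ j))
      have h8 := Nat.mul_le_mul_right ((f i).code.size + 1) (h3.trans hj)
      simp only [List.length_map] at h5 h6
      simp only [st, enc_prod, Data.size]
      simp only [tr] at *
      omega
    · set Δ : Ctx := ⟨{q : Γ.Index × ℕ // q.2 < (f q.1).subformulas.length},
        fun q => Γ.oracle q.1.1, fun q => st q.1.1 q.1.2⟩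
      have hin := Computes.input Δ
      have hW := hin.dataFst
      have hout := hin.dataSnd
      have hg := hW.dataFst
      have htag := hg.dataFst.toInt
      have hrest := hW.dataSnd
      have harg := hg.dataSnd
      -- Tags 0 and 1 are leaves, 2 is negation with one child, and 3 and 4 have two children.
      have hnew := (htag.le (Computes.const Δ 1)).ite hrest
        ((htag.le (Computes.const Δ 2)).ite (harg.dataPair hrest)
          (harg.dataFst.dataPair (harg.dataSnd.dataPair hrest)))
      refine (hnew.dataPair (hg.dataPair hout)).congr fun q => ?_
      obtain ⟨⟨i, j⟩, hj⟩ := q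
      dsimp only at hj
      have h4 := length_flatMap_visit_iterate ([f i], []) j (by rw [hlen]; exact hj.le)
      rw [hlen] at h4
      simp only [Δ, st, tr, Function.iterate_succ_apply']
      generalize visit^[j] ([f i], []) = r at *
      obtain ⟨W, out⟩ := r
      cases W with
      | nil => simp at h4; omega
      | cons g W =>
        cases g <;> simp [visit, children, BoolFormula.code, Data.fst, Data.snd, Data.toInt]
    · have h4 := length_flatMap_visit_iterate ([f i], []) j (by rw [hlen]; exact hj.le)
      rw [hlen] at h4
      simp only [st, tr]
      generalize visit^[j] ([f i], []) = r at *
      obtain ⟨W, out⟩ := r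
      cases W with
      | nil => simp at h4; omega
      | cons g W => rfl
    · have := visit_iterate_eq ([f i], [])
      rw [hlen] at this
      simp [st, tr, this, Data.fst, Data.truthy]
  refine h.dataSnd.recode fun i => ?_
  have := visit_iterate_eq ([f i], [])
  rw [hlen] at this
  simp [st, tr, this, Data.snd]

/-- Recursion on formulas, by a step function on a stack of values. -/
theorem Computes.formulaRec (hf : Γ.Computes fun i => (f i).code)
    {v : (i : Γ.Index) → BoolFormula (n i) → Data} {step : Γ.Index → Data → Data → Data}
    {b : Γ.Index → ℕ}
    (hstep : (Γ.ext fun i (q : Data × Data) =>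
      ∃ g : BoolFormula (n i), g.code.size ≤ (f i).code.size ∧ q.2 = g.code).Computes fun q =>
        step q.1.1 q.1.2.1 q.1.2.2)
    (hv : ∀ i g s, step i ((g.children.map (v i)).foldr Data.pair s) g.code = .pair (v i g) s)
    (hb : Γ.Bdd b) (hsb : ∀ i s (g : BoolFormula (n i)), g.code.size ≤ (f i).code.size →
      (step i s g.code).size ≤ s.size + b i) : Γ.Computes fun i => v i (f i) := by
  have hmem : ∀ i x, x ∈ (f i).subformulas.reverse.map BoolFormula.code →
      ∃ g : BoolFormula (n i), g.code.size ≤ (f i).code.size ∧ x = g.code := by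
    intro i x hx
    obtain ⟨g, hg, rfl⟩ := List.mem_map.1 hx
    refine ⟨g, ?_, rfl⟩
    have h := BoolFormula.visit_iterate_eq ([f i], [])
    have h2 := (BoolFormula.visit_iterate_bounds (f i)
      ([f i].flatMap BoolFormula.subformulas).length).2.1 g
    rw [h] at h2
    exact h2 (by simpa using hg)
  have h := Computes.foldl_of_growth (f := step) (g := b) hf.subformulas (Computes.const Γ 0).data
    (hstep.restrict (f := fun i (q : Data × Data) => step i q.1 q.2) fun i q hq => hmem i _ hq) hb
    fun i s x hx => by
      obtain ⟨g, hg, rfl⟩ := hmem i x hx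
      exact hsb i s g hg
  refine h.dataFst.congr fun i => ?_
  rw [List.foldl_map, List.foldl_reverse, BoolFormula.foldr_subformulas (hv i)]
  rfl

end Ctx

/-! ### Evaluation of formulas at the zero valuation -/

namespace BoolFormula

variable {n : ℕ}

/-- The value of a formula at the zero valuation, as a datum. -/
def zeroValue (g : BoolFormula n) : Data := .int (if g.eval (fun _ => false) = true then 1 else 0)

/-- The step of the evaluation at the zero valuation with a stack. -/
def zeroStep (s x : Data) : Data :=
  if x.fst.toInt ≤ 0 then .pair x.snd s
  else if x.fst.toInt ≤ 1 then .pair (.int 0) s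
  else if x.fst.toInt ≤ 2 then .pair (if s.fst.truthy = true then .int 0 else .int 1) s.snd
  else if x.fst.toInt ≤ 3 then
    .pair (if s.fst.truthy = true then s.snd.fst else .int 0) s.snd.snd
  else .pair (if s.fst.truthy = true then .int 1 else s.snd.fst) s.snd.snd

theorem truthy_zeroValue (g : BoolFormula n) :
    g.zeroValue.truthy = g.eval (fun _ => false) := by
  rw [zeroValue]
  cases g.eval (fun _ => false) <;> rfl

theorem zeroStep_eq (g : BoolFormula n) (s : Data) :
    zeroStep ((g.children.map zeroValue).foldr Data.pair s) g.code = .pair g.zeroValue s := by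
  cases g with
  | const b => rfl
  | var j => rfl
  | neg g =>
    simp only [zeroStep, code, children, Data.fst, Data.toInt, Data.snd, List.map, List.foldr,
      truthy_zeroValue]
    rw [show (neg g).zeroValue =
      .int (if (!g.eval fun _ => false) = true then 1 else 0) from rfl]
    cases g.eval (fun _ => false) <;> rfl
  | and g h =>
    simp only [zeroStep, code, children, Data.fst, Data.toInt, Data.snd, List.map, List.foldr,
      truthy_zeroValue]
    rw [show (and g h).zeroValue = .int (if (g.eval (fun _ => false) &&
      h.eval fun _ => false) = true then 1 else 0) from rfl,
      show h.zeroValue = .int (if h.eval (fun _ => false) = true then 1 else 0) from rfl]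
    cases g.eval (fun _ => false) <;> cases h.eval (fun _ => false) <;> rfl
  | or g h =>
    simp only [zeroStep, code, children, Data.fst, Data.toInt, Data.snd, List.map, List.foldr,
      truthy_zeroValue]
    rw [show (or g h).zeroValue = .int (if (g.eval (fun _ => false) ||
      h.eval fun _ => false) = true then 1 else 0) from rfl,
      show h.zeroValue = .int (if h.eval (fun _ => false) = true then 1 else 0) from rfl]
    cases g.eval (fun _ => false) <;> cases h.eval (fun _ => false) <;> rfl

theorem size_zeroStep_le (s x : Data) : (zeroStep s x).size ≤ s.size + (6 + x.size) := by
  have h1 := x.size_snd_le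
  have h2 := s.size_snd_le
  have h3 := s.snd.size_snd_le
  have h4 : s.snd.fst.size + s.snd.snd.size ≤ s.snd.size + 1 := by
    cases s.snd <;> simp [Data.fst, Data.snd, Data.size]; omega
  have e0 : (Data.int 0).size = 1 := rfl
  have e1 : (Data.int 1).size = 2 := rfl
  have h5 : ∀ a b : Data, (Data.pair a b).size = 1 + a.size + b.size := fun _ _ => rfl
  rw [zeroStep]
  split_ifs <;> rw [h5] <;> omega

end BoolFormula

theorem evalZero_inFP (C : Set AnyFormula) : (FnClass.ofFormulas C).evalZero.InFP := by
  refine Problem.InFP.of_computes fun Γ (F : Γ.Index → {F : AnyFormula // F ∈ C}) hF => ?_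
  have hf : Γ.Computes fun i => (F i).1.2.code := hF.dataSnd
  refine Ctx.Computes.formulaRec hf (b := fun i => 6 + (F i).1.2.code.size)
    (v := fun i g => g.zeroValue) (step := fun i s x => BoolFormula.zeroStep s x) ?_
    (fun i g s => g.zeroStep_eq s) ((Ctx.Bdd.const Γ 6).add hf.bdd_size) fun i s g hg => ?_
  · set Δ := Γ.ext fun i (q : Data × Data) => ∃ g : BoolFormula (F i).1.1,
      g.code.size ≤ (F i).1.2.code.size ∧ q.2 = g.code
    have hs : Δ.Computes fun q => q.1.2.1 := (Ctx.Computes.newVar _ _).fst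
    have hx : Δ.Computes fun q => q.1.2.2 := (Ctx.Computes.newVar _ _).snd
    have hc := fun z => (Ctx.Computes.const Δ z)
    have ht := hx.dataFst.toInt
    exact (ht.le (hc 0)).ite (hx.dataSnd.dataPair hs) ((ht.le (hc 1)).ite
      ((hc 0).data.dataPair hs) ((ht.le (hc 2)).ite
      ((hs.dataFst.dataIte (hc 0).data (hc 1).data).dataPair hs.dataSnd) ((ht.le (hc 3)).ite
      ((hs.dataFst.dataIte hs.dataSnd.dataFst (hc 0).data).dataPair hs.dataSnd.dataSnd)
      ((hs.dataFst.dataIte (hc 1).data hs.dataSnd.dataFst).dataPair hs.dataSnd.dataSnd))))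
  · have := BoolFormula.size_zeroStep_le s g.code
    omega

/-! ### OR-substitution on codes of formulas -/

namespace BoolFormula

variable {n N : ℕ}

theorem eval_subst (θ : Fin n → BoolFormula N) (f : BoolFormula n) (v : Fin N → Bool) :
    (f.subst θ).eval v = f.eval fun i => (θ i).eval v := by
  induction f <;> simp_all [subst, eval]

theorem eval_disj (l : List (Fin N)) (v : Fin N → Bool) :
    (disj l).eval v = decide (∃ x ∈ l, v x = true) := by
  induction l with
  | nil => simp [disj, eval]
  | cons x l ih =>
    cases l with
    | nil => simp [disj, eval]
    | cons y l =>
      change ((var x).eval v || (disj (y :: l)).eval v) = _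
      rw [ih]
      simp [eval]

theorem isORSubst_eval_subst (f : BoolFormula n) (m : Fin n → ℕ)
    (e : (Σ i : Fin n, Fin (m i)) ≃ Fin N) :
    f.eval.IsORSubst m e (f.subst fun i => disj (List.ofFn fun j => e ⟨i, j⟩)).eval := by
  intro v
  rw [eval_subst]
  congr 1
  funext i
  rw [eval_disj]
  simp only [List.mem_ofFn, exists_exists_eq_and]

/-- The step of the construction of a disjunction. -/
def disjStep (x : ℕ) (d : Data) : Data :=
  if d.truthy = true then .pair (.int 4) (.pair (.pair (.int 1) (.int x)) d)
  else .pair (.int 1) (.int x)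

/-- The code of the disjunction of the variables in a list. -/
def disjCode (l : List ℕ) : Data :=
  if (l.foldr disjStep (.int 0)).truthy = true then l.foldr disjStep (.int 0)
  else .pair (.int 0) (.int 0)

/-- The start value `int 0` is false while every code is true, so it marks that there is no disjunct
yet; a single variable is thus not joined with the constant 0. -/
theorem foldr_disjStep (x : Fin N) (l : List (Fin N)) :
    ((x :: l).map Fin.val).foldr disjStep (.int 0) = (disj (x :: l)).code := by
  induction l generalizing x with
  | nil => rfl
  | cons y l ih =>
    rw [List.map_cons, List.foldr_cons, ih, disjStep, if_pos (truthy_code _)]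
    rfl

theorem disjCode_eq (l : List (Fin N)) : disjCode (l.map Fin.val) = (disj l).code := by
  cases l with
  | nil => rfl
  | cons x l => rw [disjCode, foldr_disjStep, if_pos (truthy_code _)]

/-- The step of the computation of a substitution with a stack, for a list of codes of the formulas
that are substituted for the variables. -/
def substStep (D : List Data) (s x : Data) : Data :=
  if x.fst.toInt ≤ 0 then .pair x s
  else if x.fst.toInt ≤ 1 then .pair (D.getD x.snd.toInt.natAbs (.int 0)) s
  else if x.fst.toInt ≤ 2 then .pair (.pair (.int 2) s.fst) s.snd
  else .pair (.pair x.fst (.pair s.fst s.snd.fst)) s.snd.snd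

theorem substStep_eq (θ : Fin n → BoolFormula N) (g : BoolFormula n) (s : Data) :
    substStep (List.ofFn fun i => (θ i).code)
      ((g.children.map fun g => (g.subst θ).code).foldr Data.pair s) g.code =
      .pair (g.subst θ).code s := by
  cases g with
  | const b => rfl
  | var j =>
    have : (List.ofFn fun i => (θ i).code).getD (j : ℕ) (.int 0) = (θ j).code := by
      rw [List.getD_eq_getElem _ _ (by simp)]
      simp
    exact congrArg (fun d => Data.pair d s) this
  | neg g => rfl
  | and g h => rfl
  | or g h => rfl

theorem size_getD_le (D : List Data) (k : ℕ) : (D.getD k (.int 0)).size ≤ (enc D).size := by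
  rcases lt_or_ge k D.length with h | h
  · rw [List.getD_eq_getElem _ _ h]
    exact size_enc_le_of_mem (List.getElem_mem h)
  · rw [List.getD_eq_default _ _ h]
    exact (enc D).size_pos

theorem size_substStep_le (D : List Data) (s x : Data) :
    (substStep D s x).size ≤ s.size + (8 + x.size + (enc D).size) := by
  have h0 := size_getD_le D x.snd.toInt.natAbs
  have h1 := x.size_fst_le
  have h2 : s.fst.size + s.snd.size ≤ s.size + 1 := by
    cases s <;> simp [Data.fst, Data.snd, Data.size]; omega
  have h4 : s.snd.fst.size + s.snd.snd.size ≤ s.snd.size + 1 := by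
    cases s.snd <;> simp [Data.fst, Data.snd, Data.size]; omega
  have e2 : (Data.int 2).size = 3 := rfl
  have h5 : ∀ a b : Data, (Data.pair a b).size = 1 + a.size + b.size := fun _ _ => rfl
  rw [substStep]
  split_ifs <;> simp only [h5] <;> omega

/-- The table lookup is one branch of a conditional, and both branches must be computable on every
token, so the index has to be small for all formulas. The constant 1 over no variables forces the
extra 1. -/
theorem natAbs_toInt_snd_code_le (g : BoolFormula n) : g.code.snd.toInt.natAbs ≤ n + 1 := by
  cases g with
  | const b => cases b <;> simp [code, Data.snd, Data.toInt]
  | var i => simp [code, Data.snd, Data.toInt]; omega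
  | neg g => cases g <;> simp [code, Data.snd, Data.toInt]
  | and g h => simp [code, Data.snd, Data.toInt]
  | or g h => simp [code, Data.snd, Data.toInt]

end BoolFormula

namespace Ctx

variable {Γ : Ctx}

theorem Computes.disjCode {l : Γ.Index → List ℕ} (hl : Γ.Computes l) :
    Γ.Computes fun i => BoolFormula.disjCode (l i) := by
  have h : Γ.Computes fun i => (l i).foldr BoolFormula.disjStep (.int 0) := by
    refine Computes.foldr_of_growth (f := fun _ => BoolFormula.disjStep)
      (g := fun i => 10 + (enc (l i)).size) hl (const Γ 0).data ?_
      ((Bdd.const Γ 10).add hl.bdd_size) fun i d x hx => ?_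
    · set Δ := Γ.ext fun i (q : Data × ℕ) => q.2 ∈ l i
      have hd : Δ.Computes fun q => q.1.2.1 := (newVar _ _).fst
      have hx : Δ.Computes fun q => (q.1.2.2 : ℤ) := (newVar _ _).snd.cast
      have hv := (const Δ 1).data.dataPair hx.data
      exact hd.dataIte ((const Δ 4).data.dataPair (hv.dataPair hd)) hv
    · have h1 := size_enc_le_of_mem hx
      have e1 : (Data.int 1).size = 2 := rfl
      have e4 : (Data.int 4).size = 4 := rfl
      have h5 : ∀ a b : Data, (Data.pair a b).size = 1 + a.size + b.size := fun _ _ => rfl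
      rw [enc_nat] at h1
      simp only [enc_data, BoolFormula.disjStep]
      split_ifs <;> simp only [h5] <;> omega
  exact h.dataIte h ((const Γ 0).data.dataPair (const Γ 0).data)

theorem Computes.getNat {l : Γ.Index → List ℕ} {k : Γ.Index → ℕ} (hl : Γ.Computes l)
    (hk : Γ.Small k) : Γ.Computes fun i => (l i).getD (k i) 0 :=
  (hl.getData hk).recode fun i => by
    rw [show Data.int 0 = enc (0 : ℕ) from rfl, List.getD_map]; rfl

theorem Computes.substCode {n N : Γ.Index → ℕ} {f : (i : Γ.Index) → BoolFormula (n i)}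
    (hf : Γ.Computes fun i => (f i).code) (hn : Γ.Bdd n)
    {θ : (i : Γ.Index) → Fin (n i) → BoolFormula (N i)}
    (hθ : Γ.Computes fun i => List.ofFn fun k => (θ i k).code) :
    Γ.Computes fun i => ((f i).subst (θ i)).code := by
  refine Computes.formulaRec hf (v := fun i g => (g.subst (θ i)).code)
    (b := fun i => 8 + (f i).code.size + (enc (List.ofFn fun k => (θ i k).code)).size)
    (step := fun i => BoolFormula.substStep (List.ofFn fun k => (θ i k).code)) ?_
    (fun i g s => BoolFormula.substStep_eq (θ i) g s)
    (((Bdd.const Γ 8).add hf.bdd_size).add hθ.bdd_size) fun i s g hg => ?_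
  · set Δ := Γ.ext fun i (q : Data × Data) => ∃ g : BoolFormula (n i),
      g.code.size ≤ (f i).code.size ∧ q.2 = g.code
    have hs : Δ.Computes fun q => q.1.2.1 := (newVar _ _).fst
    have hx : Δ.Computes fun q => q.1.2.2 := (newVar _ _).snd
    have hc := fun z => (const Δ z)
    have ht := hx.dataFst.toInt
    have hk : Δ.Small fun q => q.1.2.2.snd.toInt.natAbs :=
      ⟨hx.dataSnd.toInt.natAbs, (hn.lift.add (Bdd.const Δ 1)).mono fun q => by
        obtain ⟨g, -, hg⟩ := q.2
        rw [hg]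
        exact g.natAbs_toInt_snd_code_le⟩
    have hget : Δ.Computes fun q => (List.ofFn fun k => (θ q.1.1 k).code).getD
        q.1.2.2.snd.toInt.natAbs (.int 0) :=
      (hθ.lift.getData hk).congr fun q => by
        congr 1
        exact List.map_id _
    exact (ht.le (hc 0)).ite (hx.dataPair hs) ((ht.le (hc 1)).ite (hget.dataPair hs)
      ((ht.le (hc 2)).ite (((hc 2).data.dataPair hs.dataFst).dataPair hs.dataSnd)
        ((hx.dataFst.dataPair (hs.dataFst.dataPair hs.dataSnd.dataFst)).dataPair
          hs.dataSnd.dataSnd)))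
  · have := BoolFormula.size_substStep_le (List.ofFn fun k => (θ i k).code) s g.code
    omega

end Ctx

theorem orClosure_computesORSubst (C : Set AnyFormula) :
    (FnClass.ofFormulas C).ComputesORSubst (FnClass.ofFormulas (orClosure C)) := by
  let θ : (F : AnyFormula) → (m : Fin F.1 → ℕ) → Fin F.1 → BoolFormula (∑ i, m i) := fun F m i =>
    BoolFormula.disj (List.ofFn fun j : Fin (m i) => finSigmaFinEquiv ⟨i, j⟩)
  let σ : (F : {F : AnyFormula // F ∈ C}) → (Fin F.1.1 → ℕ) → {G : AnyFormula // G ∈ orClosure C} :=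
    fun F m => ⟨⟨∑ i, m i, F.1.2.subst (θ F.1 m)⟩, F.1, F.2, m, finSigmaFinEquiv, rfl⟩
  refine ⟨σ, fun F m => ⟨rfl, BoolFormula.isORSubst_eval_subst F.1.2 m finSigmaFinEquiv⟩, ?_⟩
  refine Problem.InFP.of_computes fun Γ
    (q : Γ.Index → Σ F : {F : AnyFormula // F ∈ C}, (Fin F.1.1 → ℕ)) hq => ?_
  let n : Γ.Index → ℕ := fun i => (q i).1.1.1
  let m : (i : Γ.Index) → Fin (n i) → ℕ := fun i => (q i).2
  have hF : Γ.Computes fun i => (FnClass.ofFormulas C).input (q i).1 := hq.dataFst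
  have hn : Γ.Small n := hF.arity
  have hf : Γ.Computes fun i => (q i).1.1.2.code := hF.dataSnd
  have hU : Γ.Computes fun i => List.ofFn fun k => List.replicate (m i k) () :=
    hq.dataSnd.recode fun i => by
      rw [enc_list, List.map_ofFn]
      simp only [Function.comp_def, enc_replicate_unit]
      rfl
  have hM : Γ.Computes fun i => List.ofFn (m i) :=
    (hU.map (f := fun _ u => u.length) (Ctx.Computes.newVar _ _).length.1).congr fun i => by
      rw [List.map_ofFn]
      congr 1
      funext k
      simp
  -- Multiplicities arrive in unary, so they are bounded by the input size and loops may run up to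
  -- them.
  have hmB : ∀ i k, (List.ofFn (m i)).getD k 0 ≤
      (enc (List.ofFn fun k => List.replicate (m i k) ())).size := fun i k => by
    rcases lt_or_ge k (n i) with h | h
    · rw [List.getD_eq_getElem _ _ (by simpa using h)]
      have h1 := size_enc_le_of_mem (l := List.ofFn fun k => List.replicate (m i k) ())
        (x := List.replicate (m i ⟨k, h⟩) ()) ((List.mem_ofFn' _ _).2 ⟨_, rfl⟩)
      have h2 := length_lt_size_enc (List.replicate (m i ⟨k, h⟩) ())
      simp only [List.length_replicate] at h2
      simp only [List.getElem_ofFn]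
      omega
    · rw [List.getD_eq_default _ _ (by simpa using h)]
      omega
  have hMs : ∀ {Δ : Ctx} {i : Δ.Index → Γ.Index} {k : Δ.Index → ℕ},
      (Δ.Computes fun j => List.ofFn (m (i j))) →
      (Δ.Computes fun j => List.ofFn fun k => List.replicate (m (i j) k) ()) → Δ.Small k →
      Δ.Small fun j => (List.ofFn (m (i j))).getD (k j) 0 := fun hM hU hk =>
    ⟨hM.getNat hk, hU.bdd_size.mono fun j => hmB _ _⟩
  have hNsum : Γ.Small fun i => ∑ k ∈ Finset.range (n i), (List.ofFn (m i)).getD k 0 := by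
    refine ⟨Ctx.Computes.ofCast ((hn.sum (f := fun i k => ((List.ofFn (m i)).getD k 0 : ℕ))
      (hMs hM.lift hU.lift hn.newVar).1.cast).congr fun i => by push_cast; rfl),
      (hn.2.mul hU.bdd_size).mono fun i => ?_⟩
    refine (Finset.sum_le_card_nsmul _ _ _ fun k _ => hmB i k).trans ?_
    simp
  -- The block of copies of variable k starts at the sum of the earlier multiplicities, as in
  -- `finSigmaFinEquiv`.
  have hoff : (Γ.ext fun i k => k < n i).Computes fun r =>
      ∑ j ∈ Finset.range r.1.2, (List.ofFn (m r.1.1)).getD j 0 :=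
    Ctx.Computes.ofCast ((hn.newVar.sum (f := fun r j => ((List.ofFn (m r.1.1)).getD j 0 : ℕ))
      (hMs hM.lift.lift hU.lift.lift hn.newVar.newVar).1.cast).congr fun i => by
        push_cast; rfl)
  have hMk := hMs hM.lift hU.lift hn.newVar
  have hD : Γ.Computes fun i => List.ofFn fun k => (θ (q i).1.1 (m i) k).code := by
    refine (hn.map_range (f := fun i k => BoolFormula.disjCode
      ((List.range ((List.ofFn (m i)).getD k 0)).map fun j =>
        (∑ j ∈ Finset.range k, (List.ofFn (m i)).getD j 0) + j))
      (hMk.map_range (hoff.lift.natAdd hMk.newVar.1)).disjCode).congr fun i => ?_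
    rw [← List.ofFn_eq_map_range]
    congr 1
    funext k
    rw [← BoolFormula.disjCode_eq, List.map_ofFn]
    congr 1
    have hget : ∀ k : Fin (n i), (List.ofFn (m i)).getD k 0 = m i k := fun k => by
      rw [List.getD_eq_getElem _ _ (by simp)]
      simp
    rw [hget, ← List.ofFn_eq_map_range]
    congr 1
    funext j
    simp only [Function.comp_apply, finSigmaFinEquiv_apply, Finset.sum_range]
    congr 1
    exact Finset.sum_congr rfl fun j _ => hget (Fin.castLE k.2.le j)
  have hcode := Ctx.Computes.substCode hf hn.2 hD
  refine (hNsum.unary.dataPair hcode).congr fun i => ?_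
  have hN : ∑ k ∈ Finset.range (n i), (List.ofFn (m i)).getD k 0 = ∑ k, m i k := by
    rw [Finset.sum_range]
    refine Finset.sum_congr rfl fun k _ => ?_
    rw [List.getD_eq_getElem _ _ (by simp)]
    simp
  rw [hN]
  rfl

theorem mainTheorem1 :
    (∀ C : Set AnyFormula,
      PolyTimeReducible (FnClass.ofFormulas C).shap (FnClass.ofFormulas (orClosure C)).countBySize ∧
      PolyTimeReducible (FnClass.ofFormulas C).countBySize (FnClass.ofFormulas (orClosure C)).count ∧
      PolyTimeReducible (FnClass.ofFormulas C).count (FnClass.ofFormulas (orClosure C)).shap) ∧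
    (∀ C C' : FnClass, C.ComputesORSubst C' →
      PolyTimeReducible C.shap C'.countBySize ∧
      PolyTimeReducible C.countBySize C'.count ∧
      (C.evalZero.InFP → PolyTimeReducible C.count C'.shap)) :=
  ⟨fun C => ⟨shap_reducible_countBySize (orClosure_computesORSubst C),
      countBySize_reducible_count (orClosure_computesORSubst C),
      count_reducible_shap (orClosure_computesORSubst C) (evalZero_inFP C)⟩,
    fun _ _ h => ⟨shap_reducible_countBySize h, countBySize_reducible_count h,
      count_reducible_shap h⟩⟩
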